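/- Let $\Omega\subset\mathbb R^3$ be a bounded Lipschitz domain and let $B\subset\Omega$ be a Lipschitz domain. Let $L\ge 0$, and let $\mathcal O$ be the set of all open sets $\omega\subset B$ with Lipschitz boundary with Lipschitz constant $L$ (near each boundary point, in suitable orthonormal coordinates, $\omega$ is one side of the graph of an $L$-Lipschitz function). Write $C^1(B)$ for the bounded continuously differentiable functions on $B$ with bounded derivative. Let $j_c>0$, $\kappa\in C^1(B)$ with $\kappa>0$, $E_d\in C^1(B;\mathbb R^3)$, $f\in L^2(\Omega;\mathbb R^3)\cap C^1(B;\mathbb R^3)$, and let $\epsilon,\nu\in L^\infty(\Omega;\mathbb R^{3\times3})\cap C^1(B;\mathbb R^{3\times 3})$ be symmetric and uniformly positive definite a.e. in $\Omega$. Let $H_0(\mathrm{curl})$ be the closure of $C_0^\infty(\Omega;\mathbb R^3)$ in $H(\mathrm{curl})=\{v\in L^2(\Omega;\mathbb R^3):\operatorname{curl}v\in L^2(\Omega;\mathbb R^3)\}$, where $\operatorname{curl}$ is understood in the distributional sense. For $\gamma>0$ put $$\max\nolimits_\gamma\{1,x\}=\begin{cases}x,& x-1\ge\frac1{2\gamma},\\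 1+\frac\gamma2\bigl(x-1+\frac1{2\gamma}\bigr)^2,&|x-1|\le\frac1{2\gamma},\\ 1,&x-1\le-\frac1{2\gamma},\end{cases}\qquad \Lambda_\gamma(e)=\frac{j_c\gamma e}{\max_\gamma\{1,\gamma|e|\}} .$$ For $\omega\subset B$ open, let $E^\gamma(\omega)\in H_0(\mathrm{curl})$ be the unique solution of $$\int_\Omega \nu\operatorname{curl}E^\gamma\cdot\operatorname{curl}v+\epsilon E^\gamma\cdot v\,dx+\int_\omega\Lambda_\gamma(E^\gamma)\cdot v\,dx=\int_\Omega f\cdot v\,dx\qquad\forall v\in H_0(\mathrm{curl}),$$ and set $J_\gamma(\omega)=\frac12\int_B\kappa|E^\gamma(\omega)-E_d|^2dx+\int_\omega dx$. For a Lipschitz vector field $\theta$ with compact support in $B$ and flow $T_t$, put $dJ_\gamma(\omega)(\theta)=\lim_{t\searrow0}\frac{J_\gamma(T_t(\omega))-J_\gamma(\omega)}t$. Fix such data and $\omega\in\mathcal O$. Then there is a constant $C$, depending on the data $(\Omega,B,j_c,\kappa,\epsilon,\nu,f,E_d)$ and on $\omega$ but not on $\gamma$ or $\theta$, such that for every $\gamma>0$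 the functional $J_\gamma$ is shape differentiable at $\omega$ (the limit $dJ_\gamma(\omega)(\theta)$ exists for every Lipschitz field $\theta$ with compact support in $B$, and is linear and continuous in $\theta$), and $$|dJ_\gamma(\omega)(\theta)|\le C\,\|\theta\|_{C^{0,1}(B)},\qquad \|\theta\|_{C^{0,1}(B)}=\sup_{x\in B}|\theta(x)|+\sup_{x\ne y\in B}\frac{|\theta(x)-\theta(y)|}{|x-y|},$$ for all Lipschitz vector fields $\theta$ with compact support in $B$. -/

import Mathlib

noncomputable section

namespace HTS

open MeasureTheory Filter Topology
open scoped NNReal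

/-- Three-dimensional Euclidean space, with the Euclidean norm. -/
abbrev E3 := EuclideanSpace ℝ (Fin 3)

/-- Real `3 × 3` matrices, viewed as linear maps acting on column vectors. -/
abbrev Mat3 := E3 →L[ℝ] E3

/-! ### Lipschitz domains and admissible shapes -/

/-- The boundary of `U` is locally, after a rigid motion, the graph of a function of two
variables with Lipschitz constant `L`, and `U` lies locally on exactly one side of it. -/
def HasLipschitzBoundaryWith (L : ℝ≥0) (U : Set E3) : Prop :=
  ∀ x₀ ∈ frontier U, ∃ (R : E3 ≃ₗᵢ[ℝ] E3) (g : EuclideanSpace ℝ (Fin 2) → ℝ) (r : ℝ),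
    LipschitzWith L g ∧ 0 < r ∧
      ∀ x ∈ Metric.ball x₀ r,
        (x ∈ U ↔ g !₂[R (x - x₀) 0, R (x - x₀) 1] < R (x - x₀) 2)

/-- Bounded Lipschitz domain: open, connected (and nonempty), bounded, Lipschitz boundary. -/
structure IsBoundedLipschitzDomain (U : Set E3) : Prop where
  isOpen : IsOpen U
  isConnected : IsConnected U
  isBounded : Bornology.IsBounded U
  lipschitz : ∃ L : ℝ≥0, HasLipschitzBoundaryWith L U

/-- The class `𝒪` of admissible shapes: open Lipschitz subsets of `B` with Lipschitz constant
`L`. They need not be connected. -/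
def admissibleShapes (B : Set E3) (L : ℝ≥0) : Set (Set E3) :=
  {ω | ω ⊆ B ∧ IsOpen ω ∧ HasLipschitzBoundaryWith L ω}

/-! ### The space `H₀(curl)` -/

/-- Partial derivative `∂ᵢ φⱼ` at `x`. -/
def partialDeriv (i j : Fin 3) (φ : E3 → E3) (x : E3) : ℝ :=
  fderiv ℝ φ x (EuclideanSpace.single i 1) j

/-- The classical curl. -/
def curl (φ : E3 → E3) (x : E3) : E3 :=
  !₂[partialDeriv 1 2 φ x - partialDeriv 2 1 φ x,
     partialDeriv 2 0 φ x - partialDeriv 0 2 φ x,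
     partialDeriv 0 1 φ x - partialDeriv 1 0 φ x]

/-- `φ` is a smooth vector field with compact support in `Ω`. -/
structure IsTestField (Ω : Set E3) (φ : E3 → E3) : Prop where
  smooth : ContDiff ℝ (⊤ : ℕ∞) φ
  compactSupport : HasCompactSupport φ
  support_subset : tsupport φ ⊆ Ω

/-- `u` belongs to `H(curl)` on `Ω` and `w` is its distributional curl. -/
structure IsHCurl (Ω : Set E3) (u w : E3 → E3) : Prop where
  memLp : MemLp u 2 (volume.restrict Ω)
  curl_memLp : MemLp w 2 (volume.restrict Ω)
  weak_curl : ∀ φ, IsTestField Ω φ →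
    ∫ x in Ω, inner ℝ (w x) (φ x) = ∫ x in Ω, inner ℝ (u x) (curl φ x)

/-- `u` belongs to `H₀(curl)` on `Ω`, the closure of the smooth compactly supported fields with
respect to the `H(curl)` norm, and `w` is its distributional curl. -/
structure IsHZeroCurl (Ω : Set E3) (u w : E3 → E3) : Prop extends IsHCurl Ω u w where
  approx : ∃ φ : ℕ → E3 → E3, (∀ n, IsTestField Ω (φ n)) ∧
    Tendsto (fun n => eLpNorm (fun x => φ n x - u x) 2 (volume.restrict Ω)) atTop (𝓝 0) ∧
    Tendsto (fun n => eLpNorm (fun x => curl (φ n) x - w x) 2 (volume.restrict Ω)) atTop (𝓝 0)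

/-! ### Data of the problem -/

/-- The space `C¹(B)` of an open set `B`, which carries the norm
`sup |g| + sup |Dg|`: continuously differentiable, bounded, with bounded derivative. -/
structure IsC1On {F : Type*} [NormedAddCommGroup F] [NormedSpace ℝ F]
    (B : Set E3) (g : E3 → F) : Prop where
  contDiffOn : ContDiffOn ℝ 1 g B
  bounded : ∃ M : ℝ, ∀ x ∈ B, ‖g x‖ ≤ M
  deriv_bounded : ∃ M : ℝ, ∀ x ∈ B, ‖fderiv ℝ g x‖ ≤ M

/-- The data. Functions given on `Ω` or on `B` are represented by functions on the whole space
whose values elsewhere are never used. -/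
structure ProblemData where
  /-- the hold-all domain -/
  Ω : Set E3
  /-- the region in which the shapes lie -/
  B : Set E3
  /-- critical current density -/
  jc : ℝ
  /-- weight of the tracking term -/
  κ : E3 → ℝ
  /-- target field -/
  Ed : E3 → E3
  /-- electric permittivity -/
  ε : E3 → Mat3
  /-- magnetic reluctivity -/
  ν : E3 → Mat3
  /-- applied current source -/
  f : E3 → E3

/-- A material parameter: in `L^∞(Ω)` and `C¹(B)`, symmetric, uniformly positive definite. -/
structure IsMaterialParameter (Ω B : Set E3) (μ : E3 → Mat3) : Prop where
  memLp : MemLp μ ⊤ (volume.restrict Ω)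
  c1 : IsC1On B μ
  symmetric : ∀ᵐ x ∂(volume.restrict Ω), ∀ ξ η : E3, inner ℝ (μ x ξ) η = inner ℝ ξ (μ x η)
  posDef : ∃ c : ℝ, 0 < c ∧
    ∀ᵐ x ∂(volume.restrict Ω), ∀ ξ : E3, c * ‖ξ‖ ^ 2 ≤ inner ℝ ξ (μ x ξ)

/-- The standing assumptions on the data. -/
structure ProblemData.Admissible (D : ProblemData) : Prop where
  omega_domain : IsBoundedLipschitzDomain D.Ω
  B_domain : IsBoundedLipschitzDomain D.B
  B_subset : D.B ⊆ D.Ω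
  Ed_c1 : IsC1On D.B D.Ed
  kappa_c1 : IsC1On D.B D.κ
  kappa_pos : ∀ x ∈ D.B, 0 < D.κ x
  jc_pos : 0 < D.jc
  eps_material : IsMaterialParameter D.Ω D.B D.ε
  nu_material : IsMaterialParameter D.Ω D.B D.ν
  f_memLp : MemLp D.f 2 (volume.restrict D.Ω)
  f_c1 : IsC1On D.B D.f

/-! ### The penalized problem -/

/-- The regularized maximum `max_γ {1, x}`. -/
def maxReg (γ x : ℝ) : ℝ :=
  if 1 / (2 * γ) ≤ x - 1 then x
  else if |x - 1| ≤ 1 / (2 * γ) then 1 + γ / 2 * (x - 1 + 1 / (2 * γ)) ^ 2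
  else 1

/-- The dual variable `j_c γ e / max_γ {1, γ |e|}`. -/
def dualVar (jc γ : ℝ) (e : E3) : E3 :=
  (jc * γ / maxReg γ (γ * ‖e‖)) • e

/-- `E ∈ H₀(curl)` solves the penalized dual formulation on the shape `ω`:
`a(E, v) + ∫_ω λ · v = ∫_Ω f · v` for all `v ∈ H₀(curl)`, where
`a(E, v) = ∫_Ω ν curl E · curl v + ∫_Ω ε E · v` and `λ` is the dual variable of `E`. -/
def ProblemData.IsState (D : ProblemData) (γ : ℝ) (ω : Set E3) (E : E3 → E3) : Prop :=
  ∃ cE : E3 → E3, IsHZeroCurl D.Ω E cE ∧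
    ∀ v cv : E3 → E3, IsHZeroCurl D.Ω v cv →
      (∫ x in D.Ω, inner ℝ (D.ν x (cE x)) (cv x)) + (∫ x in D.Ω, inner ℝ (D.ε x (E x)) (v x))
        + (∫ x in ω, inner ℝ (dualVar D.jc γ (E x)) (v x))
      = ∫ x in D.Ω, inner ℝ (D.f x) (v x)

/-- The state `E^γ(ω)`: the solution of the penalized formulation. For admissible data it exists
and is unique up to equality almost everywhere in `Ω`. -/
def ProblemData.state (D : ProblemData) (γ : ℝ) (ω : Set E3) : E3 → E3 :=
  Classical.epsilon (D.IsState γ ω)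

/-- The shape functional `J_γ(ω) = 1/2 ∫_B κ |E^γ(ω) - E_d|² + ∫_ω 1`. -/
def ProblemData.J (D : ProblemData) (γ : ℝ) (ω : Set E3) : ℝ :=
  1 / 2 * (∫ x in D.B, D.κ x * ‖D.state γ ω x - D.Ed x‖ ^ 2) + ∫ _x in ω, (1 : ℝ)

/-! ### Shape derivatives -/

/-- Lipschitz vector fields with compact support contained in `B`, extended by zero. -/
def lipschitzFields (B : Set E3) : Submodule ℝ (E3 → E3) where
  carrier := {θ | (∃ K : ℝ≥0, LipschitzWith K θ) ∧ HasCompactSupport θ ∧ tsupport θ ⊆ B}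
  zero_mem' := ⟨⟨0, LipschitzWith.const 0⟩, HasCompactSupport.zero, by simp⟩
  add_mem' := by
    rintro a b ⟨⟨K, hK⟩, ha, ha'⟩ ⟨⟨M, hM⟩, hb, hb'⟩
    exact ⟨⟨K + M, hK.add hM⟩, ha.add hb,
      (tsupport_add a b).trans (Set.union_subset ha' hb')⟩
  smul_mem' := by
    rintro c a ⟨⟨K, hK⟩, ha, ha'⟩
    refine ⟨⟨‖c‖₊ * K, (lipschitzWith_smul c).comp hK⟩, ?_, ?_⟩
    · exact ha.smul_left (f := fun _ => c)
    · exact (tsupport_smul_subset_right (fun _ => c) a).trans ha'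

/-- The norm `sup |θ(x)| + sup |θ(x) - θ(y)| / |x - y|` of `C^{0,1}(B)`. Both suprema are finite
for the fields in `lipschitzFields B`. -/
def lipNorm (B : Set E3) (θ : E3 → E3) : ℝ :=
  (⨆ x : B, ‖θ x‖) + ⨆ p : B × B, ‖θ p.1 - θ p.2‖ / ‖(p.1 : E3) - p.2‖

/-- The transported set `T_t(ω)`, where `T_t` is the flow of `θ`: the endpoints `x(t)` of the
solutions of `x' = θ(x)` on `[0, t]` with `x(0) ∈ ω`. -/
def flowImage (θ : E3 → E3) (t : ℝ) (ω : Set E3) : Set E3 :=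
  {y | ∃ x : ℝ → E3, x 0 ∈ ω ∧ x t = y ∧
    ∀ s ∈ Set.Icc 0 t, HasDerivWithinAt x (θ (x s)) (Set.Icc 0 t) s}

/-- `d` is the Eulerian semiderivative of `K` at `ω` in direction `θ`. -/
def HasEulerianSemiderivative (K : Set E3 → ℝ) (ω : Set E3) (θ : E3 → E3) (d : ℝ) : Prop :=
  Tendsto (fun t : ℝ => (K (flowImage θ t ω) - K ω) / t) (𝓝[>] 0) (𝓝 d)

/-- `K` is shape differentiable at `ω` with shape derivative `dK`: the Eulerian semiderivatives
in all directions supported in `B` exist and form the linear continuous functional `dK`. -/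
structure HasShapeDerivative (B : Set E3) (K : Set E3 → ℝ) (ω : Set E3)
    (dK : lipschitzFields B →ₗ[ℝ] ℝ) : Prop where
  semiderivative : ∀ θ : lipschitzFields B, HasEulerianSemiderivative K ω θ (dK θ)
  continuous : ∃ c : ℝ, ∀ θ : lipschitzFields B, |dK θ| ≤ c * lipNorm B θ

end HTS

end

noncomputable section

namespace HTS

open MeasureTheory Filter Topology
open scoped NNReal


/-! ### The dual variable -/

/-! Write $E_t$ for the state on $T_t(\omega)$ and $R_t=(DT_t-1)/t$. Everything is pulled back to
the fixed shape $\omega$. The covariant pull-back $DT_t^\top(E_t\circ T_t)$ lies in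
$H_0(\mathrm{curl})$, with curl $\operatorname{adj}(DT_t)\,(\operatorname{curl}E_t\circ T_t)$
(`IsDeformation.inHZero_pull`). Testing the equation on $T_t(\omega)$ with pull-backs under
$T_t^{-1}$ and changing variables gives an equation on $\omega$ whose coefficients differ from the
original ones by $t$ times bounded families (`pert_state`). The unknown is kept as the plain
composition $e_t=E_t\circ T_t$, so that the nonlinearity remains $\Lambda_\gamma(e_t)$; the price is
that $(1+tR_t^\top)e_t$, and not $e_t$, belongs to the space.

Since $\theta$ is only Lipschitz, $R_t\to D\theta$ is available only in the weak-star sense. This is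
enough, as the abstract `TransportedProblem` shows. Strong monotonicity bounds the quotients
$(e_t-E)/t$ and $(u_t-w)/t$ (`bddFam_quotient`), where $u_t=\operatorname{curl}E_t\circ T_t$ and
$w=\operatorname{curl}E$. Testing with the adjoint state $(p,q)$ removes these quotients from the
derivative of the tracking term, and each remaining term pairs a weakly convergent factor with a
strongly convergent one, or a bounded factor with a null one (`tendsto_quotient`). The limit is the
explicit expression `sensitivity`, linear in $\theta$; the volume contributes
$\int_\omega\operatorname{div}\theta$.

Uniformity in $\gamma$ comes from signs and from one pointwise bound. The state is bounded by
coercivity because $\Lambda_\gamma(e)\cdot e\ge 0$, and the adjoint state because $\Lambda_\gamma'$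
is positive semidefinite (`norm_le_of_solution`). In the derivative formula the reaction enters only
through $\Lambda_\gamma(E)$, which is at most $j_c$, and through $\Lambda_\gamma'(E)\,D\theta^\top
E$. The norm of $\Lambda_\gamma'$ can reach $j_c\gamma$, but $|\Lambda_\gamma'(e)|\,|e|\le 2j_c$
(`norm_fderiv_dualVar_mul_le`), so this term is bounded as well. The Lipschitz constant of
$\Lambda_\gamma$, which does grow with $\gamma$, is used only for solvability and for the existence
of the limit, never in the final estimate. -/

theorem hasDerivAt_sq_posPart (y : ℝ) : HasDerivAt (fun y : ℝ => max y 0 ^ 2) (2 * max y 0) y := by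
  rcases lt_trichotomy y 0 with h | h | h
  · have : (fun y : ℝ => max y 0 ^ 2) =ᶠ[𝓝 y] fun _ => 0 := by
      filter_upwards [gt_mem_nhds h] with z hz
      simp [max_eq_right (le_of_lt hz)]
    rw [max_eq_right h.le, mul_zero]
    exact (hasDerivAt_const y (0 : ℝ)).congr_of_eventuallyEq this
  · subst h
    rw [hasDerivAt_iff_isLittleO]
    simp only [max_self, mul_zero, smul_zero, sub_zero, ne_eq, OfNat.ofNat_ne_zero,
      not_false_eq_true, zero_pow]
    have h1 : (fun y : ℝ => max y 0 ^ 2) =O[𝓝 0] fun y : ℝ => y ^ 2 := by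
      refine Asymptotics.IsBigO.of_bound 1 (Eventually.of_forall fun z => ?_)
      rw [one_mul, norm_pow, norm_pow]
      gcongr
      rw [Real.norm_eq_abs, Real.norm_eq_abs, abs_of_nonneg (le_max_right _ _)]
      exact max_le (le_abs_self _) (abs_nonneg _)
    refine h1.trans_isLittleO ?_
    simpa using Asymptotics.isLittleO_pow_id (𝕜 := ℝ) (n := 2) (by norm_num)
  · have : (fun y : ℝ => max y 0 ^ 2) =ᶠ[𝓝 y] fun y => y ^ 2 := by
      filter_upwards [lt_mem_nhds h] with z hz
      simp [max_eq_left (le_of_lt hz)]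
    rw [max_eq_left h.le]
    simpa using (hasDerivAt_pow 2 y).congr_of_eventuallyEq this

/-- As a difference of two squared positive parts the function is visibly $C^1$ across both
junctions, so its derivative needs no case distinction. -/
theorem maxReg_eq {γ : ℝ} (hγ : 0 < γ) (x : ℝ) :
    maxReg γ x = 1 + γ / 2 *
      (max (x - 1 + 1 / (2 * γ)) 0 ^ 2 - max (x - 1 - 1 / (2 * γ)) 0 ^ 2) := by
  have hd : 0 < 1 / (2 * γ) := by positivity
  have hgd : γ * (1 / (2 * γ)) = 1 / 2 := by field_simp
  unfold maxReg
  generalize 1 / (2 * γ) = d at *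
  split_ifs with h1 h2
  · rw [max_eq_left (by linarith), max_eq_left (by linarith)]
    linear_combination (-2 * (x - 1)) * hgd
  · rw [abs_le] at h2
    rw [max_eq_left (by linarith), max_eq_right (by linarith)]
    ring
  · have : x - 1 < -d := by
      by_contra h
      exact h2 (abs_le.2 ⟨by linarith, by linarith⟩)
    rw [max_eq_right (by linarith), max_eq_right (by linarith)]
    ring

/-- The derivative of `maxReg`. -/
def maxRegDeriv (γ x : ℝ) : ℝ :=
  γ * (max (x - 1 + 1 / (2 * γ)) 0 - max (x - 1 - 1 / (2 * γ)) 0)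

theorem hasDerivAt_maxReg {γ : ℝ} (hγ : 0 < γ) (x : ℝ) :
    HasDerivAt (maxReg γ) (maxRegDeriv γ x) x := by
  have h1 := (hasDerivAt_sq_posPart (x - 1 + 1 / (2 * γ))).comp x
    (((hasDerivAt_id x).sub_const 1).add_const (1 / (2 * γ)))
  have h2 := (hasDerivAt_sq_posPart (x - 1 - 1 / (2 * γ))).comp x
    (((hasDerivAt_id x).sub_const 1).sub_const (1 / (2 * γ)))
  have h3 := ((h1.sub h2).const_mul (γ / 2)).const_add 1
  refine (h3.congr_of_eventuallyEq (Eventually.of_forall fun y => ?_)).congr_deriv ?_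
  · simp [maxReg_eq hγ]
  · simp only [maxRegDeriv]
    ring

theorem maxRegDeriv_nonneg {γ : ℝ} (hγ : 0 < γ) (x : ℝ) : 0 ≤ maxRegDeriv γ x := by
  have hd : 0 < 1 / (2 * γ) := by positivity
  refine mul_nonneg hγ.le (sub_nonneg.2 (max_le_max (by linarith) le_rfl))

theorem one_le_maxReg {γ : ℝ} (hγ : 0 < γ) (x : ℝ) : 1 ≤ maxReg γ x := by
  have hd : 0 < 1 / (2 * γ) := by positivity
  rw [maxReg_eq hγ]
  have : max (x - 1 - 1 / (2 * γ)) 0 ^ 2 ≤ max (x - 1 + 1 / (2 * γ)) 0 ^ 2 :=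
    pow_le_pow_left₀ (le_max_right _ _) (max_le_max (by linarith) le_rfl) 2
  nlinarith

theorem le_maxReg {γ : ℝ} (hγ : 0 < γ) (x : ℝ) : x ≤ maxReg γ x := by
  have hgd : γ * (1 / (2 * γ)) = 1 / 2 := by field_simp
  have hd : 0 < 1 / (2 * γ) := by positivity
  unfold maxReg
  generalize 1 / (2 * γ) = d at *
  split_ifs with h1 h2
  · exact le_rfl
  · have : 0 ≤ γ / 2 * (x - 1 - d) ^ 2 := by positivity
    linear_combination this + (-2 * (x - 1)) * hgd
  · have : x - 1 < -d := by
      by_contra h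
      exact h2 (abs_le.2 ⟨by linarith, by linarith⟩)
    linarith

/-- The gap between the two sides is the intercept at $0$ of the tangent at $x$; by convexity it
decreases on $x\ge 0$, and it is zero once $\max_\gamma\{1,x\}=x$. This inequality is the origin of
both the monotonicity of the dual variable and the $\gamma$-free bound on
$|\Lambda_\gamma'(e)|\,|e|$. -/
theorem mul_maxRegDeriv_le {γ : ℝ} (hγ : 0 < γ) {x : ℝ} (hx : 0 ≤ x) :
    x * maxRegDeriv γ x ≤ maxReg γ x := by
  have hgd : γ * (1 / (2 * γ)) = 1 / 2 := by field_simp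
  have hd : 0 < 1 / (2 * γ) := by positivity
  unfold maxReg maxRegDeriv
  generalize 1 / (2 * γ) = d at *
  split_ifs with h1 h2
  · rw [max_eq_left (by linarith), max_eq_left (by linarith)]
    linear_combination (2 * x) * hgd
  · rw [abs_le] at h2
    rw [max_eq_left (by linarith), max_eq_right (by linarith)]
    -- On the quadratic branch the gap is exactly $\frac\gamma2\bigl((1+d)^2-x^2\bigr)$, because
    -- $2\gamma d=1$.
    have h3 : 0 ≤ γ / 2 * ((1 + d - x) * (1 + d + x)) :=
      mul_nonneg (by positivity) (mul_nonneg (by linarith) (by linarith))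
    nlinarith
  · have : x - 1 < -d := by
      by_contra h
      exact h2 (abs_le.2 ⟨by linarith, by linarith⟩)
    rw [max_eq_right (by linarith), max_eq_right (by linarith)]
    simp

/-- Differentiability, at every point, of a radial field `φ(|e|) e`. -/
theorem hasFDerivAt_radial {φ φ' : ℝ → ℝ} (hφ : ∀ r, HasDerivAt φ (φ' r) r) (e : E3) :
    HasFDerivAt (fun x : E3 => φ ‖x‖ • x)
      (φ ‖e‖ • ContinuousLinearMap.id ℝ E3
        + ((φ' ‖e‖ * ‖e‖⁻¹) • innerSL ℝ e).smulRight e) e := by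
  -- At the origin the rank-one part of the claimed derivative vanishes, and continuity of `φ` alone
  -- gives $\varphi(|x|)x=\varphi(0)x+o(|x|)$. Elsewhere the norm is differentiable and the product
  -- rule applies.
  by_cases he : e = 0
  · subst he
    have hc : Tendsto (fun x : E3 => φ ‖x‖ - φ 0) (𝓝 0) (𝓝 0) := by
      have : Tendsto (fun x : E3 => φ ‖x‖) (𝓝 0) (𝓝 (φ ‖(0 : E3)‖)) :=
        ((hφ _).continuousAt.comp_of_eq continuous_norm.continuousAt rfl)
      simpa using this.sub_const (φ 0)
    rw [hasFDerivAt_iff_isLittleO]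
    have h1 : (fun x : E3 => (φ ‖x‖ - φ 0) • x) =o[𝓝 0] fun x : E3 => x := by
      have := (Asymptotics.isLittleO_one_iff ℝ).2 hc |>.smul_isBigO
        (Asymptotics.isBigO_refl (fun x : E3 => x) (𝓝 0))
      simpa using this
    refine (h1.congr_left fun x => ?_).congr_right fun x => (sub_zero x).symm
    simp [sub_smul]
  · have hn : HasFDerivAt (fun x : E3 => ‖x‖) (‖e‖⁻¹ • innerSL ℝ e) e := by
      have h2 : ‖e‖ ^ 2 ≠ 0 := pow_ne_zero _ (norm_ne_zero_iff.2 he)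
      have h1 := (hasStrictFDerivAt_norm_sq e).hasFDerivAt.sqrt h2
      refine (h1.congr_of_eventuallyEq (Eventually.of_forall fun x => ?_)).congr_fderiv ?_
      · simp [Real.sqrt_sq (norm_nonneg _)]
      · ext v
        simp [Real.sqrt_sq (norm_nonneg _)]
        ring
    have h1 := ((hφ ‖e‖).comp_hasFDerivAt e hn).smul (hasFDerivAt_id e)
    refine h1.congr_fderiv ?_
    ext v i
    simp only [Function.comp_apply, id_eq, add_apply, smul_apply, ContinuousLinearMap.id_apply,
      ContinuousLinearMap.smulRight_apply, innerSL_apply_apply, smul_eq_mul, PiLp.add_apply,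
      PiLp.smul_apply]
    ring

/-- Pointwise derivative of the dual variable, with the bounds used throughout. -/
theorem exists_hasFDerivAt_dualVar {jc γ : ℝ} (hj : 0 < jc) (hγ : 0 < γ) (e : E3) :
    ∃ A : Mat3, HasFDerivAt (dualVar jc γ) A e ∧ (∀ h, 0 ≤ inner ℝ (A h) h) ∧
      ‖A‖ ≤ 2 * (jc * γ) ∧ ‖A‖ * ‖e‖ ≤ 2 * jc := by
  set φ : ℝ → ℝ := fun r => jc * γ / maxReg γ (γ * r) with hφd
  set φ' : ℝ → ℝ := fun r => -(jc * γ * (maxRegDeriv γ (γ * r) * γ)) / maxReg γ (γ * r) ^ 2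
    with hφ'd
  have hm : ∀ x, 0 < maxReg γ x := fun x => lt_of_lt_of_le one_pos (one_le_maxReg hγ x)
  have hφ : ∀ r, HasDerivAt φ (φ' r) r := fun r => by
    have h1 : HasDerivAt (fun r => maxReg γ (γ * r)) (maxRegDeriv γ (γ * r) * γ) r := by
      simpa using! (hasDerivAt_maxReg hγ (γ * r)).comp r ((hasDerivAt_id r).const_mul γ)
    simpa [hφd, hφ'd] using! (hasDerivAt_const r (jc * γ)).div h1 (hm _).ne'
  have hpos : 0 < φ ‖e‖ := div_pos (mul_pos hj hγ) (hm _)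
  have hle : φ ‖e‖ ≤ jc * γ := div_le_self (mul_pos hj hγ).le (one_le_maxReg hγ _)
  have hle2 : φ ‖e‖ * ‖e‖ ≤ jc := by
    rw [hφd]
    simp only
    rw [div_mul_eq_mul_div, div_le_iff₀ (hm _)]
    have := le_maxReg hγ (γ * ‖e‖)
    nlinarith
  have hneg : φ' ‖e‖ ≤ 0 := by
    have := maxRegDeriv_nonneg hγ (γ * ‖e‖)
    exact div_nonpos_of_nonpos_of_nonneg (by
      have : 0 ≤ jc * γ * (maxRegDeriv γ (γ * ‖e‖) * γ) := by positivity
      linarith) (by positivity)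
  -- The derivative has eigenvalue $\varphi$ on $e^\perp$ and $\varphi+\varphi' r$ in the radial
  -- direction. This says that the radial one is nonnegative, and it is `mul_maxRegDeriv_le` at
  -- $x=\gamma r$.
  have hder : -(φ' ‖e‖ * ‖e‖) ≤ φ ‖e‖ := by
    have h1 := mul_maxRegDeriv_le hγ (x := γ * ‖e‖) (by positivity)
    rw [hφd, hφ'd]
    simp only
    rw [neg_div, neg_mul, neg_neg, div_mul_eq_mul_div, div_le_div_iff₀ (pow_pos (hm _) 2) (hm _)]
    have h2 := mul_le_mul_of_nonneg_left h1 (by have := hm (γ * ‖e‖); positivity :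
      0 ≤ jc * γ * maxReg γ (γ * ‖e‖))
    nlinarith
  refine ⟨_, hasFDerivAt_radial hφ e, fun h => ?_, ?_⟩
  · simp only [add_apply, smul_apply,
      ContinuousLinearMap.smulRight_apply, ContinuousLinearMap.id_apply, innerSL_apply_apply,
      inner_add_left, real_inner_smul_left, smul_eq_mul, real_inner_self_eq_norm_sq]
    rcases eq_or_ne e 0 with rfl | he
    · simp only [inner_zero_left, mul_zero, add_zero]
      positivity
    · have hr : 0 < ‖e‖ := norm_pos_iff.2 he
      have hcs : inner ℝ e h * inner ℝ e h ≤ ‖e‖ ^ 2 * ‖h‖ ^ 2 := by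
        have := real_inner_mul_inner_self_le e h
        simpa [real_inner_self_eq_norm_sq] using this
      have h1 : -(φ' ‖e‖) * ‖e‖⁻¹ * (inner ℝ e h * inner ℝ e h)
          ≤ -(φ' ‖e‖) * ‖e‖⁻¹ * (‖e‖ ^ 2 * ‖h‖ ^ 2) :=
        mul_le_mul_of_nonneg_left hcs (mul_nonneg (by linarith) (by positivity))
      have h2 : -(φ' ‖e‖) * ‖e‖⁻¹ * (‖e‖ ^ 2 * ‖h‖ ^ 2) = -(φ' ‖e‖ * ‖e‖) * ‖h‖ ^ 2 := by
        field_simp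
      have h3 := mul_le_mul_of_nonneg_right hder (sq_nonneg ‖h‖)
      nlinarith
  -- Both norm bounds follow from $\|A\|\le\varphi+|\varphi'|r\le 2\varphi$, once with $\varphi\le
  -- j_c\gamma$ and once with $\varphi r\le j_c$.
  · have hA : ‖φ ‖e‖ • ContinuousLinearMap.id ℝ E3
        + ((φ' ‖e‖ * ‖e‖⁻¹) • innerSL ℝ e).smulRight e‖ ≤ 2 * φ ‖e‖ := by
      refine ContinuousLinearMap.opNorm_le_bound _ (by positivity) fun h => ?_
      simp only [add_apply, smul_apply,
        ContinuousLinearMap.smulRight_apply, ContinuousLinearMap.id_apply, innerSL_apply_apply,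
        smul_eq_mul]
      refine (norm_add_le _ _).trans ?_
      rw [norm_smul, norm_smul, Real.norm_eq_abs, Real.norm_eq_abs, abs_of_pos hpos, abs_mul,
        abs_mul, abs_of_nonpos hneg, abs_inv, abs_norm]
      rcases eq_or_ne e 0 with rfl | he
      · simp only [norm_zero, mul_zero, add_zero] at hpos ⊢
        nlinarith [norm_nonneg h]
      · have hr : 0 < ‖e‖ := norm_pos_iff.2 he
        have hcs := abs_real_inner_le_norm e h
        have h1 : -(φ' ‖e‖) * ‖e‖⁻¹ * |inner ℝ e h| * ‖e‖
            ≤ -(φ' ‖e‖) * ‖e‖⁻¹ * (‖e‖ * ‖h‖) * ‖e‖ := by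
          have : 0 ≤ -(φ' ‖e‖) * ‖e‖⁻¹ := mul_nonneg (by linarith) (by positivity)
          gcongr
        have h2 : -(φ' ‖e‖) * ‖e‖⁻¹ * (‖e‖ * ‖h‖) * ‖e‖ = -(φ' ‖e‖ * ‖e‖) * ‖h‖ := by
          field_simp
        have h3 := mul_le_mul_of_nonneg_right hder (norm_nonneg h)
        linarith
    exact ⟨hA.trans (by linarith),
      (mul_le_mul_of_nonneg_right hA (norm_nonneg _)).trans (by linarith)⟩

section dualVar

variable {jc γ : ℝ} (hj : 0 < jc) (hγ : 0 < γ)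
include hj hγ

theorem hasFDerivAt_dualVar (e : E3) :
    HasFDerivAt (dualVar jc γ) (fderiv ℝ (dualVar jc γ) e) e := by
  obtain ⟨A, h, -⟩ := exists_hasFDerivAt_dualVar hj hγ e
  exact h.differentiableAt.hasFDerivAt

theorem inner_fderiv_dualVar_nonneg (e h : E3) :
    0 ≤ inner ℝ (fderiv ℝ (dualVar jc γ) e h) h := by
  obtain ⟨A, h1, h2, -⟩ := exists_hasFDerivAt_dualVar hj hγ e
  rw [h1.fderiv]
  exact h2 h

theorem norm_fderiv_dualVar_le (e : E3) : ‖fderiv ℝ (dualVar jc γ) e‖ ≤ 2 * (jc * γ) := by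
  obtain ⟨A, h1, -, h2, -⟩ := exists_hasFDerivAt_dualVar hj hγ e
  rwa [h1.fderiv]

theorem norm_fderiv_dualVar_mul_le (e : E3) : ‖fderiv ℝ (dualVar jc γ) e‖ * ‖e‖ ≤ 2 * jc := by
  obtain ⟨A, h1, -, -, h2⟩ := exists_hasFDerivAt_dualVar hj hγ e
  rwa [h1.fderiv]

theorem norm_dualVar_le (e : E3) : ‖dualVar jc γ e‖ ≤ jc := by
  have hm : 0 < maxReg γ (γ * ‖e‖) := lt_of_lt_of_le one_pos (one_le_maxReg hγ _)
  rw [dualVar, norm_smul, Real.norm_eq_abs, abs_of_pos (div_pos (mul_pos hj hγ) hm),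
    div_mul_eq_mul_div, div_le_iff₀ hm]
  have := le_maxReg hγ (γ * ‖e‖)
  nlinarith

theorem lipschitzWith_dualVar : LipschitzWith (2 * (jc * γ)).toNNReal (dualVar jc γ) := by
  refine lipschitzWith_of_nnnorm_fderiv_le
    (fun e => (hasFDerivAt_dualVar hj hγ e).differentiableAt) fun e => ?_
  rw [← NNReal.coe_le_coe, Real.coe_toNNReal _ (by positivity)]
  exact norm_fderiv_dualVar_le hj hγ e

/-- The derivative is positive semidefinite at every point, so the pairing with $a-b$ increases
along the segment from $b$ to $a$. -/
theorem dualVar_monotone (a b : E3) :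
    0 ≤ inner ℝ (dualVar jc γ a - dualVar jc γ b) (a - b) := by
  set g : ℝ → ℝ := fun s => inner ℝ (dualVar jc γ (b + s • (a - b))) (a - b)
  have hg : ∀ s, HasDerivAt g
      (inner ℝ (fderiv ℝ (dualVar jc γ) (b + s • (a - b)) (a - b)) (a - b)) s := fun s => by
    have h1 : HasDerivAt (fun s : ℝ => b + s • (a - b)) (a - b) s := by
      simpa using ((hasDerivAt_id s).smul_const (a - b)).const_add b
    have h2 := (hasFDerivAt_dualVar hj hγ (b + s • (a - b))).comp_hasDerivAt s h1
    simpa using! h2.inner ℝ (hasDerivAt_const s (a - b))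
  have hmono : Monotone g := monotone_of_deriv_nonneg (fun s => (hg s).differentiableAt)
    fun s => by rw [(hg s).deriv]; exact inner_fderiv_dualVar_nonneg hj hγ _ _
  have := hmono (zero_le_one : (0 : ℝ) ≤ 1)
  simp only [g, zero_smul, add_zero, one_smul, add_sub_cancel] at this
  rw [inner_sub_left]
  linarith

end dualVar

theorem dualVar_zero (jc γ : ℝ) : dualVar jc γ 0 = 0 := by simp [dualVar]

/-! ### Strongly monotone equations on a subspace of a Hilbert space -/

section Hilbert

variable {X : Type*} [NormedAddCommGroup X] [InnerProductSpace ℝ X]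

/-- Zarantonello's theorem, in Galerkin form on a complete subspace. -/
theorem exists_mem_forall_inner_eq_zero (H : Submodule ℝ X) [CompleteSpace H] (Ψ : X → X)
    {K : ℝ≥0} (hK : LipschitzWith K Ψ) {c : ℝ} (hc : 0 < c)
    (hmono : ∀ x ∈ H, ∀ y ∈ H, c * ‖x - y‖ ^ 2 ≤ inner ℝ (Ψ x - Ψ y) (x - y)) :
    ∃ x ∈ H, ∀ y ∈ H, inner ℝ (Ψ x) y = 0 := by
  set D : ℝ := (K : ℝ) ^ 2 + c ^ 2
  have hD : 0 < D := by positivity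
  -- The natural step is $c/K^2$; adding $c^2$ to the denominator keeps it positive when $K=0$ and
  -- forces $\tau c\le 1$, so that the square root below is meaningful.
  set τ : ℝ := c / D with hτ
  have hτ0 : 0 < τ := by positivity
  have hq : 1 - 2 * τ * c + τ ^ 2 * (K : ℝ) ^ 2 ≤ 1 - τ * c := by
    have : τ * (K : ℝ) ^ 2 ≤ c := by
      rw [hτ, div_mul_eq_mul_div, div_le_iff₀ hD]
      have : (K : ℝ) ^ 2 ≤ D := by simp only [D]; nlinarith
      gcongr
    nlinarith
  have hτc : 0 < τ * c := by positivity
  have hτc1 : τ * c ≤ 1 := by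
    rw [hτ, div_mul_eq_mul_div, div_le_one hD]
    simp only [D]
    nlinarith [sq_nonneg (K : ℝ)]
  -- Banach's fixed point theorem for the damped projected iteration: a fixed point is exactly a
  -- point where the projection of `Ψ x` onto `H` vanishes.
  let G : H → H := fun x => x - τ • H.orthogonalProjectionOnto (Ψ x)
  have hG : ∀ x y : H, ‖G x - G y‖ ^ 2 ≤ (1 - τ * c) * ‖x - y‖ ^ 2 := fun x y => by
    have h1 : G x - G y = (x - y) - τ • H.orthogonalProjectionOnto (Ψ x - Ψ y) := by
      simp only [G, map_sub, smul_sub]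
      abel
    have h2 : inner ℝ (x - y) (H.orthogonalProjectionOnto (Ψ x - Ψ y))
        = inner ℝ (Ψ x - Ψ y) ((x : X) - y) := by
      rw [Submodule.inner_orthogonalProjectionOnto_eq_of_mem_left, real_inner_comm]
      rfl
    have h3 : ‖H.orthogonalProjectionOnto (Ψ x - Ψ y)‖ ≤ K * ‖x - y‖ :=
      (H.norm_orthogonalProjectionOnto_apply_le _).trans (hK.norm_sub_le x y)
    have h4 := hmono x x.2 y y.2
    have h5 : ‖(x : X) - y‖ = ‖x - y‖ := rfl
    rw [h1, norm_sub_sq_real, real_inner_smul_right, h2, norm_smul, Real.norm_eq_abs, mul_pow,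
      sq_abs]
    rw [h5] at h4
    have h6 := pow_le_pow_left₀ (norm_nonneg _) h3 2
    rw [mul_pow] at h6
    have h7 := mul_le_mul_of_nonneg_left h6 (sq_nonneg τ)
    have h8 := mul_le_mul_of_nonneg_left h4 hτ0.le
    have h9 := mul_le_mul_of_nonneg_right hq (sq_nonneg ‖x - y‖)
    nlinarith
  have hcontr : ContractingWith (Real.sqrt (1 - τ * c)).toNNReal G := by
    constructor
    · rw [← NNReal.coe_lt_coe, Real.coe_toNNReal _ (Real.sqrt_nonneg _), NNReal.coe_one,
        Real.sqrt_lt' one_pos]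
      linarith
    · refine LipschitzWith.of_dist_le_mul fun x y => ?_
      rw [Real.coe_toNNReal _ (Real.sqrt_nonneg _), dist_eq_norm, dist_eq_norm]
      refine abs_le_of_sq_le_sq' ?_ (by positivity) |>.2
      rw [mul_pow, Real.sq_sqrt (by linarith)]
      exact hG x y
  have hfix := hcontr.fixedPoint_isFixedPt
  set x := ContractingWith.fixedPoint G hcontr
  have hx : H.orthogonalProjectionOnto (Ψ x) = 0 := by
    have : x - τ • H.orthogonalProjectionOnto (Ψ x) = x := hfix
    have h := sub_eq_self.1 this
    exact (smul_eq_zero.1 h).resolve_left hτ0.ne'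
  refine ⟨x, x.2, fun y hy => ?_⟩
  rw [← Submodule.inner_orthogonalProjectionOnto_eq_of_mem_right ⟨y, hy⟩, hx]
  simp

end Hilbert

/-! ### Sensitivity of perturbed variational equations -/

section Sensitivity

variable {V : Type*} [NormedAddCommGroup V] [InnerProductSpace ℝ V]
variable {F : Type*} [NormedAddCommGroup F]

/-- A family that stays bounded as the parameter decreases to `0`. -/
def BddFam (u : ℝ → F) : Prop := ∃ M : ℝ, ∀ᶠ t in 𝓝[>] (0 : ℝ), ‖u t‖ ≤ M

namespace BddFam

theorem const (a : F) : BddFam fun _ => a := ⟨‖a‖, Eventually.of_forall fun _ => le_rfl⟩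

theorem add {u v : ℝ → F} (hu : BddFam u) (hv : BddFam v) : BddFam fun t => u t + v t := by
  obtain ⟨M, hM⟩ := hu
  obtain ⟨M', hM'⟩ := hv
  exact ⟨M + M', by filter_upwards [hM, hM'] with t h h' using (norm_add_le _ _).trans (by gcongr)⟩

theorem neg {u : ℝ → F} (hu : BddFam u) : BddFam fun t => -u t := by
  obtain ⟨M, hM⟩ := hu
  exact ⟨M, by simpa using hM⟩

theorem sub {u v : ℝ → F} (hu : BddFam u) (hv : BddFam v) : BddFam fun t => u t - v t := by
  simpa [sub_eq_add_neg] using hu.add hv.neg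

theorem smul [NormedSpace ℝ F] {u : ℝ → F} (hu : BddFam u) : BddFam fun t => t • u t := by
  obtain ⟨M, hM⟩ := hu
  refine ⟨M, ?_⟩
  filter_upwards [hM, Ioo_mem_nhdsGT (zero_lt_one : (0 : ℝ) < 1)] with t h ht
  rw [norm_smul, Real.norm_eq_abs, abs_of_pos ht.1]
  nlinarith [norm_nonneg (u t), ht.2]

theorem apply {A : ℝ → V →L[ℝ] V} {u : ℝ → V} (hA : BddFam A) (hu : BddFam u) :
    BddFam fun t => A t (u t) := by
  obtain ⟨M, hM⟩ := hA
  obtain ⟨M', hM'⟩ := hu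
  refine ⟨M * M', ?_⟩
  filter_upwards [hM, hM'] with t h h'
  exact ((A t).le_opNorm _).trans (mul_le_mul h h' (norm_nonneg _) ((norm_nonneg _).trans h))

theorem tendsto_smul [NormedSpace ℝ F] {u : ℝ → F} (hu : BddFam u) :
    Tendsto (fun t => t • u t) (𝓝[>] (0 : ℝ)) (𝓝 0) := by
  obtain ⟨M, hM⟩ := hu
  have h0 : Tendsto (fun t : ℝ => |t| * M) (𝓝[>] (0 : ℝ)) (𝓝 0) := by
    have : Tendsto (fun t : ℝ => |t| * M) (𝓝 (0 : ℝ)) (𝓝 (|0| * M)) :=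
      (continuous_abs.mul continuous_const).tendsto 0
    simpa using this.mono_left nhdsWithin_le_nhds
  refine squeeze_zero_norm' ?_ h0
  filter_upwards [hM] with t ht
  rw [norm_smul, Real.norm_eq_abs]
  gcongr

theorem tendsto_inner {u v : ℝ → V} (hu : BddFam u) (hv : Tendsto v (𝓝[>] (0 : ℝ)) (𝓝 0)) :
    Tendsto (fun t => inner ℝ (u t) (v t)) (𝓝[>] (0 : ℝ)) (𝓝 0) := by
  obtain ⟨M, hM⟩ := hu
  have h0 : Tendsto (fun t : ℝ => M * ‖v t‖) (𝓝[>] (0 : ℝ)) (𝓝 0) := by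
    simpa using hv.norm.const_mul M
  refine squeeze_zero_norm' ?_ h0
  filter_upwards [hM] with t ht
  exact (norm_inner_le_norm _ _).trans (by gcongr)

theorem tendsto_add_smul [NormedSpace ℝ F] {u : ℝ → F} (hu : BddFam u) (a : F) :
    Tendsto (fun t => a + t • u t) (𝓝[>] (0 : ℝ)) (𝓝 a) := by
  simpa using hu.tendsto_smul.const_add a

end BddFam

/-- Bounded convergence in the weak operator topology. -/
structure WeakOpLim (A : ℝ → V →L[ℝ] V) (A₀ : V →L[ℝ] V) : Prop where
  bdd : BddFam A
  lim : ∀ a b, Tendsto (fun t => inner ℝ (A t a) b) (𝓝[>] (0 : ℝ)) (𝓝 (inner ℝ (A₀ a) b))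

/-- Bounded weak convergence. -/
structure WeakLim (u : ℝ → V) (u₀ : V) : Prop where
  bdd : BddFam u
  lim : ∀ b, Tendsto (fun t => inner ℝ (u t) b) (𝓝[>] (0 : ℝ)) (𝓝 (inner ℝ u₀ b))

namespace WeakLim

theorem tendsto {u : ℝ → V} {u₀ : V} (hu : WeakLim u u₀) {v : ℝ → V} {v₀ : V}
    (hv : Tendsto v (𝓝[>] (0 : ℝ)) (𝓝 v₀)) :
    Tendsto (fun t => inner ℝ (u t) (v t)) (𝓝[>] (0 : ℝ)) (𝓝 (inner ℝ u₀ v₀)) := by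
  have h1 : Tendsto (fun t => v t - v₀) (𝓝[>] (0 : ℝ)) (𝓝 0) := by
    simpa using hv.sub_const v₀
  have h2 := (hu.bdd.tendsto_inner h1).add (hu.lim v₀)
  simpa [inner_sub_right] using h2

end WeakLim

namespace WeakOpLim

theorem apply {A : ℝ → V →L[ℝ] V} {A₀ : V →L[ℝ] V} (hA : WeakOpLim A A₀) {u : ℝ → V} {u₀ : V}
    (hu : Tendsto u (𝓝[>] (0 : ℝ)) (𝓝 u₀)) : WeakLim (fun t => A t (u t)) (A₀ u₀) := by
  have hbu : BddFam u := by
    refine ⟨‖u₀‖ + 1, ?_⟩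
    filter_upwards [hu.norm.eventually (gt_mem_nhds (lt_add_one ‖u₀‖))] with t ht using ht.le
  refine ⟨hA.bdd.apply hbu, fun b => ?_⟩
  have h1 : Tendsto (fun t => A t (u t - u₀)) (𝓝[>] (0 : ℝ)) (𝓝 0) := by
    obtain ⟨M, hM⟩ := hA.bdd
    have h0 : Tendsto (fun t : ℝ => M * ‖u t - u₀‖) (𝓝[>] (0 : ℝ)) (𝓝 0) := by
      simpa using (hu.sub_const u₀).norm.const_mul M
    refine squeeze_zero_norm' ?_ h0
    filter_upwards [hM] with t ht
    exact ((A t).le_opNorm _).trans (by gcongr)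
  have h2 := ((BddFam.const b).tendsto_inner h1).add (hA.lim u₀ b)
  simpa [inner_sub_right, real_inner_comm b] using h2

theorem add {A B : ℝ → V →L[ℝ] V} {A₀ B₀ : V →L[ℝ] V} (hA : WeakOpLim A A₀)
    (hB : WeakOpLim B B₀) : WeakOpLim (fun t => A t + B t) (A₀ + B₀) :=
  ⟨hA.bdd.add hB.bdd, fun a b => by
    simpa [inner_add_left] using (hA.lim a b).add (hB.lim a b)⟩

theorem sub {A B : ℝ → V →L[ℝ] V} {A₀ B₀ : V →L[ℝ] V} (hA : WeakOpLim A A₀)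
    (hB : WeakOpLim B B₀) : WeakOpLim (fun t => A t - B t) (A₀ - B₀) :=
  ⟨hA.bdd.sub hB.bdd, fun a b => by
    simpa [inner_sub_left] using (hA.lim a b).sub (hB.lim a b)⟩

theorem add_smul {A B : ℝ → V →L[ℝ] V} {A₀ : V →L[ℝ] V} (hA : WeakOpLim A A₀)
    (hB : BddFam B) : WeakOpLim (fun t => A t + t • B t) A₀ :=
  ⟨hA.bdd.add hB.smul, fun a b => by
    have h1 : Tendsto (fun t => t • B t a) (𝓝[>] (0 : ℝ)) (𝓝 0) :=
      (hB.apply (BddFam.const a)).tendsto_smul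
    have h2 := (hA.lim a b).add ((BddFam.const b).tendsto_inner h1)
    simpa [inner_add_right, real_inner_comm b] using h2⟩

end WeakOpLim

/-- The transported variational problem: all the data are perturbed by `t` times a bounded weakly
convergent family. `R` stands for `(DT_t - I) / t`, `Rs` for its transpose, `τ` for its trace. -/
structure TransportedProblem (H : Submodule ℝ (V × V)) (N Ep K Λ' : V →L[ℝ] V) (Φ : V → V)
    (f d E w p q : V) (R Rs τ C Cs N' Ep' K' : ℝ → V →L[ℝ] V) (f' d' e u : ℝ → V)
    (R₀ Rs₀ τ₀ N₀ Ep₀ K₀ : V →L[ℝ] V) (f₀ d₀ : V) : Prop where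
  coercive : ∃ c : ℝ, 0 < c ∧ ∀ v, c * ‖v‖ ^ 2 ≤ inner ℝ (N v) v ∧ c * ‖v‖ ^ 2 ≤ inner ℝ (Ep v) v
  K_symm : ∀ a b, inner ℝ (K a) b = inner ℝ a (K b)
  monotone : ∀ a b, 0 ≤ inner ℝ (Φ a - Φ b) (a - b)
  lipschitz : ∃ L : ℝ≥0, LipschitzWith L Φ
  fderiv : HasFDerivAt (fun v => inner ℝ (Φ v) p) ((innerSL ℝ p).comp Λ') E
  state_mem : (E, w) ∈ H
  state : ∀ v z, (v, z) ∈ H → inner ℝ (N w) z + inner ℝ (Ep E + Φ E - f) v = 0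
  adjoint_mem : (p, q) ∈ H
  adjoint : ∀ v z, (v, z) ∈ H →
    inner ℝ (N z) q + inner ℝ (Ep v) p + inner ℝ (Λ' v) p = -inner ℝ (K (E - d)) v
  hR : WeakOpLim R R₀
  hRs : WeakOpLim Rs Rs₀
  hτ : WeakOpLim τ τ₀
  hC : BddFam C
  hCs : BddFam Cs
  hN : WeakOpLim N' N₀
  hEp : WeakOpLim Ep' Ep₀
  hK : WeakOpLim K' K₀
  hf : WeakLim f' f₀
  hd : WeakLim d' d₀
  he : BddFam e
  hu : BddFam u
  -- Here `e t` and `u t` stand for $E_t\circ T_t$ and $\operatorname{curl}E_t\circ T_t$. With `Cs`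
  -- the adjugate of `R`, the pair is $DT_t^\top e_t$ and $\operatorname{adj}(DT_t)u_t$, the
  -- covariant pull-back and its curl.
  pert_mem : ∀ᶠ t in 𝓝[>] (0 : ℝ),
    (e t + t • Rs t (e t), u t + t • (τ t - R t + t • Cs t) (u t)) ∈ H
  -- With `C` the cofactor map of `R`, the test factors are $DT_t z$ and
  -- $\operatorname{cof}(DT_t)v$: what remains of the pull-backs under $T_t^{-1}$ after
  -- multiplication by the Jacobian determinant.
  pert_state : ∀ᶠ t in 𝓝[>] (0 : ℝ), ∀ v z, (v, z) ∈ H →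
    inner ℝ ((N + t • N' t) (u t)) (z + t • R t z)
      + inner ℝ ((Ep + t • Ep' t) (e t) + Φ (e t) - (f + t • f' t))
        (v + t • (τ t - Rs t + t • C t) v) = 0

namespace TransportedProblem

variable {H : Submodule ℝ (V × V)} {N Ep K Λ' : V →L[ℝ] V} {Φ : V → V}
    {f d E w p q : V} {R Rs τ C Cs N' Ep' K' : ℝ → V →L[ℝ] V} {f' d' e u : ℝ → V}
    {R₀ Rs₀ τ₀ N₀ Ep₀ K₀ : V →L[ℝ] V} {f₀ d₀ : V}

set_option maxHeartbeats 1000000 in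
-- Subtract the two equations and test with the difference of the pulled-back state and $(E,w)$,
-- which lies in `H`. Coercivity and monotonicity give a quadratic lower bound, and all
-- discrepancies are $O(t)$ times the norm of the test pair. Replacing $\Phi(e_t)$ by $\Phi$ of the
-- pull-back costs $O(t)$ by the Lipschitz property.
theorem bddFam_quotient (h : TransportedProblem H N Ep K Λ' Φ f d E w p q R Rs τ C Cs N' Ep' K'
      f' d' e u R₀ Rs₀ τ₀ N₀ Ep₀ K₀ f₀ d₀) :
    BddFam (fun t => t⁻¹ • (e t - E)) ∧ BddFam (fun t => t⁻¹ • (u t - w)) := by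
  obtain ⟨c, hc, hcoer⟩ := h.coercive
  obtain ⟨L, hL⟩ := h.lipschitz
  have bG := (h.hτ.bdd.sub h.hRs.bdd).add h.hC.smul
  have bGs := (h.hτ.bdd.sub h.hR.bdd).add h.hCs.smul
  have bRe := h.hRs.bdd.apply h.he
  have bGu := bGs.apply h.hu
  have bΦe : BddFam fun t => Φ (e t) := by
    obtain ⟨M, hM⟩ := h.he
    refine ⟨‖Φ 0‖ + L * M, ?_⟩
    filter_upwards [hM] with t ht
    have h1 := hL.norm_sub_le (e t) 0
    rw [sub_zero] at h1
    have h2 : ‖Φ (e t)‖ ≤ ‖Φ (e t) - Φ 0‖ + ‖Φ 0‖ := by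
      simpa using norm_add_le (Φ (e t) - Φ 0) (Φ 0)
    have h3 : (L : ℝ) * ‖e t‖ ≤ L * M := by gcongr
    linarith
  obtain ⟨M1, hM1⟩ := ((BddFam.const N).apply bGu).sub (h.hN.bdd.apply h.hu)
  obtain ⟨M2, hM2⟩ := ((BddFam.const N).add h.hN.bdd.smul).apply h.hu
  obtain ⟨M3, hM3⟩ := h.hR.bdd
  obtain ⟨M4, hM4⟩ := (((BddFam.const Ep).apply bRe).sub (h.hEp.bdd.apply h.he)).add h.hf.bdd
  obtain ⟨M5, hM5⟩ := bRe
  obtain ⟨M6, hM6⟩ := ((((BddFam.const Ep).add h.hEp.bdd.smul).apply h.he).add bΦe).sub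
    ((BddFam.const f).add h.hf.bdd.smul)
  obtain ⟨M7, hM7⟩ := bG
  set A : ℝ := |M1| + |M2| * |M3| + |M4| + L * |M5| + |M6| * |M7|
  have key : ∀ᶠ t in 𝓝[>] (0 : ℝ),
      ‖t⁻¹ • (e t + t • Rs t (e t) - E)‖ ≤ 2 * A / c ∧
      ‖t⁻¹ • (u t + t • (τ t - R t + t • Cs t) (u t) - w)‖ ≤ 2 * A / c := by
    filter_upwards [hM1, hM2, hM3, hM4, hM5, hM6, hM7, h.pert_mem, h.pert_state,
      self_mem_nhdsWithin] with t h1 h2 h3 h4 h5 h6 h7 hmem hst ht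
    have ht : (0 : ℝ) < t := ht
    set Et := e t + t • Rs t (e t) with hEt
    set wt := u t + t • (τ t - R t + t • Cs t) (u t) with hwt
    set v := Et - E with hv
    set z := wt - w with hz
    have hvz : (v, z) ∈ H := H.sub_mem hmem h.state_mem
    have e0 := h.state v z hvz
    have e1 := hst v z hvz
    have hm := h.monotone Et E
    have hcN := (hcoer z).1
    have hcE := (hcoer v).2
    -- The left side is the coercive quantity; on the right each term carries a factor $t$,
    -- explicitly or through $\Phi(E_t)-\Phi(e_t)$ (with `Et` the pull-back).
    have hexp : inner ℝ (N z) z + inner ℝ (Ep v) v + inner ℝ (Φ Et - Φ E) v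
        = t * (inner ℝ (N ((τ t - R t + t • Cs t) (u t)) - N' t (u t)) z)
          - t * inner ℝ ((N + t • N' t) (u t)) (R t z)
          + t * inner ℝ (Ep (Rs t (e t)) - Ep' t (e t) + f' t) v
          + inner ℝ (Φ Et - Φ (e t)) v
          - t * inner ℝ ((Ep + t • Ep' t) (e t) + Φ (e t) - (f + t • f' t))
            ((τ t - Rs t + t • C t) v) := by
      have hNz : N z = N (u t) + t • N ((τ t - R t + t • Cs t) (u t)) - N w := by
        rw [hz, hwt, map_sub, map_add, map_smul]
      have hEv : Ep v = Ep (e t) + t • Ep (Rs t (e t)) - Ep E := by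
        rw [hv, hEt, map_sub, map_add, map_smul]
      rw [hNz, hEv]
      generalize (τ t - R t + t • Cs t) (u t) = a1 at *
      generalize (τ t - Rs t + t • C t) v = a2 at *
      simp only [add_apply, smul_apply, inner_add_left, inner_sub_left, inner_add_right,
        real_inner_smul_left, real_inner_smul_right] at e0 e1 ⊢
      linear_combination e1 - e0
    have b1 : t * (inner ℝ (N ((τ t - R t + t • Cs t) (u t)) - N' t (u t)) z)
        ≤ t * (|M1| * ‖z‖) := by
      gcongr
      refine (real_inner_le_norm _ _).trans ?_
      gcongr
      exact h1.trans (le_abs_self _)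
    have b2 : -(t * inner ℝ ((N + t • N' t) (u t)) (R t z)) ≤ t * (|M2| * |M3| * ‖z‖) := by
      rw [← mul_neg]
      gcongr
      refine (neg_le_abs _).trans ((abs_real_inner_le_norm _ _).trans ?_)
      rw [mul_assoc]
      exact mul_le_mul (h2.trans (le_abs_self _)) (((R t).le_opNorm _).trans
        (by gcongr; exact h3.trans (le_abs_self _))) (norm_nonneg _) (abs_nonneg _)
    have b3 : t * inner ℝ (Ep (Rs t (e t)) - Ep' t (e t) + f' t) v ≤ t * (|M4| * ‖v‖) := by
      gcongr
      refine (real_inner_le_norm _ _).trans ?_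
      gcongr
      exact h4.trans (le_abs_self _)
    have b4 : inner ℝ (Φ Et - Φ (e t)) v ≤ t * (L * |M5| * ‖v‖) := by
      refine (real_inner_le_norm _ _).trans ?_
      have := hL.norm_sub_le Et (e t)
      rw [hEt, add_sub_cancel_left, norm_smul, Real.norm_eq_abs, abs_of_pos ht] at this
      have h8 : ‖Φ Et - Φ (e t)‖ ≤ L * (t * |M5|) :=
        this.trans (by gcongr; exact h5.trans (le_abs_self _))
      calc _ ≤ L * (t * |M5|) * ‖v‖ := by gcongr
        _ = _ := by ring
    have b5 : -(t * inner ℝ ((Ep + t • Ep' t) (e t) + Φ (e t) - (f + t • f' t))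
        ((τ t - Rs t + t • C t) v)) ≤ t * (|M6| * |M7| * ‖v‖) := by
      rw [← mul_neg]
      gcongr
      refine (neg_le_abs _).trans ((abs_real_inner_le_norm _ _).trans ?_)
      rw [mul_assoc]
      exact mul_le_mul (h6.trans (le_abs_self _)) ((ContinuousLinearMap.le_opNorm _ _).trans
        (by gcongr; exact h7.trans (le_abs_self _))) (norm_nonneg _) (abs_nonneg _)
    have hA : c * (‖z‖ ^ 2 + ‖v‖ ^ 2) ≤ t * A * (‖z‖ + ‖v‖) := by
      have p1 : 0 ≤ t * (|M4| + L * |M5| + |M6| * |M7|) * ‖z‖ := by positivity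
      have p2 : 0 ≤ t * (|M1| + |M2| * |M3|) * ‖v‖ := by positivity
      have : t * A * (‖z‖ + ‖v‖) = t * (|M1| * ‖z‖) + t * (|M2| * |M3| * ‖z‖) + t * (|M4| * ‖v‖)
          + t * (L * |M5| * ‖v‖) + t * (|M6| * |M7| * ‖v‖)
          + t * (|M4| + L * |M5| + |M6| * |M7|) * ‖z‖ + t * (|M1| + |M2| * |M3|) * ‖v‖ := by
        simp only [A]
        ring
      linarith
    have hA0 : 0 ≤ A := by positivity
    have hs : ‖z‖ + ‖v‖ ≤ t * (2 * A / c) := by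
      have h9 : c * (‖z‖ + ‖v‖) ^ 2 ≤ 2 * (t * A * (‖z‖ + ‖v‖)) := by
        nlinarith [sq_nonneg (‖z‖ - ‖v‖)]
      rcases (add_nonneg (norm_nonneg z) (norm_nonneg v)).eq_or_lt with h10 | h10
      · rw [← h10]; positivity
      · have h11 : c * (‖z‖ + ‖v‖) ≤ 2 * (t * A) := by
          by_contra hcon
          nlinarith
        rw [← mul_div_assoc, le_div_iff₀ hc]
        linarith
    have hn : ∀ y : V, ‖t⁻¹ • y‖ = t⁻¹ * ‖y‖ := fun y => by
      rw [norm_smul, norm_inv, Real.norm_eq_abs, abs_of_pos ht]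
    rw [hn, hn]
    constructor
    · rw [inv_mul_le_iff₀ ht]
      linarith [norm_nonneg z]
    · rw [inv_mul_le_iff₀ ht]
      linarith [norm_nonneg v]
  -- The estimate so far concerns pull-backs; their quotients differ from those of `e` and `u` by
  -- bounded terms, which are now removed.
  have bX : BddFam fun t => t⁻¹ • (e t + t • Rs t (e t) - E) := ⟨_, key.mono fun t h => h.1⟩
  have bY : BddFam fun t => t⁻¹ • (u t + t • (τ t - R t + t • Cs t) (u t) - w) :=
    ⟨_, key.mono fun t h => h.2⟩
  obtain ⟨M8, hM8⟩ := bX.sub ((h.hRs.bdd).apply h.he)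
  obtain ⟨M9, hM9⟩ := bY.sub bGu
  refine ⟨⟨M8, ?_⟩, ⟨M9, ?_⟩⟩
  · filter_upwards [hM8, self_mem_nhdsWithin] with t h8 ht
    have ht : (0 : ℝ) < t := ht
    convert h8 using 2
    rw [add_sub_right_comm, smul_add, smul_smul, inv_mul_cancel₀ ht.ne', one_smul,
      add_sub_cancel_right]
  · filter_upwards [hM9, self_mem_nhdsWithin] with t h9 ht
    have ht : (0 : ℝ) < t := ht
    convert h9 using 2
    rw [add_sub_right_comm, smul_add, smul_smul t⁻¹ t, inv_mul_cancel₀ ht.ne', one_smul,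
      add_sub_cancel_right]

variable [CompleteSpace V]

set_option maxHeartbeats 1000000 in
/-- Derivative of a quadratic tracking functional along the transported problem. -/
theorem tendsto_quotient (h : TransportedProblem H N Ep K Λ' Φ f d E w p q R Rs τ C Cs N' Ep' K'
      f' d' e u R₀ Rs₀ τ₀ N₀ Ep₀ K₀ f₀ d₀) :
    Tendsto (fun t => t⁻¹ * (1 / 2 * inner ℝ ((K + t • K' t) (e t - (d + t • d' t)))
        (e t - (d + t • d' t)) - 1 / 2 * inner ℝ (K (E - d)) (E - d))) (𝓝[>] (0 : ℝ))
      (𝓝 (1 / 2 * inner ℝ (K₀ (E - d)) (E - d) - inner ℝ (K (E - d)) (Rs₀ E + d₀)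
        + inner ℝ (N₀ w) q + inner ℝ (N ((R₀ - τ₀) w)) q + inner ℝ (N w) (R₀ q)
        + inner ℝ (Ep₀ E) p - inner ℝ (Ep (Rs₀ E)) p
        + inner ℝ (Ep E + Φ E - f) ((τ₀ - Rs₀) p) - inner ℝ (Λ' (Rs₀ E)) p - inner ℝ f₀ p)) := by
  obtain ⟨bx, by'⟩ := h.bddFam_quotient
  set x : ℝ → V := fun t => t⁻¹ • (e t - E) with hx
  set y : ℝ → V := fun t => t⁻¹ • (u t - w) with hy
  have hex : ∀ᶠ t in 𝓝[>] (0 : ℝ), e t = E + t • x t := by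
    filter_upwards [self_mem_nhdsWithin] with t ht
    have ht : (0 : ℝ) < t := ht
    rw [hx, smul_smul, mul_inv_cancel₀ ht.ne', one_smul, add_sub_cancel]
  have huy : ∀ᶠ t in 𝓝[>] (0 : ℝ), u t = w + t • y t := by
    filter_upwards [self_mem_nhdsWithin] with t ht
    have ht : (0 : ℝ) < t := ht
    rw [hy, smul_smul, mul_inv_cancel₀ ht.ne', one_smul, add_sub_cancel]
  have le : Tendsto e (𝓝[>] (0 : ℝ)) (𝓝 E) :=
    (bx.tendsto_add_smul E).congr' (hex.mono fun t ht => ht.symm)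
  have lu : Tendsto u (𝓝[>] (0 : ℝ)) (𝓝 w) :=
    (by'.tendsto_add_smul w).congr' (huy.mono fun t ht => ht.symm)
  have wG := (h.hτ.sub h.hRs).add_smul h.hC
  have wGs := (h.hτ.sub h.hR).add_smul h.hCs
  have lFq := (h.hR.bdd.apply (BddFam.const q)).tendsto_add_smul q
  have lGp := (wG.bdd.apply (BddFam.const p)).tendsto_add_smul p
  have lFq0 := (h.hR.bdd.apply (BddFam.const q)).tendsto_smul
  have lGp0 := (wG.bdd.apply (BddFam.const p)).tendsto_smul
  set g : ℝ → V := fun t => e t - (d + t • d' t) with hg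
  have bγ : BddFam fun t => x t - d' t := bx.sub h.hd.bdd
  have lg : Tendsto g (𝓝[>] (0 : ℝ)) (𝓝 (E - d)) := le.sub (h.hd.bdd.tendsto_add_smul d)
  have lg0 : Tendsto (fun t => g t - (E - d)) (𝓝[>] (0 : ℝ)) (𝓝 0) := by
    simpa using lg.sub_const (E - d)
  -- increments of the nonlinearity
  obtain ⟨L, hL⟩ := h.lipschitz
  have bΦ : BddFam fun t => t⁻¹ • (Φ (e t) - Φ E) := by
    obtain ⟨M, hM⟩ := bx
    refine ⟨L * M, ?_⟩
    filter_upwards [hM] with t ht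
    calc ‖t⁻¹ • (Φ (e t) - Φ E)‖ = ‖t⁻¹‖ * ‖Φ (e t) - Φ E‖ := norm_smul _ _
      _ ≤ ‖t⁻¹‖ * (L * ‖e t - E‖) := by gcongr; exact hL.norm_sub_le _ _
      _ = L * ‖x t‖ := by rw [hx, norm_smul]; ring
      _ ≤ L * M := by gcongr
  have lΦ : Tendsto (fun t => inner ℝ (t⁻¹ • (Φ (e t) - Φ E)) p - inner ℝ (Λ' (x t)) p)
      (𝓝[>] (0 : ℝ)) (𝓝 0) := by
    have h1 := (h.fderiv.isLittleO.comp_tendsto le)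
    have h2 : (fun t => e t - E) =O[𝓝[>] (0 : ℝ)] fun t => t := by
      obtain ⟨M, hM⟩ := bx
      refine Asymptotics.IsBigO.of_bound M ?_
      filter_upwards [hM, hex] with t ht hte
      rw [hte, add_sub_cancel_left, norm_smul, mul_comm]
      gcongr
    have h3 := (h1.trans_isBigO h2).tendsto_inv_smul_nhds_zero
    refine h3.congr fun t => ?_
    simp only [Function.comp_apply, ContinuousLinearMap.comp_apply, innerSL_apply_apply,
      smul_eq_mul, hx, map_smul, real_inner_smul_right, map_sub, inner_sub_right,
      real_inner_comm p]
    ring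
  -- From here on each limit is weak times strong, or bounded times null. In `tNR`, `tEpR` and `tΛR`
  -- the fixed operator is moved by its adjoint onto the fixed factor, so that weak convergence
  -- alone suffices.
  have tK := (h.hK.apply lg).tendsto lg
  have tKγ := ((BddFam.const K).apply bγ).tendsto_inner lg0
  have tKd := h.hd.lim (K (E - d))
  have tKR := (h.hRs.apply le).lim (K (E - d))
  have tNR := (wGs.apply lu).lim (ContinuousLinearMap.adjoint N q)
  have tEpR := (h.hRs.apply le).lim (ContinuousLinearMap.adjoint Ep p)
  have tΛR := (h.hRs.apply le).lim (ContinuousLinearMap.adjoint Λ' p)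
  have tN' := (h.hN.apply lu).tendsto lFq
  have tNy := ((BddFam.const N).apply by').tendsto_inner lFq0
  have tNw := h.hR.lim q (N w)
  have tEp' := (h.hEp.apply le).tendsto lGp
  have tEpx := ((BddFam.const Ep).apply bx).tendsto_inner lGp0
  have tΦx := bΦ.tendsto_inner lGp0
  have tf := h.hf.tendsto lGp
  have tG := wG.lim p (Ep E + Φ E - f)
  have total := (((((((((((((((tK.const_mul (1 / 2)).add (tKγ.const_mul (1 / 2))).sub tKd).sub
    tKR).sub tNR).sub tEpR).sub tΛR).add tN').add tNy).add tNw).add tEp').add tEpx).add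
    tΦx).add lΦ).sub tf).add tG
  refine (total.congr' ?_).trans (le_of_eq ?_)
  · filter_upwards [hex, huy, h.pert_mem, h.pert_state, self_mem_nhdsWithin]
      with t hte htu hmem hst ht
    have ht : (0 : ℝ) < t := ht
    -- Three identities are combined: the perturbed and the unperturbed state equation, both tested
    -- with the adjoint pair, and the adjoint equation tested with the difference quotient of the
    -- pull-backs, which is an element of `H`.
    have e1 := hst p q h.adjoint_mem
    have hz : (t⁻¹ • (e t + t • Rs t (e t) - E),
        t⁻¹ • (u t + t • (τ t - R t + t • Cs t) (u t) - w)) ∈ H :=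
      H.smul_mem t⁻¹ (H.sub_mem hmem h.state_mem)
    have e2 := h.adjoint _ _ hz
    have e0 := h.state p q h.adjoint_mem
    have hxx : t⁻¹ • (e t + t • Rs t (e t) - E) = x t + Rs t (e t) := by
      rw [add_sub_right_comm, smul_add, smul_smul t⁻¹ t, inv_mul_cancel₀ ht.ne', one_smul]
    have hyy : t⁻¹ • (u t + t • (τ t - R t + t • Cs t) (u t) - w)
        = y t + (τ t - R t + t • Cs t) (u t) := by
      rw [add_sub_right_comm, smul_add, smul_smul t⁻¹ t, inv_mul_cancel₀ ht.ne', one_smul]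
    rw [hxx, hyy] at e2
    have hgt : g t = (E - d) + t • (x t - d' t) := by
      rw [hg]
      simp only
      rw [hte, smul_sub]
      abel
    have hΦt : Φ (e t) = Φ E + t • (t⁻¹ • (Φ (e t) - Φ E)) := by
      rw [smul_smul, mul_inv_cancel₀ ht.ne', one_smul, add_sub_cancel]
    change _ = t⁻¹ * (1 / 2 * inner ℝ ((K + t • K' t) (g t)) (g t) - _)
    have hs1 := h.K_symm (x t) (E - d)
    have hs2 := h.K_symm (d' t) (E - d)
    -- The quadratic increment is split symmetrically so that the quotient `x t` survives only in
    -- $\langle K(E-d),x_t\rangle$, the term that the adjoint equation is designed to cancel, and in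
    -- a product that tends to zero.
    have hquad : t⁻¹ * (1 / 2 * inner ℝ ((K + t • K' t) (g t)) (g t)
          - 1 / 2 * inner ℝ (K (E - d)) (E - d))
        = 1 / 2 * inner ℝ (K' t (g t)) (g t)
          + 1 / 2 * inner ℝ (K (x t - d' t)) (g t - (E - d))
          + inner ℝ (K (E - d)) (x t) - inner ℝ (d' t) (K (E - d)) := by
      have : inner ℝ ((K + t • K' t) (g t)) (g t)
          = inner ℝ (K (g t)) (g t) + t * inner ℝ (K' t (g t)) (g t) := by
        simp [inner_add_left, real_inner_smul_left]
      rw [this]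
      generalize inner ℝ (K' t (g t)) (g t) = α
      rw [hgt]
      generalize hgg : E - d = g0 at *
      simp only [map_add, map_smul, map_sub, inner_add_left, inner_sub_left, inner_add_right,
        inner_sub_right, real_inner_smul_left, real_inner_smul_right, add_sub_cancel_left]
      rw [hs1, hs2, real_inner_comm (K g0) (x t), real_inner_comm (K g0) (d' t)]
      field_simp
      ring
    rw [hquad]
    have e1' : t * (inner ℝ (N' t (u t)) (q + t • R t q) + inner ℝ (N (y t)) (q + t • R t q)
        + inner ℝ (N w) (R t q) + inner ℝ (Ep' t (e t)) (p + t • (τ t - Rs t + t • C t) p)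
        + inner ℝ (Ep (x t)) (p + t • (τ t - Rs t + t • C t) p)
        + inner ℝ (t⁻¹ • (Φ (e t) - Φ E)) (p + t • (τ t - Rs t + t • C t) p)
        - inner ℝ (f' t) (p + t • (τ t - Rs t + t • C t) p)
        + inner ℝ (Ep E + Φ E - f) ((τ t - Rs t + t • C t) p)) = 0 := by
      generalize hq' : t⁻¹ • (Φ (e t) - Φ E) = δ at hΦt ⊢
      rw [hΦt] at e1
      have hNu : (N + t • N' t) (u t) = N w + t • N (y t) + t • N' t (u t) := by
        rw [add_apply, smul_apply]
        conv_lhs => rw [htu]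
        rw [map_add, map_smul, ← htu]
      have hEe : (Ep + t • Ep' t) (e t) = Ep E + t • Ep (x t) + t • Ep' t (e t) := by
        rw [add_apply, smul_apply]
        conv_lhs => rw [hte]
        rw [map_add, map_smul, ← hte]
      rw [hNu, hEe] at e1
      generalize (τ t - Rs t + t • C t) p = a1 at *
      generalize N' t (u t) = a2 at *
      generalize Ep' t (e t) = a3 at *
      simp only [inner_add_left, inner_sub_left, inner_add_right,
        real_inner_smul_left, real_inner_smul_right] at e0 e1 ⊢
      linear_combination e1 - e0
    have e1'' := (mul_eq_zero.1 e1').resolve_left ht.ne'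
    simp only [ContinuousLinearMap.adjoint_inner_right]
    generalize (τ t - R t + t • Cs t) (u t) = b1 at *
    generalize hb2 : (τ t - Rs t + t • C t) p = b2 at *
    generalize t⁻¹ • (Φ (e t) - Φ E) = b3 at *
    generalize Rs t (e t) = b4 at *
    rw [real_inner_comm (N w) (R t q), real_inner_comm (Ep E + Φ E - f) b2,
      real_inner_comm (K (E - d)) b4]
    simp only [map_add, inner_add_left, inner_add_right, inner_sub_left, inner_sub_right,
      real_inner_smul_right] at e2 e1'' ⊢
    -- All terms in which the unknown quotients are paired with a fixed vector cancel here.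
    linear_combination e1'' - e2
  · congr 1
    simp only [ContinuousLinearMap.adjoint_inner_right, sub_apply, map_sub,
      inner_sub_left, inner_sub_right, inner_add_right, inner_add_left]
    simp only [real_inner_comm (K E), real_inner_comm (K d), real_inner_comm (N w),
      real_inner_comm (Ep E), real_inner_comm (Φ E), real_inner_comm f]
    ring

end TransportedProblem

end Sensitivity

/-! ### The flow of a Lipschitz field -/

section Flow

variable {θ : E3 → E3} {K : ℝ≥0}

theorem exists_trajectory (hθ : LipschitzWith K θ) {M : ℝ≥0} (hM : ∀ x, ‖θ x‖ ≤ M) (x : E3) :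
    ∃ α : ℝ → E3, α 0 = x ∧
      ∀ s ∈ Set.Icc (0 : ℝ) 1, HasDerivWithinAt α (θ (α s)) (Set.Icc 0 1) s := by
  -- A curve of speed at most $M$ stays within distance $M$ in unit time, so the ball of radius $M$
  -- suffices for the whole interval $[0,1]$.
  have h : IsPicardLindelof (fun _ => θ) (tmin := 0) (tmax := 1) ⟨0, by simp⟩ x M 0 M K :=
    IsPicardLindelof.of_time_independent (fun y _ => hM y) hθ.lipschitzOnWith (by simp)
  exact h.exists_eq_forall_mem_Icc_hasDerivWithinAt₀

theorem eqOn_of_trajectories (hθ : LipschitzWith K θ) {t : ℝ} {α β : ℝ → E3}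
    (hα : ∀ s ∈ Set.Icc 0 t, HasDerivWithinAt α (θ (α s)) (Set.Icc 0 t) s)
    (hβ : ∀ s ∈ Set.Icc 0 t, HasDerivWithinAt β (θ (β s)) (Set.Icc 0 t) s) (h0 : α 0 = β 0) :
    Set.EqOn α β (Set.Icc 0 t) := by
  have hIci : ∀ {γ : ℝ → E3}, (∀ s ∈ Set.Icc 0 t, HasDerivWithinAt γ (θ (γ s)) (Set.Icc 0 t) s) →
      ∀ s ∈ Set.Ico 0 t, HasDerivWithinAt γ (θ (γ s)) (Set.Ici s) s := fun h s hs =>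
    (h s (Set.Ico_subset_Icc_self hs)).mono_of_mem_nhdsWithin
      (Filter.mem_of_superset (Icc_mem_nhdsGE hs.2) (Set.Icc_subset_Icc_left hs.1))
  exact ODE_solution_unique_of_mem_Icc_right (v := fun _ => θ) (s := fun _ => Set.univ) (K := K)
    (fun _ _ => hθ.lipschitzOnWith) (fun s hs => (hα s hs).continuousWithinAt) (hIci hα)
    (fun _ _ => trivial) (fun s hs => (hβ s hs).continuousWithinAt) (hIci hβ)
    (fun _ _ => trivial) h0

/-- The flow of a bounded Lipschitz field on the unit time interval. -/
theorem exists_flow (hθ : LipschitzWith K θ) {M : ℝ≥0} (hM : ∀ x, ‖θ x‖ ≤ M) :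
    ∃ T : ℝ → E3 → E3, ∀ t ∈ Set.Icc (0 : ℝ) 1,
      (∀ ω, flowImage θ t ω = T t '' ω) ∧
      (∀ x y, ‖(T t x - x) - (T t y - y)‖ ≤ t * (K * Real.exp K) * ‖x - y‖) ∧
      (∀ x, ‖T t x - x - t • θ x‖ ≤ t ^ 2 * (K * M)) ∧
      (∀ x, θ x = 0 → T t x = x) := by
  choose α hα0 hα using exists_trajectory hθ hM
  have hmono : ∀ t ∈ Set.Icc (0 : ℝ) 1, ∀ x, ∀ s ∈ Set.Icc 0 t,
      HasDerivWithinAt (α x) (θ (α x s)) (Set.Icc 0 t) s := fun t ht x s hs =>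
    (hα x s ⟨hs.1, hs.2.trans ht.2⟩).mono (Set.Icc_subset_Icc_right ht.2)
  refine ⟨fun t x => α x t, fun t ht => ⟨fun ω => ?_, fun x y => ?_, fun x => ?_, fun x hx => ?_⟩⟩
  -- `flowImage` quantifies over all integral curves; by uniqueness each one is the selected curve
  -- with the same initial point.
  · ext z
    constructor
    · rintro ⟨β, hβ0, hβt, hβ⟩
      refine ⟨β 0, hβ0, ?_⟩
      rw [← hβt]
      exact eqOn_of_trajectories hθ (hmono t ht (β 0)) hβ (hα0 _) ⟨ht.1, le_rfl⟩
    · rintro ⟨x, hx, rfl⟩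
      exact ⟨α x, by rwa [hα0], rfl, hmono t ht x⟩
  · have hg : ∀ s ∈ Set.Icc (0 : ℝ) 1, dist (α x s) (α y s) ≤ dist x y * Real.exp (K * (s - 0)) := by
      have hIci : ∀ z, ∀ s ∈ Set.Ico (0 : ℝ) 1,
          HasDerivWithinAt (α z) (θ (α z s)) (Set.Ici s) s := fun z s hs =>
        (hα z s (Set.Ico_subset_Icc_self hs)).mono_of_mem_nhdsWithin
          (Filter.mem_of_superset (Icc_mem_nhdsGE hs.2) (Set.Icc_subset_Icc_left hs.1))
      exact dist_le_of_trajectories_ODE (v := fun _ => θ) (K := K) (fun _ => hθ)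
        (fun s hs => (hα x s hs).continuousWithinAt) (hIci x)
        (fun s hs => (hα y s hs).continuousWithinAt) (hIci y) (by rw [hα0, hα0])
    have h1 := norm_image_sub_le_of_norm_deriv_le_segment' (f := fun s => α x s - α y s)
      (C := K * Real.exp K * ‖x - y‖)
      (fun s hs => (hmono t ht x s hs).sub (hmono t ht y s hs)) (fun s hs => by
        have hs1 : s ∈ Set.Icc (0 : ℝ) 1 := ⟨hs.1, hs.2.le.trans ht.2⟩
        have h2 := hg s hs1
        rw [dist_eq_norm, dist_eq_norm, sub_zero] at h2
        have h3 : Real.exp (K * s) ≤ Real.exp K :=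
          Real.exp_le_exp.2 (mul_le_of_le_one_right K.2 hs1.2)
        calc ‖θ (α x s) - θ (α y s)‖ ≤ K * ‖α x s - α y s‖ := hθ.norm_sub_le _ _
          _ ≤ K * (‖x - y‖ * Real.exp K) := by
              gcongr
              exact h2.trans (by gcongr)
          _ = _ := by ring) t ⟨ht.1, le_rfl⟩
    simp only [hα0, sub_zero] at h1
    calc ‖α x t - x - (α y t - y)‖ = ‖α x t - α y t - (x - y)‖ := by congr 1; abel
      _ ≤ _ := h1
      _ = _ := by ring
  -- The displacement is at most $Mt$, so the velocity varies by at most $KMt$ on $[0,t]$;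
  -- integrating once more gives the second-order error $KMt^2$.
  · have h0 : ∀ s ∈ Set.Icc 0 t, ‖α x s - x‖ ≤ M * t := fun s hs => by
      have h1 := norm_image_sub_le_of_norm_deriv_le_segment' (f := α x) (C := M)
        (hmono t ht x) (fun s _ => hM _) s hs
      rw [hα0, sub_zero] at h1
      exact h1.trans (by gcongr; exact hs.2)
    have h1 := norm_image_sub_le_of_norm_deriv_le_segment' (f := fun s => α x s - s • θ x)
      (C := K * (M * t)) (fun s hs => (hmono t ht x s hs).sub
        ((hasDerivWithinAt_id s _).smul_const (θ x))) (fun s hs => by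
        rw [one_smul]
        exact (hθ.norm_sub_le _ _).trans (by gcongr; exact h0 s (Set.Ico_subset_Icc_self hs)))
        t ⟨ht.1, le_rfl⟩
    simp only [hα0, sub_zero, zero_smul] at h1
    calc ‖α x t - x - t • θ x‖ = ‖α x t - t • θ x - x‖ := by congr 1; abel
      _ ≤ _ := h1
      _ = _ := by ring
  · have := eqOn_of_trajectories hθ (hmono t ht x) (β := fun _ => x) (fun s hs => by
      simpa [hx] using hasDerivWithinAt_const s (Set.Icc 0 t) x) (hα0 x) ⟨ht.1, le_rfl⟩
    exact this

/-- A small Lipschitz perturbation of the identity is a bi-Lipschitz homeomorphism. -/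
theorem exists_homeomorph_of_lipschitz_sub_id {T : E3 → E3} {c : ℝ} (hc : c ≤ 1 / 2)
    (hT : ∀ x y, ‖(T x - x) - (T y - y)‖ ≤ c * ‖x - y‖) :
    ∃ h : E3 ≃ₜ E3, ⇑h = T ∧ LipschitzWith 2 h ∧ LipschitzWith 2 h.symm := by
  have hT' : ∀ x y, ‖(T x - x) - (T y - y)‖ ≤ 1 / 2 * ‖x - y‖ := fun x y =>
    (hT x y).trans (by gcongr)
  have happ : ApproximatesLinearOn T ((ContinuousLinearEquiv.refl ℝ E3 : E3 ≃L[ℝ] E3) : E3 →L[ℝ] E3)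
      Set.univ (1 / 2 : ℝ≥0) := by
    intro x _ y _
    have := hT' x y
    calc _ = ‖(T x - x) - (T y - y)‖ := by
          congr 1
          simp
          abel
      _ ≤ _ := by simpa using this
  have hN : Subsingleton E3 ∨ (1 / 2 : ℝ≥0) <
      ‖((ContinuousLinearEquiv.refl ℝ E3).symm : E3 →L[ℝ] E3)‖₊⁻¹ := by
    right
    have : ‖((ContinuousLinearEquiv.refl ℝ E3).symm : E3 →L[ℝ] E3)‖₊ = 1 := by
      ext
      simp
    rw [this, inv_one]
    exact NNReal.half_lt_self one_ne_zero
  refine ⟨happ.toHomeomorph T hN, rfl, ?_, ?_⟩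
  · refine LipschitzWith.of_dist_le_mul fun x y => ?_
    rw [dist_eq_norm, dist_eq_norm]
    change ‖T x - T y‖ ≤ _
    have h1 := hT' x y
    have h2 : T x - T y = ((T x - x) - (T y - y)) + (x - y) := by abel
    rw [h2]
    refine (norm_add_le _ _).trans ?_
    push_cast
    linarith [norm_nonneg (x - y)]
  -- From $\|x-y\|\le\|Tx-Ty\|+\frac12\|x-y\|$ the inverse has Lipschitz constant $2$.
  · refine LipschitzWith.of_dist_le_mul fun a b => ?_
    set h := happ.toHomeomorph T hN
    obtain ⟨x, rfl⟩ := h.surjective a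
    obtain ⟨y, rfl⟩ := h.surjective b
    rw [h.symm_apply_apply, h.symm_apply_apply, dist_eq_norm, dist_eq_norm]
    change _ ≤ _ * ‖T x - T y‖
    have h1 := hT' x y
    have h2 : x - y = (T x - T y) - ((T x - x) - (T y - y)) := by abel
    have h3 := norm_sub_le (T x - T y) ((T x - x) - (T y - y))
    rw [← h2] at h3
    push_cast
    linarith

end Flow

/-! ### Bi-Lipschitz deformations -/

/-- Lebesgue measure is a multiple of three-dimensional Hausdorff measure, and the latter grows by
at most $K^3$ under a $K$-Lipschitz map. -/
theorem volume_image_le_of_lipschitzWith {S : E3 → E3} {K : ℝ≥0} (hS : LipschitzWith K S)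
    (A : Set E3) : volume (S '' A) ≤ (K : ENNReal) ^ 3 * volume A := by
  have h3 : ((Module.finrank ℝ E3 : ℕ) : ℝ) = 3 := by simp
  have hH : (volume : Measure E3) = Measure.addHaarScalarFactor volume
      (Measure.hausdorffMeasure ((Module.finrank ℝ E3 : ℕ) : ℝ) : Measure E3)
      • (Measure.hausdorffMeasure ((Module.finrank ℝ E3 : ℕ) : ℝ) : Measure E3) :=
    Measure.isAddLeftInvariant_eq_smul _ _
  have h1 := hS.hausdorffMeasure_image_le (d := ((Module.finrank ℝ E3 : ℕ) : ℝ)) (by positivity) A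
  rw [hH]
  simp only [Measure.smul_apply, ENNReal.smul_def, smul_eq_mul]
  have h4 : (K : ENNReal) ^ ((Module.finrank ℝ E3 : ℕ) : ℝ) = (K : ENNReal) ^ 3 := by
    rw [h3]
    exact_mod_cast ENNReal.rpow_natCast (K : ENNReal) 3
  rw [h4] at h1
  rw [mul_left_comm]
  gcongr

/-- A bi-Lipschitz homeomorphism of the space which is the identity outside a compact subset
of `U`. -/
structure IsDeformation (U : Set E3) (T : E3 ≃ₜ E3) : Prop where
  lipschitz : LipschitzWith 2 T
  lipschitz_symm : LipschitzWith 2 T.symm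
  eq_self : ∃ K : Set E3, IsCompact K ∧ K ⊆ U ∧ ∀ x ∉ K, T x = x

namespace IsDeformation

variable {U U' : Set E3} {T : E3 ≃ₜ E3}

theorem symm (h : IsDeformation U T) : IsDeformation U T.symm := by
  obtain ⟨K, h1, h2, h3⟩ := h.eq_self
  exact ⟨h.lipschitz_symm, h.lipschitz, K, h1, h2, fun x hx => by
    rw [T.symm_apply_eq, h3 x hx]⟩

theorem mono (h : IsDeformation U T) (hU : U ⊆ U') : IsDeformation U' T := by
  obtain ⟨K, h1, h2, h3⟩ := h.eq_self
  exact ⟨h.lipschitz, h.lipschitz_symm, K, h1, h2.trans hU, h3⟩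

theorem mapsTo (h : IsDeformation U T) : Set.MapsTo T U U := fun x hx => by
  obtain ⟨K, -, h2, h3⟩ := h.eq_self
  -- A point sent outside $U$ would have its image fixed by $T$, which contradicts injectivity.
  by_contra hTx
  have h4 := h3 (T x) fun hK => hTx (h2 hK)
  exact hTx (by rwa [T.injective h4])

theorem mem_iff (h : IsDeformation U T) {x : E3} : T x ∈ U ↔ x ∈ U :=
  ⟨fun hx => by simpa using h.symm.mapsTo hx, fun hx => h.mapsTo hx⟩

theorem preimage_eq (h : IsDeformation U T) : T ⁻¹' U = U := Set.ext fun _ => h.mem_iff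

theorem image_eq (h : IsDeformation U T) : T '' U = U := by
  conv_lhs => rw [← h.preimage_eq]
  exact Set.image_preimage_eq _ T.surjective

/-- Preimages under $T$ are images under the $2$-Lipschitz inverse; the factor is $2^3$. -/
theorem map_le (h : IsDeformation U T) :
    (volume.restrict U).map T ≤ (8 : ENNReal) • volume.restrict U := by
  rw [Measure.le_iff]
  intro A hA
  rw [Measure.map_apply T.measurable hA, Measure.restrict_apply (T.measurable hA),
    Measure.smul_apply, Measure.restrict_apply hA, smul_eq_mul]
  have h1 : T ⁻¹' A ∩ U = T.symm '' (A ∩ U) := by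
    rw [T.image_symm, Set.preimage_inter, h.preimage_eq]
  rw [h1]
  refine (volume_image_le_of_lipschitzWith h.lipschitz_symm _).trans (le_of_eq ?_)
  norm_num

theorem quasiMeasurePreserving (h : IsDeformation U T) :
    Measure.QuasiMeasurePreserving T (volume.restrict U) (volume.restrict U) :=
  ⟨T.measurable, h.map_le.absolutelyContinuous.trans
    (Measure.smul_absolutelyContinuous)⟩

theorem quasiMeasurePreserving_volume (h : IsDeformation U T) :
    Measure.QuasiMeasurePreserving T volume volume := by
  simpa using (h.mono (Set.subset_univ U)).quasiMeasurePreserving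

/-- The factor $3$ is a convenient upper bound for $\sqrt8$. -/
theorem eLpNorm_comp_le {F : Type*} [NormedAddCommGroup F] (h : IsDeformation U T) {g : E3 → F}
    (hg : AEStronglyMeasurable g (volume.restrict U)) :
    eLpNorm (fun x => g (T x)) 2 (volume.restrict U)
      ≤ 3 * eLpNorm g 2 (volume.restrict U) := by
  have hac := h.quasiMeasurePreserving.absolutelyContinuous
  have h1 : eLpNorm (fun x => g (T x)) 2 (volume.restrict U)
      = eLpNorm g 2 ((volume.restrict U).map T) :=
    (eLpNorm_map_measure (hg.mono_ac hac) T.measurable.aemeasurable).symm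
  rw [h1]
  refine (eLpNorm_mono_measure g h.map_le).trans ?_
  rw [eLpNorm_smul_measure_of_ne_zero (by norm_num), smul_eq_mul]
  gcongr
  have : (8 : ENNReal) ≤ 3 ^ (2 : ℝ) := by
    rw [show (2 : ℝ) = ((2 : ℕ) : ℝ) by norm_num, ENNReal.rpow_natCast]
    norm_num
  calc (8 : ENNReal) ^ (1 / 2 : ENNReal).toReal ≤ (3 ^ (2 : ℝ)) ^ (1 / 2 : ENNReal).toReal := by
        gcongr
    _ = 3 := by
        rw [← ENNReal.rpow_mul]
        simp

theorem memLp_comp {F : Type*} [NormedAddCommGroup F] (h : IsDeformation U T) {g : E3 → F}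
    (hg : MemLp g 2 (volume.restrict U)) : MemLp (fun x => g (T x)) 2 (volume.restrict U) :=
  ⟨hg.1.comp_quasiMeasurePreserving h.quasiMeasurePreserving,
    (h.eLpNorm_comp_le hg.1).trans_lt (ENNReal.mul_lt_top (by norm_num) hg.2)⟩

/-- The change of variables formula is applied on the set of differentiability points. By Rademacher
its complement is null, and a Lipschitz map sends null sets to null sets, so neither side sees the
difference. -/
theorem setIntegral_image (h : IsDeformation U T) {F : Type*} [NormedAddCommGroup F]
    [NormedSpace ℝ F] {A : Set E3} (hA : MeasurableSet A) (g : E3 → F) :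
    ∫ y in T '' A, g y = ∫ x in A, |(fderiv ℝ T x).det| • g (T x) := by
  set D := {x | DifferentiableAt ℝ T x}
  have hD : MeasurableSet D := measurableSet_of_differentiableAt ℝ T
  have hDn : volume Dᶜ = 0 := ae_iff.1 h.lipschitz.ae_differentiableAt
  have h1 := integral_image_eq_integral_abs_det_fderiv_smul volume (hA.inter hD)
    (fun x hx => (DifferentiableAt.hasFDerivAt hx.2).hasFDerivWithinAt) T.injective.injOn g
  have h2 : (A ∩ D : Set E3) =ᵐ[volume] A := by
    refine inter_ae_eq_left_of_ae_eq_univ ?_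
    rw [ae_eq_univ]
    exact hDn
  have h3 : (T '' (A ∩ D) : Set E3) =ᵐ[volume] T '' A := by
    rw [Set.image_inter T.injective]
    refine inter_ae_eq_left_of_ae_eq_univ ?_
    rw [ae_eq_univ, ← Set.image_compl_eq T.bijective]
    refine le_antisymm ((volume_image_le_of_lipschitzWith h.lipschitz _).trans ?_) zero_le
    rw [hDn, mul_zero]
  rw [setIntegral_congr_set h3, setIntegral_congr_set h2] at h1
  exact h1

theorem ae_differentiableAt_symm (h : IsDeformation U T) :
    ∀ᵐ x, DifferentiableAt ℝ T.symm (T x) :=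
  h.quasiMeasurePreserving_volume.ae h.lipschitz_symm.ae_differentiableAt

/-- This is the chain rule for $T\circ T^{-1}=\mathrm{id}$ at $Tx$; the points $x$ for which
$T^{-1}$ fails to be differentiable at $Tx$ form the preimage of a null set, again null. -/
theorem ae_fderiv_comp_fderiv_symm (h : IsDeformation U T) :
    ∀ᵐ x, (fderiv ℝ T x).comp (fderiv ℝ T.symm (T x)) = ContinuousLinearMap.id ℝ E3 := by
  filter_upwards [h.lipschitz.ae_differentiableAt, h.ae_differentiableAt_symm] with x h1 h2
  have h3 : HasFDerivAt T (fderiv ℝ T x) (T.symm (T x)) := by simpa using h1.hasFDerivAt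
  have h4 := h3.comp (T x) h2.hasFDerivAt
  have h5 : T ∘ T.symm = id := funext fun y => T.apply_symm_apply y
  rw [h5] at h4
  exact h4.unique (hasFDerivAt_id _)

end IsDeformation

/-! ### Weak convergence of derivatives of Lipschitz functions -/

/-- Replace $g$ by a smooth compactly supported function, at a small $L^1$ cost because the
derivatives are uniformly bounded, and then integrate by parts: the derivative falls on the smooth
function and the uniformly small `s t` remains. -/
theorem tendsto_integral_mul_fderiv_zero {ι : Type*} {l : Filter ι} {s : ι → E3 → ℝ} {C : ℝ≥0}
    (hs : ∀ᶠ t in l, LipschitzWith C (s t)) (h0 : ∀ ε > 0, ∀ᶠ t in l, ∀ x, |s t x| ≤ ε)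
    {g : E3 → ℝ} (hg : Integrable g) (v : E3) :
    Tendsto (fun t => ∫ x, g x * fderiv ℝ (s t) x v) l (𝓝 0) := by
  rw [Metric.tendsto_nhds]
  intro ε hε
  -- The added $1$ avoids division by zero. Both error terms will be at most $\varepsilon/3$, which
  -- leaves strict room below $\varepsilon$.
  set δ : ℝ := ε / (3 * (C * ‖v‖ + 1))
  have hδ : 0 < δ := by positivity
  obtain ⟨φ, hφc, hφs, hφ⟩ := (memLp_one_iff_integrable.2 hg).exist_eLpNorm_sub_le
    (by norm_num) le_rfl hδ
  have hφi : Integrable φ := hφs.continuous.integrable_of_hasCompactSupport hφc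
  have hφ1 : ∫ x, ‖g x - φ x‖ ≤ δ := by
    have h1 := integral_norm_eq_lintegral_enorm (hg.sub hφi).1
    simp only [Pi.sub_apply] at h1
    rw [h1]
    refine ENNReal.toReal_le_of_le_ofReal hδ.le ?_
    rw [eLpNorm_one_eq_lintegral_enorm] at hφ
    exact hφ
  set I : ℝ := ∫ x, |lineDeriv ℝ φ x (-v)|
  have hI : 0 ≤ I := integral_nonneg fun _ => abs_nonneg _
  obtain ⟨Cφ, hCφ⟩ := hφs.lipschitzWith_of_hasCompactSupport hφc (by simp)
  have hφd : ∀ x, lineDeriv ℝ φ x (-v) = fderiv ℝ φ x (-v) := fun x =>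
    ((hφs.differentiable (by simp)) x).lineDeriv_eq_fderiv
  have hφdi : Integrable fun x => lineDeriv ℝ φ x (-v) := by
    simp only [hφd]
    refine Continuous.integrable_of_hasCompactSupport
      ((hφs.continuous_fderiv (by simp)).clm_apply continuous_const) ?_
    exact hφc.fderiv_apply (𝕜 := ℝ) (-v)
  filter_upwards [hs, h0 (ε / (3 * (I + 1))) (by positivity)] with t hst h0t
  rw [dist_zero_right]
  have hbd : ∀ x, |fderiv ℝ (s t) x v| ≤ C * ‖v‖ := fun x =>
    ((fderiv ℝ (s t) x).le_opNorm v).trans (by gcongr; exact norm_fderiv_le_of_lipschitz ℝ hst)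
  have hms : AEStronglyMeasurable (fun x => fderiv ℝ (s t) x v) volume :=
    (measurable_fderiv_apply_const ℝ (s t) v).aestronglyMeasurable
  have hint : ∀ {ψ : E3 → ℝ}, Integrable ψ → Integrable fun x => ψ x * fderiv ℝ (s t) x v :=
    fun hψ => hψ.mul_bdd (c := C * ‖v‖) hms (Eventually.of_forall hbd)
  have hsplit : ∫ x, g x * fderiv ℝ (s t) x v
      = (∫ x, (g x - φ x) * fderiv ℝ (s t) x v) + ∫ x, lineDeriv ℝ φ x (-v) * s t x := by
    rw [← hst.integral_lineDeriv_mul_eq hCφ hφc v]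
    have h1 : ∫ x, lineDeriv ℝ (s t) x v * φ x = ∫ x, φ x * fderiv ℝ (s t) x v := by
      refine integral_congr_ae ?_
      filter_upwards [hst.ae_differentiableAt] with x hx
      rw [hx.lineDeriv_eq_fderiv, mul_comm]
    have h2 := integral_add (hint (hg.sub hφi)) (hint hφi)
    simp only [Pi.sub_apply] at h2
    rw [h1, ← h2]
    congr 1 with x
    ring
  have b1 : ‖∫ x, (g x - φ x) * fderiv ℝ (s t) x v‖ ≤ δ * (C * ‖v‖) := by
    refine (norm_integral_le_integral_norm _).trans ?_
    calc ∫ x, ‖(g x - φ x) * fderiv ℝ (s t) x v‖ ≤ ∫ x, ‖g x - φ x‖ * (C * ‖v‖) := by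
          refine integral_mono (hint (hg.sub hφi)).norm ((hg.sub hφi).norm.mul_const _) fun x => ?_
          simp only [norm_mul]
          gcongr
          exact hbd x
      _ = (∫ x, ‖g x - φ x‖) * (C * ‖v‖) := integral_mul_const _ _
      _ ≤ _ := by gcongr
  have b2 : ‖∫ x, lineDeriv ℝ φ x (-v) * s t x‖ ≤ I * (ε / (3 * (I + 1))) := by
    refine (norm_integral_le_integral_norm _).trans ?_
    rw [← integral_mul_const]
    refine integral_mono_of_nonneg (Eventually.of_forall fun _ => norm_nonneg _)
      (hφdi.norm.mul_const _) (Eventually.of_forall fun x => ?_)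
    simp only [norm_mul, Real.norm_eq_abs]
    gcongr
    exact h0t x
  have b3 : δ * (C * ‖v‖) ≤ ε / 3 := by
    have : δ * (C * ‖v‖ + 1) = ε / 3 := by
      simp only [δ]
      field_simp
    nlinarith
  have b4 : I * (ε / (3 * (I + 1))) ≤ ε / 3 := by
    have : (I + 1) * (ε / (3 * (I + 1))) = ε / 3 := by field_simp
    have h5 : 0 ≤ ε / (3 * (I + 1)) := by positivity
    nlinarith
  rw [hsplit]
  refine lt_of_le_of_lt (norm_add_le _ _) ?_
  linarith

theorem LipschitzWith.coord {T : E3 → E3} {C : ℝ≥0} (hT : LipschitzWith C T) (i : Fin 3) :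
    LipschitzWith C fun x => T x i := by
  refine LipschitzWith.of_dist_le_mul fun x y => ?_
  refine le_trans ?_ (hT.dist_le_mul x y)
  rw [dist_eq_norm, dist_eq_norm, ← PiLp.sub_apply]
  exact PiLp.norm_apply_le _ i

theorem fderiv_coord {T : E3 → E3} {x : E3} (hT : DifferentiableAt ℝ T x) (i : Fin 3) (v : E3) :
    fderiv ℝ (fun y => T y i) x v = fderiv ℝ T x v i := by
  have := ((EuclideanSpace.proj (𝕜 := ℝ) i).hasFDerivAt.comp x hT.hasFDerivAt).fderiv
  change fderiv ℝ (EuclideanSpace.proj (𝕜 := ℝ) i ∘ T) x v = _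
  rw [this]
  rfl

/-- Derivatives of uniformly Lipschitz, uniformly convergent maps converge weakly. -/
theorem tendsto_integral_mul_fderiv {ι : Type*} {l : Filter ι} {R : ι → E3 → E3} {θ : E3 → E3}
    {C : ℝ≥0} (hR : ∀ᶠ t in l, LipschitzWith C (R t)) (hθ : LipschitzWith C θ)
    (h0 : ∀ ε > 0, ∀ᶠ t in l, ∀ x, ‖R t x - θ x‖ ≤ ε)
    {U : Set E3} (hU : MeasurableSet U) {g : E3 → ℝ} (hg : IntegrableOn g U) (v : E3) (i : Fin 3) :
    Tendsto (fun t => ∫ x in U, g x * fderiv ℝ (R t) x v i) l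
      (𝓝 (∫ x in U, g x * fderiv ℝ θ x v i)) := by
  have hg' : Integrable (U.indicator g) := (integrable_indicator_iff hU).2 hg
  have key := tendsto_integral_mul_fderiv_zero (l := l) (s := fun t x => R t x i - θ x i)
    (C := C + C) (hR.mono fun t ht => (LipschitzWith.coord ht i).sub (LipschitzWith.coord hθ i))
    (fun ε hε => (h0 ε hε).mono fun t ht x => by
      rw [← PiLp.sub_apply]
      exact (PiLp.norm_apply_le _ i).trans (ht x)) hg' v
  rw [← tendsto_sub_nhds_zero_iff]
  refine key.congr' ?_
  filter_upwards [hR] with t ht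
  have hint : ∀ {S : E3 → E3}, LipschitzWith C S →
      IntegrableOn (fun x => g x * fderiv ℝ S x v i) U := fun {S} hS => by
    refine Integrable.mul_bdd (c := C * ‖v‖) hg ?_ (Eventually.of_forall fun x => ?_)
    · exact ((EuclideanSpace.proj (𝕜 := ℝ) i).continuous.measurable.comp
        (measurable_fderiv_apply_const ℝ S v)).aestronglyMeasurable
    · exact (PiLp.norm_apply_le _ i).trans (((fderiv ℝ S x).le_opNorm v).trans
        (by gcongr; exact norm_fderiv_le_of_lipschitz ℝ hS))
  rw [← integral_sub (hint ht) (hint hθ), ← integral_indicator hU]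
  refine integral_congr_ae ?_
  filter_upwards [ht.ae_differentiableAt, hθ.ae_differentiableAt] with x h1 h2
  have h3 : fderiv ℝ (fun y => R t y i - θ y i) x v = fderiv ℝ (R t) x v i - fderiv ℝ θ x v i := by
    rw [← fderiv_coord h1, ← fderiv_coord h2]
    have d1 : DifferentiableAt ℝ (fun y => R t y i) x :=
      (EuclideanSpace.proj (𝕜 := ℝ) i).differentiableAt.comp x h1
    have d2 : DifferentiableAt ℝ (fun y => θ y i) x :=
      (EuclideanSpace.proj (𝕜 := ℝ) i).differentiableAt.comp x h2
    rw [fderiv_fun_sub d1 d2]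
    rfl
  rw [h3]
  by_cases hx : x ∈ U
  · simp only [Set.indicator_of_mem hx]
    ring
  · simp only [Set.indicator_of_notMem hx, zero_mul]

/-! ### Adjugates and cofactors -/

/-- The entries of a linear map. -/
def toMat : Mat3 ≃⋆ₐ[ℝ] Matrix (Fin 3) (Fin 3) ℝ := (Matrix.toEuclideanCLM (𝕜 := ℝ)).symm

theorem toMat_apply (F : Mat3) (i j : Fin 3) :
    toMat F i j = F (EuclideanSpace.single j 1) i := by
  obtain ⟨M, rfl⟩ := EquivLike.surjective toMat.symm F
  rw [StarAlgEquiv.apply_symm_apply]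
  simp [toMat, Matrix.ofLp_toEuclideanCLM]

theorem det_eq (F : Mat3) : F.det = (toMat F).det := by
  obtain ⟨M, rfl⟩ := EquivLike.surjective toMat.symm F
  rw [StarAlgEquiv.apply_symm_apply]
  change LinearMap.det ((Matrix.toEuclideanCLM (𝕜 := ℝ) M : E3 →L[ℝ] E3) : E3 →ₗ[ℝ] E3) = _
  rw [Matrix.coe_toEuclideanCLM_eq_toEuclideanLin, Matrix.toEuclideanLin_eq_toLin_orthonormal,
    LinearMap.det_toLin]

/-- The adjugate of a linear map. -/
def adjg (F : Mat3) : Mat3 := toMat.symm (toMat F).adjugate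

/-- The cofactor map. -/
def cofr (F : Mat3) : Mat3 := ContinuousLinearMap.adjoint (adjg F)

/-- The trace. -/
def tr3 (F : Mat3) : ℝ := (toMat F).trace

theorem toMat_adjg (F : Mat3) : toMat (adjg F) = (toMat F).adjugate := by
  simp [adjg]

/-- With $A=F^{-1}$ these are $\det F\,F^{-1}=\operatorname{adj}F$ and $\det
F\,\operatorname{adj}(F^{-1})=F$. In a change of variables the Jacobian thus absorbs the inverse
derivative carried by pulled-back test fields. -/
theorem adjg_smul_of_mul_eq_one {F A : Mat3} (h : F * A = 1) :
    F.det • A = adjg F ∧ F.det • adjg A = F := by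
  have h1 : toMat F * toMat A = 1 := by rw [← map_mul, h, map_one]
  have h2 : toMat A * toMat F = 1 := mul_eq_one_comm.1 h1
  have hd : (toMat F).det * (toMat A).det = 1 := by rw [← Matrix.det_mul, h1, Matrix.det_one]
  constructor
  · apply EquivLike.injective toMat
    rw [map_smul, toMat_adjg, det_eq]
    calc (toMat F).det • toMat A = ((toMat F).adjugate * toMat F) * toMat A := by
          rw [Matrix.adjugate_mul, Matrix.smul_mul, one_mul]
      _ = _ := by rw [mul_assoc, h1, mul_one]
  · apply EquivLike.injective toMat
    rw [map_smul, toMat_adjg, det_eq]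
    calc (toMat F).det • (toMat A).adjugate
        = (toMat F).det • ((toMat A).adjugate * (toMat A * toMat F)) := by rw [h2, mul_one]
      _ = (toMat F).det • ((toMat A).det • toMat F) := by
          rw [← mul_assoc, Matrix.adjugate_mul, Matrix.smul_mul, one_mul]
      _ = toMat F := by rw [smul_smul, hd, one_smul]

/-- Entries of a $3\times3$ adjugate are quadratic polynomials, so the expansion in $t$ is exact and
stops at order two. -/
theorem adjg_one_add_smul (t : ℝ) (R : Mat3) :
    adjg (1 + t • R) = 1 + t • (tr3 R • 1 - R + t • adjg R) := by
  apply EquivLike.injective toMat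
  rw [toMat_adjg]
  simp only [map_add, map_sub, map_smul, map_one, toMat_adjg, tr3]
  generalize toMat R = M
  ext i j
  fin_cases i <;> fin_cases j <;>
    simp [Matrix.adjugate_fin_three, Matrix.trace_fin_three] <;> ring

theorem cofr_one_add_smul (t : ℝ) (R : Mat3) :
    cofr (1 + t • R) = 1 + t • (tr3 R • 1 - ContinuousLinearMap.adjoint R + t • cofr R) := by
  rw [cofr, adjg_one_add_smul]
  simp only [map_add, ← ContinuousLinearMap.star_eq_adjoint, star_smul, star_one,
    star_trivial, cofr, star_add, star_sub]

theorem det_one_add_smul (t : ℝ) (R : Mat3) :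
    (1 + t • R).det = 1 + t * (tr3 R + t * (tr3 (adjg R) + t * R.det)) := by
  rw [det_eq, det_eq]
  simp only [map_add, map_smul, map_one, toMat_adjg, tr3]
  generalize toMat R = M
  simp [Matrix.adjugate_fin_three, Matrix.trace_fin_three, Matrix.det_fin_three]
  ring

theorem continuous_toMat : Continuous toMat :=
  LinearMap.continuous_of_finiteDimensional
    (toMat.toAlgEquiv.toLinearEquiv : Mat3 ≃ₗ[ℝ] Matrix (Fin 3) (Fin 3) ℝ).toLinearMap

theorem continuous_toMat_symm : Continuous toMat.symm :=
  LinearMap.continuous_of_finiteDimensional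
    (toMat.symm.toAlgEquiv.toLinearEquiv : Matrix (Fin 3) (Fin 3) ℝ ≃ₗ[ℝ] Mat3).toLinearMap

theorem continuous_adjg : Continuous adjg :=
  continuous_toMat_symm.comp continuous_toMat.matrix_adjugate

theorem continuous_tr3 : Continuous tr3 := continuous_toMat.matrix_trace

theorem continuous_det3 : Continuous fun F : Mat3 => F.det := by
  simp only [det_eq]
  exact continuous_toMat.matrix_det

theorem continuous_cofr : Continuous cofr :=
  (ContinuousLinearMap.adjoint (𝕜 := ℝ) (E := E3) (F := E3)).continuous.comp continuous_adjg

theorem exists_bound_of_continuous {F : Type*} [NormedAddCommGroup F] {g : Mat3 → F}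
    (hg : Continuous g) (M : ℝ) : ∃ C : ℝ, 0 ≤ C ∧ ∀ A : Mat3, ‖A‖ ≤ M → ‖g A‖ ≤ C := by
  obtain ⟨C, hC⟩ := (isCompact_closedBall (0 : Mat3) M).exists_bound_of_continuousOn hg.continuousOn
  exact ⟨max C 0, le_max_right _ _, fun A hA => (hC A (by simpa using hA)).trans (le_max_left _ _)⟩

theorem adjg_apply (F : Mat3) (w : E3) (i : Fin 3) :
    adjg F w i = ((toMat F).adjugate.mulVec w.ofLp) i := by
  rw [adjg]
  rfl

theorem tr3_eq (F : Mat3) : tr3 F = ∑ i, F (EuclideanSpace.single i 1) i := by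
  simp [tr3, Matrix.trace, toMat_apply]

/-! ### Pull-back of fields and of their curls. -/

/-- Covariant pull-back of a field. -/
def covPull (T : E3 → E3) (u : E3 → E3) (x : E3) : E3 :=
  ContinuousLinearMap.adjoint (fderiv ℝ T x) (u (T x))

/-- Pull-back of a curl. -/
def curlPull (T : E3 → E3) (w : E3 → E3) (x : E3) : E3 := adjg (fderiv ℝ T x) (w (T x))

theorem covPull_apply (T u : E3 → E3) (x : E3) (j : Fin 3) :
    covPull T u x j = inner ℝ (fderiv ℝ T x (EuclideanSpace.single j 1)) (u (T x)) := by
  rw [covPull, ← ContinuousLinearMap.adjoint_inner_right, EuclideanSpace.inner_single_left]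
  simp

theorem contDiff_covPull {T u : E3 → E3} (hT : ContDiff ℝ (⊤ : ℕ∞) T)
    (hu : ContDiff ℝ (⊤ : ℕ∞) u) : ContDiff ℝ (⊤ : ℕ∞) (covPull T u) := by
  rw [contDiff_euclidean]
  intro j
  simp only [covPull_apply]
  refine ContDiff.inner ℝ ?_ (hu.comp hT)
  exact (hT.fderiv_right (m := (⊤ : ℕ∞)) (by simp)).clm_apply contDiff_const

/-- The classical transformation rule of the curl under the covariant pull-back. -/
theorem curl_covPull {T u : E3 → E3} (hT : ContDiff ℝ (⊤ : ℕ∞) T)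
    (hu : ContDiff ℝ (⊤ : ℕ∞) u) (x : E3) : curl (covPull T u) x = curlPull T (curl u) x := by
  have hdT : ∀ y, DifferentiableAt ℝ T y := hT.differentiable (by simp)
  have hdu : ∀ y, DifferentiableAt ℝ u y := hu.differentiable (by simp)
  have hdT' : DifferentiableAt ℝ (fderiv ℝ T) x :=
    (hT.fderiv_right (m := (⊤ : ℕ∞)) (by simp)).differentiable (by simp) x
  set D2 := fderiv ℝ (fderiv ℝ T) x
  have hsymm : ∀ a b, D2 a b = D2 b a := fun a b =>
    (hT.contDiffAt.isSymmSndFDerivAt (by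
      rw [minSmoothness_of_isRCLikeNormedField]
      exact (WithTop.coe_le_coe.2 le_top : ((2 : ℕ∞) : WithTop ℕ∞) ≤ ((⊤ : ℕ∞) : WithTop ℕ∞)))) a b
  have hp : ∀ i j, partialDeriv i j (covPull T u) x
      = inner ℝ (D2 (EuclideanSpace.single i 1) (EuclideanSpace.single j 1)) (u (T x))
        + inner ℝ (fderiv ℝ T x (EuclideanSpace.single j 1))
          (fderiv ℝ u (T x) (fderiv ℝ T x (EuclideanSpace.single i 1))) := fun i j => by
    have h0 : DifferentiableAt ℝ (covPull T u) x :=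
      (contDiff_covPull hT hu).differentiable (by simp) x
    rw [partialDeriv, ← fderiv_coord h0]
    simp only [covPull_apply]
    have h1 : HasFDerivAt (fun y => fderiv ℝ T y (EuclideanSpace.single j 1))
        (D2.flip (EuclideanSpace.single j 1)) x := by
      simpa using! hdT'.hasFDerivAt.clm_apply (hasFDerivAt_const (EuclideanSpace.single j 1) x)
    have h2 : HasFDerivAt (fun y => u (T y)) ((fderiv ℝ u (T x)).comp (fderiv ℝ T x)) x :=
      (hdu (T x)).hasFDerivAt.comp x (hdT x).hasFDerivAt
    rw [(h1.inner ℝ h2).fderiv]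
    simp [fderivInnerCLM_apply, add_comm]
  have hexp : ∀ a b : E3, inner ℝ b (fderiv ℝ u (T x) a)
      = ∑ k, ∑ l, b k * (a l * partialDeriv l k u (T x)) := fun a b => by
    have ha : a = ∑ l, a l • EuclideanSpace.single l (1 : ℝ) := by
      ext i
      fin_cases i <;> simp [Fin.sum_univ_three]
    conv_lhs => rw [ha]
    simp only [map_sum, map_smul, PiLp.inner_apply, partialDeriv]
    refine Finset.sum_congr rfl fun k _ => ?_
    simp only [WithLp.ofLp_sum, WithLp.ofLp_smul, Finset.sum_apply, Pi.smul_apply, smul_eq_mul,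
      RCLike.inner_apply, conj_trivial, Finset.sum_mul]
    refine Finset.sum_congr rfl fun l _ => ?_
    ring
  ext i
  rw [curlPull, adjg_apply]
  simp only [curl, hp, hexp]
  -- Second derivatives of $T$ are symmetric and cancel in the antisymmetrized expression; what is
  -- left is the quadratic form in $DT$ given by the adjugate.
  rw [hsymm (EuclideanSpace.single 2 1) (EuclideanSpace.single 1 1),
    hsymm (EuclideanSpace.single 0 1) (EuclideanSpace.single 2 1),
    hsymm (EuclideanSpace.single 1 1) (EuclideanSpace.single 0 1)]
  rw [Matrix.adjugate_fin_three]
  simp only [toMat_apply]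
  generalize fderiv ℝ T x = F
  fin_cases i <;> simp [Fin.sum_univ_three, Matrix.mulVec, dotProduct] <;> ring

/-! ### Auxiliary facts on square integrable fields -/

section L2

variable {α : Type*} {m : MeasurableSpace α} {μ : Measure α}

/-- Dominated convergence for squared norms, reduced to sequences because the filter is countably
generated. -/
theorem tendsto_eLpNorm_two_zero {F : Type*} [NormedAddCommGroup F] {ι : Type*} {l : Filter ι}
    [l.IsCountablyGenerated] {g : ι → α → F} {G : α → ℝ}
    (hm : ∀ᶠ i in l, AEStronglyMeasurable (g i) μ) (hG : MemLp G 2 μ)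
    (hbd : ∀ᶠ i in l, ∀ᵐ x ∂μ, ‖g i x‖ ≤ G x)
    (hlim : ∀ᵐ x ∂μ, Tendsto (fun i => g i x) l (𝓝 0)) :
    Tendsto (fun i => eLpNorm (g i) 2 μ) l (𝓝 0) := by
  refine tendsto_of_seq_tendsto fun k hk => ?_
  obtain ⟨N, hN⟩ := eventually_atTop.1 ((hk.eventually hm).and (hk.eventually hbd))
  rw [← tendsto_add_atTop_iff_nat N]
  set s : ℕ → ι := fun n => k (n + N)
  have hs : Tendsto s atTop l := (tendsto_add_atTop_iff_nat (f := k) N).2 hk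
  have hsN : ∀ n, _ := fun n => hN (n + N) (Nat.le_add_left N n)
  have h2 : ∀ {F' : Type _} [NormedAddCommGroup F'] (f : α → F'),
      eLpNorm f 2 μ = (∫⁻ x, ‖f x‖ₑ ^ (2 : ℝ) ∂μ) ^ (1 / (2 : ℝ)) := fun f => by
    rw [eLpNorm_eq_lintegral_rpow_enorm_toReal (by norm_num) (by norm_num)]
    simp
  have h3 : (∫⁻ x, ‖G x‖ₑ ^ (2 : ℝ) ∂μ) ≠ ⊤ := by
    have := hG.2
    rw [eLpNorm_eq_lintegral_rpow_enorm_toReal (by norm_num) (by norm_num),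
      ENNReal.rpow_lt_top_iff_of_pos (by norm_num)] at this
    simpa using this.ne
  have key : Tendsto (fun n => ∫⁻ x, ‖g (s n) x‖ₑ ^ (2 : ℝ) ∂μ) atTop (𝓝 (∫⁻ _, 0 ∂μ)) := by
    refine tendsto_lintegral_of_dominated_convergence' (fun x => ‖G x‖ₑ ^ (2 : ℝ))
      (fun n => (hsN n).1.enorm.pow_const _) (fun n => ?_) h3 ?_
    · filter_upwards [(hsN n).2] with x hx
      gcongr
      exact enorm_le_iff_norm_le.2 (hx.trans (le_abs_self _))
    · filter_upwards [hlim] with x hx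
      have h4 : Tendsto (fun n => ‖g (s n) x‖ₑ) atTop (𝓝 0) := by simpa using (hx.comp hs).enorm
      have := (ENNReal.continuous_rpow_const (y := 2)).tendsto 0 |>.comp h4
      simpa using! this
  have h5 := (ENNReal.continuous_rpow_const (y := 1 / 2)).tendsto (∫⁻ _, 0 ∂μ) |>.comp key
  have h6 : (fun n => eLpNorm (g (s n)) 2 μ)
      = (fun a : ENNReal => a ^ (1 / 2 : ℝ)) ∘ fun n => ∫⁻ x, ‖g (s n) x‖ₑ ^ (2 : ℝ) ∂μ :=
    funext fun n => h2 _
  change Tendsto (fun n => eLpNorm (g (s n)) 2 μ) atTop (𝓝 0)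
  rw [h6]
  simpa using h5

theorem integral_alternating_six {a b c d e f : α → ℝ} (ha : Integrable a μ) (hb : Integrable b μ)
    (hc : Integrable c μ) (hd : Integrable d μ) (he : Integrable e μ) (hf : Integrable f μ) :
    ∫ x, (a - b + c - d + e - f) x ∂μ = (((((∫ x, a x ∂μ) - ∫ x, b x ∂μ) + ∫ x, c x ∂μ)
      - ∫ x, d x ∂μ) + ∫ x, e x ∂μ) - ∫ x, f x ∂μ := by
  rw [integral_sub' ((((ha.sub hb).add hc).sub hd).add he) hf,
    integral_add' (((ha.sub hb).add hc).sub hd) he, integral_sub' ((ha.sub hb).add hc) hd,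
    integral_add' (ha.sub hb) hc, integral_sub' ha hb]

theorem abs_integral_inner_le {a b : α → E3} (ha : MemLp a 2 μ) (hb : MemLp b 2 μ) :
    |∫ x, inner ℝ (a x) (b x) ∂μ| ≤ (eLpNorm a 2 μ).toReal * (eLpNorm b 2 μ).toReal := by
  have h1 : ∫ x, inner ℝ (a x) (b x) ∂μ = inner ℝ (ha.toLp a) (hb.toLp b) := by
    rw [L2.inner_def]
    refine integral_congr_ae ?_
    filter_upwards [ha.coeFn_toLp, hb.coeFn_toLp] with x h1 h2
    rw [h1, h2]
  rw [h1, ← Lp.norm_toLp a ha, ← Lp.norm_toLp b hb]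
  exact abs_real_inner_le_norm _ _

theorem integrable_inner {a b : α → E3} (ha : MemLp a 2 μ) (hb : MemLp b 2 μ) :
    Integrable (fun x => inner ℝ (a x) (b x)) μ := by
  refine (L2.integrable_inner (𝕜 := ℝ) (ha.toLp a) (hb.toLp b)).congr ?_
  filter_upwards [ha.coeFn_toLp, hb.coeFn_toLp] with x h1 h2
  rw [h1, h2]

end L2

theorem AEStronglyMeasurable.apply_clm {α : Type*} {m : MeasurableSpace α} {μ : Measure α}
    {A : α → Mat3} {u : α → E3} (hA : AEStronglyMeasurable A μ) (hu : AEStronglyMeasurable u μ) :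
    AEStronglyMeasurable (fun x => A x (u x)) μ :=
  (isBoundedBilinearMap_apply (𝕜 := ℝ) (E := E3) (F := E3)).continuous.comp_aestronglyMeasurable
    (hA.prodMk hu)

/-! ### Integration by parts for the curl -/

namespace IsTestField

variable {Ω : Set E3} {φ ψ : E3 → E3}

theorem differentiable (h : IsTestField Ω φ) : Differentiable ℝ φ := h.smooth.differentiable (by simp)

theorem continuous_partialDeriv (h : IsTestField Ω φ) (i j : Fin 3) :
    Continuous (partialDeriv i j φ) :=
  (EuclideanSpace.proj (𝕜 := ℝ) j).continuous.comp
    ((h.smooth.continuous_fderiv (by simp)).clm_apply continuous_const)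

theorem continuous_curl (h : IsTestField Ω φ) : Continuous (curl φ) := by
  refine (PiLp.continuous_toLp 2 _).comp (continuous_pi fun i => ?_)
  fin_cases i
  · exact (h.continuous_partialDeriv 1 2).sub (h.continuous_partialDeriv 2 1)
  · exact (h.continuous_partialDeriv 2 0).sub (h.continuous_partialDeriv 0 2)
  · exact (h.continuous_partialDeriv 0 1).sub (h.continuous_partialDeriv 1 0)

theorem curl_eq_zero {x : E3} (hx : x ∉ tsupport φ) : curl φ x = 0 := by
  have h0 : fderiv ℝ φ x = 0 :=
    Function.notMem_support.1 fun h => hx ((support_fderiv_subset ℝ) h)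
  ext i
  fin_cases i <;> simp [curl, partialDeriv, h0]

theorem hasCompactSupport_curl (h : IsTestField Ω φ) : HasCompactSupport (curl φ) :=
  HasCompactSupport.intro h.compactSupport fun _ hx => curl_eq_zero hx

theorem memLp (h : IsTestField Ω φ) (μ : Measure E3) [IsFiniteMeasureOnCompacts μ] :
    MemLp φ 2 μ := h.smooth.continuous.memLp_of_hasCompactSupport h.compactSupport

theorem memLp_curl (h : IsTestField Ω φ) (μ : Measure E3) [IsFiniteMeasureOnCompacts μ] :
    MemLp (curl φ) 2 μ := h.continuous_curl.memLp_of_hasCompactSupport h.hasCompactSupport_curl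

theorem integral_partialDeriv_mul (hφ : IsTestField Ω φ) (hψ : IsTestField Ω ψ) (i j k : Fin 3) :
    ∫ x, partialDeriv i j φ x * ψ x k = -∫ x, partialDeriv i k ψ x * φ x j := by
  have c1 : Continuous fun x => φ x j :=
    (EuclideanSpace.proj (𝕜 := ℝ) j).continuous.comp hφ.smooth.continuous
  have c2 : Continuous fun x => ψ x k :=
    (EuclideanSpace.proj (𝕜 := ℝ) k).continuous.comp hψ.smooth.continuous
  have s1 : HasCompactSupport fun x => φ x j :=
    hφ.compactSupport.comp_left (g := fun y : E3 => y j) rfl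
  have s2 : HasCompactSupport fun x => ψ x k :=
    hψ.compactSupport.comp_left (g := fun y : E3 => y k) rfl
  have d1 : Differentiable ℝ fun x => φ x j :=
    (EuclideanSpace.proj (𝕜 := ℝ) j).differentiable.comp hφ.differentiable
  have d2 : Differentiable ℝ fun x => ψ x k :=
    (EuclideanSpace.proj (𝕜 := ℝ) k).differentiable.comp hψ.differentiable
  have e1 : ∀ x, partialDeriv i j φ x
      = fderiv ℝ (fun x => φ x j) x (EuclideanSpace.single i 1) := fun x =>
    (fderiv_coord (hφ.differentiable x) j _).symm
  have e2 : ∀ x, partialDeriv i k ψ x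
      = fderiv ℝ (fun x => ψ x k) x (EuclideanSpace.single i 1) := fun x =>
    (fderiv_coord (hψ.differentiable x) k _).symm
  have p1 := hφ.continuous_partialDeriv i j
  have p2 := hψ.continuous_partialDeriv i k
  have key := integral_mul_fderiv_eq_neg_fderiv_mul_of_integrable (μ := volume)
    (f := fun x => φ x j) (g := fun x => ψ x k) (v := EuclideanSpace.single i 1)
    (by simp only [← e1]; exact (p1.mul c2).integrable_of_hasCompactSupport s2.mul_left)
    (by simp only [← e2]; exact (c1.mul p2).integrable_of_hasCompactSupport s1.mul_right)
    ((c1.mul c2).integrable_of_hasCompactSupport s1.mul_right)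
    (fun x _ => d1 x) (fun x _ => d2 x)
  simp only [← e1, ← e2] at key
  rw [← neg_eq_iff_eq_neg.2 key]
  simp only [mul_comm]

theorem integral_curl_inner (hφ : IsTestField Ω φ) (hψ : IsTestField Ω ψ) :
    ∫ x in Ω, inner ℝ (curl φ x) (ψ x) = ∫ x in Ω, inner ℝ (φ x) (curl ψ x) := by
  have r1 : ∫ x in Ω, inner ℝ (curl φ x) (ψ x) = ∫ x, inner ℝ (curl φ x) (ψ x) :=
    setIntegral_eq_integral_of_forall_compl_eq_zero fun x hx => by
      rw [image_eq_zero_of_notMem_tsupport fun h => hx (hψ.support_subset h), inner_zero_right]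
  have r2 : ∫ x in Ω, inner ℝ (φ x) (curl ψ x) = ∫ x, inner ℝ (φ x) (curl ψ x) :=
    setIntegral_eq_integral_of_forall_compl_eq_zero fun x hx => by
      rw [image_eq_zero_of_notMem_tsupport fun h => hx (hφ.support_subset h), inner_zero_left]
  have hint : ∀ {φ ψ : E3 → E3}, IsTestField Ω φ → IsTestField Ω ψ → ∀ i j k,
      Integrable fun x => partialDeriv i j φ x * ψ x k := fun hφ hψ i j k =>
    ((hφ.continuous_partialDeriv i j).mul ((EuclideanSpace.proj (𝕜 := ℝ) k).continuous.comp
      hψ.smooth.continuous)).integrable_of_hasCompactSupport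
      (HasCompactSupport.mul_left (hψ.compactSupport.comp_left (g := fun y : E3 => y k) rfl))
  rw [r1, r2]
  have s1 : ∫ x, inner ℝ (curl φ x) (ψ x)
      = (((((∫ x, partialDeriv 1 2 φ x * ψ x 0) - ∫ x, partialDeriv 2 1 φ x * ψ x 0)
        + ∫ x, partialDeriv 2 0 φ x * ψ x 1) - ∫ x, partialDeriv 0 2 φ x * ψ x 1)
        + ∫ x, partialDeriv 0 1 φ x * ψ x 2) - ∫ x, partialDeriv 1 0 φ x * ψ x 2 := by
    rw [← integral_alternating_six (hint hφ hψ 1 2 0) (hint hφ hψ 2 1 0) (hint hφ hψ 2 0 1)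
      (hint hφ hψ 0 2 1) (hint hφ hψ 0 1 2) (hint hφ hψ 1 0 2)]
    congr 1 with x
    simp [curl, PiLp.inner_apply, Fin.sum_univ_three]
    ring
  have s2 : ∫ x, inner ℝ (φ x) (curl ψ x)
      = (((((∫ x, partialDeriv 1 2 ψ x * φ x 0) - ∫ x, partialDeriv 2 1 ψ x * φ x 0)
        + ∫ x, partialDeriv 2 0 ψ x * φ x 1) - ∫ x, partialDeriv 0 2 ψ x * φ x 1)
        + ∫ x, partialDeriv 0 1 ψ x * φ x 2) - ∫ x, partialDeriv 1 0 ψ x * φ x 2 := by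
    rw [← integral_alternating_six (hint hψ hφ 1 2 0) (hint hψ hφ 2 1 0) (hint hψ hφ 2 0 1)
      (hint hψ hφ 0 2 1) (hint hψ hφ 0 1 2) (hint hψ hφ 1 0 2)]
    congr 1 with x
    simp [curl, PiLp.inner_apply, Fin.sum_univ_three]
    ring
  rw [s1, s2, hφ.integral_partialDeriv_mul hψ 1 2 0, hφ.integral_partialDeriv_mul hψ 2 1 0,
    hφ.integral_partialDeriv_mul hψ 2 0 1, hφ.integral_partialDeriv_mul hψ 0 2 1,
    hφ.integral_partialDeriv_mul hψ 0 1 2, hφ.integral_partialDeriv_mul hψ 1 0 2]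
  ring

theorem add (hφ : IsTestField Ω φ) (hψ : IsTestField Ω ψ) : IsTestField Ω (φ + ψ) :=
  ⟨hφ.smooth.add hψ.smooth, hφ.compactSupport.add hψ.compactSupport,
    (tsupport_add φ ψ).trans (Set.union_subset hφ.support_subset hψ.support_subset)⟩

theorem smul (hφ : IsTestField Ω φ) (c : ℝ) : IsTestField Ω (c • φ) :=
  ⟨hφ.smooth.const_smul c, hφ.compactSupport.smul_left (f := fun _ => c),
    (tsupport_smul_subset_right (fun _ => c) φ).trans hφ.support_subset⟩

theorem zero : IsTestField Ω 0 := ⟨contDiff_const, HasCompactSupport.zero, by simp⟩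

theorem curl_add (hφ : IsTestField Ω φ) (hψ : IsTestField Ω ψ) :
    curl (φ + ψ) = curl φ + curl ψ := by
  ext x i
  have h := fderiv_add (hφ.differentiable x) (hψ.differentiable x)
  fin_cases i <;> simp [curl, partialDeriv, h] <;> ring

theorem curl_smul (hφ : IsTestField Ω φ) (c : ℝ) : curl (c • φ) = c • curl φ := by
  ext x i
  have h := fderiv_const_smul (hφ.differentiable x) c
  fin_cases i <;> simp [curl, partialDeriv, h] <;> ring

end IsTestField

/-! ### Approximation by test fields -/

/-- Membership in `H₀(curl)` expressed through approximation only. -/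
structure InHZero (Ω : Set E3) (u w : E3 → E3) : Prop where
  memLp : MemLp u 2 (volume.restrict Ω)
  memLp_curl : MemLp w 2 (volume.restrict Ω)
  approx : ∀ ε : ENNReal, ε ≠ 0 → ∃ φ, IsTestField Ω φ ∧
    eLpNorm (fun x => φ x - u x) 2 (volume.restrict Ω) ≤ ε ∧
    eLpNorm (fun x => curl φ x - w x) 2 (volume.restrict Ω) ≤ ε

theorem IsTestField.inHZero {Ω : Set E3} {φ : E3 → E3} (h : IsTestField Ω φ) :
    InHZero Ω φ (curl φ) :=
  ⟨h.memLp _, h.memLp_curl _, fun ε _ => ⟨φ, h, by simp, by simp⟩⟩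

/-- The identity holds for test fields by integration by parts, and both sides are continuous for
the $L^2$ convergence of fields and curls. -/
theorem InHZero.weak_curl {Ω : Set E3} {u w φ : E3 → E3} (h : InHZero Ω u w)
    (hφ : IsTestField Ω φ) :
    ∫ x in Ω, inner ℝ (w x) (φ x) = ∫ x in Ω, inner ℝ (u x) (curl φ x) := by
  have m1 := hφ.memLp (volume.restrict Ω)
  have m2 := hφ.memLp_curl (volume.restrict Ω)
  set A := (eLpNorm φ 2 (volume.restrict Ω)).toReal + (eLpNorm (curl φ) 2 (volume.restrict Ω)).toReal
  have hA : 0 ≤ A := by positivity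
  rw [← sub_eq_zero, ← abs_nonpos_iff]
  refine le_of_forall_pos_le_add fun δ hδ => ?_
  obtain ⟨ψ, hψ, h1, h2⟩ := h.approx (ENNReal.ofReal (δ / (A + 1)))
    (by simp only [ne_eq, ENNReal.ofReal_eq_zero, not_le]; positivity)
  have n1 := hψ.memLp (volume.restrict Ω)
  have n2 := hψ.memLp_curl (volume.restrict Ω)
  have e : (∫ x in Ω, inner ℝ (w x) (φ x)) - ∫ x in Ω, inner ℝ (u x) (curl φ x)
      = (∫ x in Ω, inner ℝ (ψ x - u x) (curl φ x)) - ∫ x in Ω, inner ℝ (curl ψ x - w x) (φ x) := by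
    simp only [inner_sub_left]
    rw [integral_sub (integrable_inner n1 m2) (integrable_inner h.memLp m2),
      integral_sub (integrable_inner n2 m1) (integrable_inner h.memLp_curl m1),
      hψ.integral_curl_inner hφ]
    ring
  have b1 := abs_integral_inner_le (n1.sub h.memLp) m2
  have b2 := abs_integral_inner_le (n2.sub h.memLp_curl) m1
  have c1 := ENNReal.toReal_le_of_le_ofReal (by positivity) h1
  have c2 := ENNReal.toReal_le_of_le_ofReal (by positivity) h2
  rw [e, zero_add]
  refine (abs_sub _ _).trans ?_
  have hq : δ / (A + 1) * A ≤ δ := by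
    rw [div_mul_eq_mul_div, div_le_iff₀ (by positivity)]
    nlinarith
  calc _ ≤ δ / (A + 1) * (eLpNorm (curl φ) 2 (volume.restrict Ω)).toReal
        + δ / (A + 1) * (eLpNorm φ 2 (volume.restrict Ω)).toReal := by
        refine add_le_add (b1.trans ?_) (b2.trans ?_)
        · gcongr; exact c1
        · gcongr; exact c2
    _ = δ / (A + 1) * A := by simp only [A]; ring
    _ ≤ δ := hq

/-- The distributional curl condition is inherited from the approximating test fields, so
approximation alone characterizes the space. The rest of the argument works with `InHZero`, which is
easier to show closed and stable under pull-back. -/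
theorem isHZeroCurl_iff {Ω : Set E3} {u w : E3 → E3} : IsHZeroCurl Ω u w ↔ InHZero Ω u w := by
  constructor
  · intro h
    refine ⟨h.memLp, h.curl_memLp, fun ε hε => ?_⟩
    obtain ⟨φ, h1, h2, h3⟩ := h.approx
    obtain ⟨n, hn⟩ := ((h2.eventually_le_const (pos_iff_ne_zero.2 hε)).and
      (h3.eventually_le_const (pos_iff_ne_zero.2 hε))).exists
    exact ⟨φ n, h1 n, hn⟩
  · intro h
    refine ⟨⟨h.memLp, h.memLp_curl, fun φ hφ => h.weak_curl hφ⟩, ?_⟩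
    choose φ h1 h2 h3 using fun n : ℕ => h.approx ((n : ENNReal) + 1)⁻¹ (by simp)
    have hlim : Tendsto (fun n : ℕ => ((n : ENNReal) + 1)⁻¹) atTop (𝓝 0) := by
      have := (tendsto_add_atTop_iff_nat 1).2 ENNReal.tendsto_inv_nat_nhds_zero
      simpa using this
    exact ⟨φ, h1, tendsto_of_tendsto_of_tendsto_of_le_of_le tendsto_const_nhds hlim
      (fun _ => bot_le) h2, tendsto_of_tendsto_of_tendsto_of_le_of_le tendsto_const_nhds hlim
      (fun _ => bot_le) h3⟩

theorem InHZero.of_approx {Ω : Set E3} {u w : E3 → E3} (hu : MemLp u 2 (volume.restrict Ω))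
    (hw : MemLp w 2 (volume.restrict Ω))
    (h : ∀ ε : ENNReal, ε ≠ 0 → ∃ u' w', InHZero Ω u' w' ∧
      eLpNorm (fun x => u' x - u x) 2 (volume.restrict Ω) ≤ ε ∧
      eLpNorm (fun x => w' x - w x) 2 (volume.restrict Ω) ≤ ε) : InHZero Ω u w := by
  refine ⟨hu, hw, fun ε hε => ?_⟩
  have hε2 : ε / 2 ≠ 0 := (ENNReal.half_pos hε).ne'
  obtain ⟨u', w', h1, h2, h3⟩ := h (ε / 2) hε2
  obtain ⟨φ, k1, k2, k3⟩ := h1.approx (ε / 2) hε2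
  have tri : ∀ {a b c : E3 → E3}, MemLp a 2 (volume.restrict Ω) → MemLp b 2 (volume.restrict Ω) →
      MemLp c 2 (volume.restrict Ω) →
      eLpNorm (fun x => a x - b x) 2 (volume.restrict Ω) ≤ ε / 2 →
      eLpNorm (fun x => b x - c x) 2 (volume.restrict Ω) ≤ ε / 2 →
      eLpNorm (fun x => a x - c x) 2 (volume.restrict Ω) ≤ ε := by
    intro a b c ha hb hc h1 h2
    have : (fun x => a x - c x) = (fun x => a x - b x) + fun x => b x - c x := by
      ext1 x
      simp
    rw [this]
    refine (eLpNorm_add_le (ha.sub hb).1 (hb.sub hc).1 (by norm_num)).trans ?_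
    exact (add_le_add h1 h2).trans (ENNReal.add_halves ε).le
  exact ⟨φ, k1, tri (k1.memLp _) h1.memLp hu k2 h2,
    tri (k1.memLp_curl _) h1.memLp_curl hw k3 h3⟩

/-! ### Mollification of Lipschitz deformations -/

section Mollify

open scoped Convolution

theorem norm_normed_convolution_le {F : Type*} [NormedAddCommGroup F] [NormedSpace ℝ F]
    (ρ : ContDiffBump (0 : E3)) {g : E3 → F} {M : ℝ} (hg : ∀ x, ‖g x‖ ≤ M) (x : E3) :
    ‖(ρ.normed volume ⋆[ContinuousLinearMap.lsmul ℝ ℝ, volume] g) x‖ ≤ M := by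
  have hi : Integrable (fun t => ρ.normed volume t * M) := ρ.integrable_normed.mul_const M
  have h1 : ‖(ρ.normed volume ⋆[ContinuousLinearMap.lsmul ℝ ℝ, volume] g) x‖
      ≤ ∫ t, ρ.normed volume t * M := by
    rw [convolution_def]
    refine norm_integral_le_of_norm_le hi (Eventually.of_forall fun t => ?_)
    rw [ContinuousLinearMap.lsmul_apply, norm_smul, Real.norm_eq_abs,
      abs_of_nonneg (ρ.nonneg_normed t)]
    exact mul_le_mul_of_nonneg_left (hg _) (ρ.nonneg_normed t)
  rwa [integral_mul_const, ρ.integral_normed, one_mul] at h1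

/-- The derivative may fall on the merely Lipschitz factor, since that factor is differentiable
almost everywhere with difference quotients dominated by the Lipschitz constant. Derivatives of
mollifications are therefore mollified derivatives, which converge almost everywhere. -/
theorem hasFDerivAt_normed_convolution (ρ : ContDiffBump (0 : E3)) {S : E3 → E3} {C : ℝ≥0}
    (hS : LipschitzWith C S) (x : E3) :
    HasFDerivAt (ρ.normed volume ⋆[ContinuousLinearMap.lsmul ℝ ℝ, volume] S)
      ((ρ.normed volume ⋆[ContinuousLinearMap.lsmul ℝ ℝ, volume] fderiv ℝ S) x) x := by
  have hρ : Continuous (ρ.normed volume) := ρ.continuous_normed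
  have hρc : HasCompactSupport (ρ.normed volume) := ρ.hasCompactSupport_normed
  have hcont : ∀ y, Continuous fun t => ρ.normed volume t • S (y - t) := fun y =>
    hρ.smul (hS.continuous.comp (continuous_const.sub continuous_id))
  have hmeas : Measurable fun t : E3 => x - t := measurable_const.sub measurable_id
  have key := hasFDerivAt_integral_of_dominated_loc_of_lip (μ := volume) (s := Set.univ)
    (F := fun y t => ρ.normed volume t • S (y - t))
    (F' := fun t => ρ.normed volume t • fderiv ℝ S (x - t)) (x₀ := x)
    (bound := fun t => ρ.normed volume t * C) univ_mem
    (Eventually.of_forall fun y => (hcont y).aestronglyMeasurable)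
    ((hcont x).integrable_of_hasCompactSupport hρc.smul_right)
    (hρ.aestronglyMeasurable.smul ((measurable_fderiv ℝ S).comp hmeas).aestronglyMeasurable)
    (Eventually.of_forall fun t => LipschitzWith.lipschitzOnWith
      (LipschitzWith.of_dist_le_mul fun y z => ?_))
    (ρ.integrable_normed.mul_const _) ?_
  · simpa only [convolution_def, ContinuousLinearMap.lsmul_apply] using! key.2
  · have h1 := hS.dist_le_mul (y - t) (z - t)
    rw [dist_sub_right] at h1
    rw [dist_eq_norm, ← smul_sub, norm_smul, ← dist_eq_norm, Real.coe_nnabs, abs_mul,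
      Real.norm_eq_abs, mul_assoc, NNReal.abs_eq]
    gcongr
  · have h1 : ∀ᵐ t, DifferentiableAt ℝ S (x - t) :=
      (quasiMeasurePreserving_sub_left volume x).ae hS.ae_differentiableAt
    filter_upwards [h1] with t ht
    have h2 : HasFDerivAt (fun y => S (y - t)) (fderiv ℝ S (x - t)) x :=
      by simpa using! ht.hasFDerivAt.comp x ((hasFDerivAt_id x).sub_const t)
    exact h2.fun_const_smul _

/-- Smooth approximation of a Lipschitz map which is the identity off a compact set. -/
theorem exists_smooth_approx {T : E3 → E3} {C : ℝ≥0} (hT : LipschitzWith C T) {K : Set E3}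
    (hTK : ∀ x ∉ K, T x = x) :
    ∃ Tn : ℕ → E3 → E3, (∀ n, ContDiff ℝ (⊤ : ℕ∞) (Tn n)) ∧
      (∀ x, Tendsto (fun n => Tn n x) atTop (𝓝 (T x))) ∧
      (∀ᵐ x, Tendsto (fun n => fderiv ℝ (Tn n) x) atTop (𝓝 (fderiv ℝ T x))) ∧
      (∃ M : ℝ, ∀ n x, ‖fderiv ℝ (Tn n) x‖ ≤ M) ∧
      ∀ δ > 0, ∀ᶠ n in atTop, ∀ x ∉ Metric.cthickening δ K, Tn n x = x := by
  -- Mollifying the displacement instead of $T$ makes the approximations equal to the identity off a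
  -- small neighbourhood of `K`.
  set S : E3 → E3 := fun x => T x - x with hSdef
  have hS : LipschitzWith (C + 1) S := hT.sub LipschitzWith.id
  have hdS : ∀ᵐ x, HasFDerivAt S (fderiv ℝ T x - 1) x := by
    filter_upwards [hT.ae_differentiableAt] with x hx
    exact hx.hasFDerivAt.sub (hasFDerivAt_id x)
  -- The ratio of outer to inner radius stays equal to $2$; a bounded ratio is what the almost
  -- everywhere convergence of mollified locally integrable functions requires.
  let ρ : ℕ → ContDiffBump (0 : E3) := fun n =>
    ⟨1 / (n + 1), 2 / (n + 1), by positivity, by gcongr; norm_num⟩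
  have hρ0 : Tendsto (fun n => (ρ n).rOut) atTop (𝓝 0) := by
    have := (tendsto_one_div_add_atTop_nhds_zero_nat (𝕜 := ℝ)).const_mul 2
    simpa [ρ, div_eq_mul_inv] using this
  set c : ℕ → E3 → E3 := fun n => (ρ n).normed volume ⋆[ContinuousLinearMap.lsmul ℝ ℝ, volume] S
  have hc : ∀ n x, HasFDerivAt (c n) (((ρ n).normed volume
      ⋆[ContinuousLinearMap.lsmul ℝ ℝ, volume] fderiv ℝ S) x) x := fun n x =>
    hasFDerivAt_normed_convolution (ρ n) hS x
  have hTn : ∀ n x, HasFDerivAt (fun y => y + c n y) (1 + ((ρ n).normed volume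
      ⋆[ContinuousLinearMap.lsmul ℝ ℝ, volume] fderiv ℝ S) x) x := fun n x =>
    (hasFDerivAt_id x).add (hc n x)
  have hbd : ∀ x, ‖fderiv ℝ S x‖ ≤ (C + 1 : ℝ≥0) := fun x => norm_fderiv_le_of_lipschitz ℝ hS
  refine ⟨fun n x => x + c n x, fun n => ?_, fun x => ?_, ?_, ⟨1 + (C + 1 : ℝ≥0), fun n x => ?_⟩,
    fun δ hδ => ?_⟩
  · exact contDiff_id.add ((ρ n).hasCompactSupport_normed.contDiff_convolution_left _
      (ρ n).contDiff_normed hS.continuous.locallyIntegrable)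
  · have := ContDiffBump.convolution_tendsto_right_of_continuous (μ := volume) hρ0
      hS.continuous x
    simpa [hSdef] using this.const_add x
  · have hloc : LocallyIntegrable (fderiv ℝ S) volume := by
      rw [locallyIntegrable_iff]
      intro k hk
      exact Measure.integrableOn_of_bounded hk.measure_lt_top.ne
        (measurable_fderiv ℝ S).aestronglyMeasurable (M := (C + 1 : ℝ≥0))
        (Eventually.of_forall hbd)
    have := ContDiffBump.ae_convolution_tendsto_right_of_locallyIntegrable (μ := volume) (K := 2)
      hρ0 (Eventually.of_forall fun n => by simp only [ρ]; apply le_of_eq; ring) hloc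
    filter_upwards [this, hdS] with x hx hx'
    simp only [fun n => (hTn n x).fderiv]
    have h1 := hx.const_add (1 : Mat3)
    rw [hx'.fderiv, add_sub_cancel] at h1
    exact h1
  · rw [(hTn n x).fderiv]
    refine (norm_add_le _ _).trans (add_le_add ?_ (norm_normed_convolution_le (ρ n) hbd x))
    exact ContinuousLinearMap.norm_id_le
  · filter_upwards [hρ0.eventually (gt_mem_nhds hδ)] with n hn x hx
    have h0 : ∀ y ∈ Metric.ball x (ρ n).rOut, S y = 0 := fun y hy => by
      rw [hSdef]
      simp only
      rw [hTK y, sub_self]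
      intro hyK
      refine hx (Metric.mem_cthickening_of_dist_le x y δ K hyK ?_)
      rw [dist_comm]
      exact (Metric.mem_ball.1 hy).le.trans hn.le
    have h1 : c n x = S x := ContDiffBump.normed_convolution_eq_right fun y hy => by
      rw [h0 y hy, h0 x (Metric.mem_ball_self (ρ n).rOut_pos)]
    rw [h1, h0 x (Metric.mem_ball_self (ρ n).rOut_pos), add_zero]

end Mollify

/-! ### Pull-back of `H₀(curl)` -/

namespace IsDeformation

variable {Ω : Set E3} {T : E3 ≃ₜ E3}

theorem norm_fderiv_le (h : IsDeformation Ω T) (x : E3) : ‖fderiv ℝ T x‖ ≤ 2 := by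
  exact_mod_cast norm_fderiv_le_of_lipschitz ℝ h.lipschitz

theorem aestronglyMeasurable_covPull (h : IsDeformation Ω T) {u : E3 → E3}
    (hu : AEStronglyMeasurable u (volume.restrict Ω)) :
    AEStronglyMeasurable (covPull T u) (volume.restrict Ω) :=
  AEStronglyMeasurable.apply_clm
    ((ContinuousLinearMap.adjoint (𝕜 := ℝ) (E := E3) (F := E3)).continuous.comp_aestronglyMeasurable
      (measurable_fderiv ℝ T).aestronglyMeasurable)
    (hu.comp_quasiMeasurePreserving h.quasiMeasurePreserving)

theorem aestronglyMeasurable_curlPull (h : IsDeformation Ω T) {u : E3 → E3}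
    (hu : AEStronglyMeasurable u (volume.restrict Ω)) :
    AEStronglyMeasurable (curlPull T u) (volume.restrict Ω) :=
  AEStronglyMeasurable.apply_clm
    (continuous_adjg.comp_aestronglyMeasurable (measurable_fderiv ℝ T).aestronglyMeasurable)
    (hu.comp_quasiMeasurePreserving h.quasiMeasurePreserving)

theorem eLpNorm_covPull_le (h : IsDeformation Ω T) {u : E3 → E3}
    (hu : AEStronglyMeasurable u (volume.restrict Ω)) :
    eLpNorm (covPull T u) 2 (volume.restrict Ω)
      ≤ ENNReal.ofReal 2 * (3 * eLpNorm u 2 (volume.restrict Ω)) := by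
  refine (eLpNorm_le_mul_eLpNorm_of_ae_le_mul (g := fun x => u (T x)) (c := 2)
    (Eventually.of_forall fun x => ?_) 2).trans (by gcongr; exact h.eLpNorm_comp_le hu)
  refine (ContinuousLinearMap.le_opNorm _ _).trans ?_
  rw [LinearIsometryEquiv.norm_map]
  gcongr
  exact h.norm_fderiv_le x

theorem exists_eLpNorm_curlPull_le (h : IsDeformation Ω T) : ∃ C : ENNReal, C ≠ ⊤ ∧
    ∀ u : E3 → E3, AEStronglyMeasurable u (volume.restrict Ω) →
      eLpNorm (curlPull T u) 2 (volume.restrict Ω) ≤ C * eLpNorm u 2 (volume.restrict Ω) := by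
  obtain ⟨C, -, hC⟩ := exists_bound_of_continuous continuous_adjg 2
  refine ⟨ENNReal.ofReal C * 3, ENNReal.mul_ne_top ENNReal.ofReal_ne_top (by norm_num),
    fun u hu => ?_⟩
  rw [mul_assoc]
  refine (eLpNorm_le_mul_eLpNorm_of_ae_le_mul (g := fun x => u (T x)) (c := C)
    (Eventually.of_forall fun x => ?_) 2).trans (by gcongr; exact h.eLpNorm_comp_le hu)
  refine (ContinuousLinearMap.le_opNorm _ _).trans ?_
  gcongr
  exact hC _ (h.norm_fderiv_le x)

theorem memLp_covPull (h : IsDeformation Ω T) {u : E3 → E3}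
    (hu : MemLp u 2 (volume.restrict Ω)) : MemLp (covPull T u) 2 (volume.restrict Ω) :=
  ⟨h.aestronglyMeasurable_covPull hu.1, (h.eLpNorm_covPull_le hu.1).trans_lt
    (ENNReal.mul_lt_top (by norm_num) (ENNReal.mul_lt_top (by norm_num) hu.2))⟩

theorem memLp_curlPull (h : IsDeformation Ω T) {u : E3 → E3}
    (hu : MemLp u 2 (volume.restrict Ω)) : MemLp (curlPull T u) 2 (volume.restrict Ω) := by
  obtain ⟨C, hC, hb⟩ := h.exists_eLpNorm_curlPull_le
  exact ⟨h.aestronglyMeasurable_curlPull hu.1,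
    (hb u hu.1).trans_lt (ENNReal.mul_lt_top hC.lt_top hu.2)⟩

/-- For a smooth approximation of $T$ the pull-back of a test field is again a test field, and the
classical curl rule applies. The approximations converge with their derivatives almost everywhere
and boundedly, so fields and curls converge in $L^2$ on the finite measure set $\Omega$. -/
theorem inHZero_pull_testField (h : IsDeformation Ω T) (hΩ : IsOpen Ω) (hfin : volume Ω ≠ ⊤)
    {φ : E3 → E3} (hφ : IsTestField Ω φ) : InHZero Ω (covPull T φ) (curlPull T (curl φ)) := by
  have m1 := h.memLp_covPull (hφ.memLp (volume.restrict Ω))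
  have m2 := h.memLp_curlPull (hφ.memLp_curl (volume.restrict Ω))
  have : IsFiniteMeasure (volume.restrict Ω) := ⟨by
    rw [Measure.restrict_apply_univ]; exact hfin.lt_top⟩
  obtain ⟨K, hK, hKΩ, hTK⟩ := h.eq_self
  obtain ⟨Tn, hs, hlim, hlimd, ⟨M, hM⟩, hid⟩ := exists_smooth_approx h.lipschitz hTK
  obtain ⟨δ, hδ, hδΩ⟩ := hK.exists_cthickening_subset_open hΩ hKΩ
  -- Off the thickening of `K` the approximate map is the identity, so the support stays inside the
  -- union of `tsupport φ` and a compact subset of $\Omega$.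
  have htest : ∀ᶠ n in atTop, IsTestField Ω (covPull (Tn n) φ) := by
    filter_upwards [hid δ hδ] with n hn
    have hsub : tsupport (covPull (Tn n) φ) ⊆ tsupport φ ∪ Metric.cthickening δ K := by
      refine closure_minimal (fun x hx => ?_)
        ((isClosed_tsupport φ).union Metric.isClosed_cthickening)
      by_contra hcon
      rw [Set.mem_union, not_or] at hcon
      refine hx ?_
      rw [covPull, hn x hcon.2, image_eq_zero_of_notMem_tsupport hcon.1, map_zero]
    exact ⟨contDiff_covPull (hs n) hφ.smooth,
      HasCompactSupport.of_support_subset_isCompact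
        (hφ.compactSupport.isCompact.union hK.cthickening) ((subset_tsupport _).trans hsub),
      hsub.trans (Set.union_subset hφ.support_subset hδΩ)⟩
  have conv : ∀ (L : Mat3 → Mat3) (ψ : E3 → E3), Continuous L → Continuous ψ →
      HasCompactSupport ψ →
      MemLp (fun x => L (fderiv ℝ T x) (ψ (T x))) 2 (volume.restrict Ω) →
      Tendsto (fun n => eLpNorm (fun x => L (fderiv ℝ (Tn n) x) (ψ (Tn n x))
        - L (fderiv ℝ T x) (ψ (T x))) 2 (volume.restrict Ω)) atTop (𝓝 0) := by
    intro L ψ hL hψ hψc hm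
    obtain ⟨CL, hCL0, hCL⟩ := exists_bound_of_continuous hL (max M 2)
    obtain ⟨Cψ, hCψ⟩ := hψ.bounded_above_of_compact_support hψc
    have hb : ∀ (A : Mat3) (y : E3), ‖A‖ ≤ max M 2 → ‖L A (ψ y)‖ ≤ CL * Cψ := fun A y hA =>
      (ContinuousLinearMap.le_opNorm _ _).trans
        (mul_le_mul (hCL A hA) (hCψ y) (norm_nonneg _) hCL0)
    refine tendsto_eLpNorm_two_zero (G := fun _ => CL * Cψ + CL * Cψ)
      (Eventually.of_forall fun n => ?_) (memLp_const _)
      (Eventually.of_forall fun n => Eventually.of_forall fun x => ?_) ?_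
    · refine AEStronglyMeasurable.sub ?_ hm.1
      exact AEStronglyMeasurable.apply_clm
        (hL.comp_aestronglyMeasurable (measurable_fderiv ℝ (Tn n)).aestronglyMeasurable)
        (hψ.comp (hs n).continuous).aestronglyMeasurable
    · exact (norm_sub_le _ _).trans (add_le_add (hb _ _ ((hM n x).trans (le_max_left _ _)))
        (hb _ _ ((h.norm_fderiv_le x).trans (le_max_right _ _))))
    · filter_upwards [ae_restrict_of_ae hlimd] with x hx
      have ha : Tendsto (fun n => L (fderiv ℝ (Tn n) x)) atTop (𝓝 (L (fderiv ℝ T x))) :=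
        (hL.tendsto _).comp hx
      have hb : Tendsto (fun n => ψ (Tn n x)) atTop (𝓝 (ψ (T x))) := (hψ.tendsto _).comp (hlim x)
      have h1 := (isBoundedBilinearMap_apply.continuous.tendsto _).comp (ha.prodMk_nhds hb)
      simpa using! h1.sub_const (L (fderiv ℝ T x) (ψ (T x)))
  have c1 := conv (fun A => ContinuousLinearMap.adjoint A) φ
    (ContinuousLinearMap.adjoint (𝕜 := ℝ) (E := E3) (F := E3)).continuous
    hφ.smooth.continuous hφ.compactSupport m1
  have c2 := conv adjg (curl φ) continuous_adjg hφ.continuous_curl hφ.hasCompactSupport_curl m2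
  refine ⟨m1, m2, fun ε hε => ?_⟩
  obtain ⟨n, h1, h2, h3⟩ := (htest.and ((c1.eventually_le_const (pos_iff_ne_zero.2 hε)).and
    (c2.eventually_le_const (pos_iff_ne_zero.2 hε)))).exists
  refine ⟨covPull (Tn n) φ, h1, h2, ?_⟩
  simp only [curl_covPull (hs n) hφ.smooth]
  exact h3

/-- Pull-back is bounded in $L^2$ on fields and on curls, so the case of test fields extends by
density. -/
theorem inHZero_pull (h : IsDeformation Ω T) (hΩ : IsOpen Ω) (hfin : volume Ω ≠ ⊤)
    {u w : E3 → E3} (huw : InHZero Ω u w) : InHZero Ω (covPull T u) (curlPull T w) := by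
  obtain ⟨C, hC, hb⟩ := h.exists_eLpNorm_curlPull_le
  refine InHZero.of_approx (h.memLp_covPull huw.memLp) (h.memLp_curlPull huw.memLp_curl)
    fun ε hε => ?_
  -- One tolerance serves both norms: $6=2\cdot3$ bounds the covariant pull-back and `C` the
  -- pull-back of curls.
  have hD : C + 6 ≠ ⊤ := ENNReal.add_ne_top.2 ⟨hC, by norm_num⟩
  have hD0 : C + 6 ≠ 0 := by simp
  obtain ⟨φ, h1, h2, h3⟩ := huw.approx (ε / (C + 6)) (ENNReal.div_ne_zero.2 ⟨hε, hD⟩)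
  have hle : ∀ {c : ENNReal}, c ≤ C + 6 → c * (ε / (C + 6)) ≤ ε := fun hc =>
    (mul_le_mul_left hc _).trans (ENNReal.mul_div_cancel hD0 hD).le
  refine ⟨_, _, h.inHZero_pull_testField hΩ hfin h1, ?_, ?_⟩
  · have e : (fun x => covPull T φ x - covPull T u x) = covPull T fun y => φ y - u y := by
      ext1 x
      simp [covPull]
    rw [e]
    refine (h.eLpNorm_covPull_le ((h1.memLp _).sub huw.memLp).1).trans ?_
    calc _ ≤ ENNReal.ofReal 2 * (3 * (ε / (C + 6))) := by gcongr; exact h2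
      _ = 6 * (ε / (C + 6)) := by
          rw [← mul_assoc]
          congr 1
          norm_num
      _ ≤ ε := hle le_add_self
  · have e : (fun x => curlPull T (curl φ) x - curlPull T w x)
        = curlPull T fun y => curl φ y - w y := by
      ext1 x
      simp [curlPull]
    rw [e]
    refine (hb _ ((h1.memLp_curl _).sub huw.memLp_curl).1).trans ?_
    exact (mul_le_mul_right h3 C).trans (hle le_self_add)

end IsDeformation

theorem abs_integral_mul_le {α : Type*} {m : MeasurableSpace α} {μ : Measure α} {a b : α → ℝ}
    (ha : MemLp a 2 μ) (hb : MemLp b 2 μ) :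
    |∫ x, a x * b x ∂μ| ≤ (eLpNorm a 2 μ).toReal * (eLpNorm b 2 μ).toReal := by
  have h1 : ∫ x, a x * b x ∂μ = inner ℝ (hb.toLp b) (ha.toLp a) := by
    rw [L2.inner_def]
    refine integral_congr_ae ?_
    filter_upwards [ha.coeFn_toLp, hb.coeFn_toLp] with x h1 h2
    rw [h1, h2]
    simp
  rw [h1, real_inner_comm, ← Real.norm_eq_abs]
  refine (norm_inner_le_norm _ _).trans_eq ?_
  rw [Lp.norm_toLp, Lp.norm_toLp]

/-! ### Multiplication operators on `L²` -/

section MulOp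

variable {α : Type*} {m : MeasurableSpace α} {μ : Measure α}

open Classical in
/-- The class of `u` in `L²`, with junk value `0`. -/
def toL2 (μ : Measure α) (u : α → E3) : Lp E3 2 μ :=
  if h : MemLp u 2 μ then h.toLp u else 0

theorem coeFn_toL2 {u : α → E3} (h : MemLp u 2 μ) : toL2 μ u =ᵐ[μ] u := by
  rw [toL2, dif_pos h]
  exact h.coeFn_toLp

theorem toL2_coeFn (u : Lp E3 2 μ) : toL2 μ u = u :=
  Lp.ext (coeFn_toL2 (Lp.memLp u))

theorem norm_toL2 {u : α → E3} (h : MemLp u 2 μ) : ‖toL2 μ u‖ = (eLpNorm u 2 μ).toReal := by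
  rw [Lp.norm_def, eLpNorm_congr_ae (coeFn_toL2 h)]

open Classical in
/-- Multiplication by the bounded matrix field `A`, with junk value `0`. -/
def mulOp (μ : Measure α) (A : α → Mat3) : Lp E3 2 μ →L[ℝ] Lp E3 2 μ :=
  if h : MemLp A ⊤ μ then
    (ContinuousLinearMap.id ℝ Mat3).holderL μ ⊤ 2 2 (h.toLp A)
  else 0

theorem coeFn_mulOp {A : α → Mat3} (h : MemLp A ⊤ μ) (u : Lp E3 2 μ) :
    mulOp μ A u =ᵐ[μ] fun x => A x (u x) := by
  rw [mulOp, dif_pos h]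
  have h1 := (ContinuousLinearMap.id ℝ Mat3).coeFn_holder (r := 2) (h.toLp A) u
  filter_upwards [h1, h.coeFn_toLp] with x h1 h2
  refine Eq.trans ?_ (h1.trans ?_)
  · rfl
  · rw [h2]; rfl

theorem mulOp_ext {A : α → Mat3} (h : MemLp A ⊤ μ) {u v : Lp E3 2 μ}
    (huv : (fun x => A x (u x)) =ᵐ[μ] v) : mulOp μ A u = v :=
  Lp.ext ((coeFn_mulOp h u).trans huv)

theorem mulOp_congr {A B : α → Mat3} (hAB : A =ᵐ[μ] B) : mulOp μ A = mulOp μ B := by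
  by_cases h : MemLp A ⊤ μ
  · have h' : MemLp B ⊤ μ := h.ae_eq hAB
    ext1 u
    refine mulOp_ext h ?_
    filter_upwards [hAB, coeFn_mulOp h' u] with x h1 h2
    rw [h1, h2]
  · have h' : ¬MemLp B ⊤ μ := fun h' => h (h'.ae_eq hAB.symm)
    rw [mulOp, mulOp, dif_neg h, dif_neg h']

theorem memLp_add_mat {A B : α → Mat3} (hA : MemLp A ⊤ μ) (hB : MemLp B ⊤ μ) :
    MemLp (fun x => A x + B x) ⊤ μ := by
  have h := hA.sub hB.neg
  rwa [sub_neg_eq_add] at h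

theorem mulOp_add {A B : α → Mat3} (hA : MemLp A ⊤ μ) (hB : MemLp B ⊤ μ) :
    mulOp μ (fun x => A x + B x) = mulOp μ A + mulOp μ B := by
  have hAB := memLp_add_mat hA hB
  ext1 u
  refine mulOp_ext hAB ?_
  filter_upwards [coeFn_mulOp hA u, coeFn_mulOp hB u, Lp.coeFn_add (mulOp μ A u) (mulOp μ B u)]
    with x h1 h2 h3
  simp only [add_apply]
  rw [h3, Pi.add_apply, h1, h2]

theorem mulOp_smul {A : α → Mat3} (hA : MemLp A ⊤ μ) (c : ℝ) :
    mulOp μ (fun x => c • A x) = c • mulOp μ A := by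
  have hcA : MemLp (fun x => c • A x) ⊤ μ := hA.const_smul c
  ext1 u
  refine mulOp_ext hcA ?_
  filter_upwards [coeFn_mulOp hA u, Lp.coeFn_smul c (mulOp μ A u)] with x h1 h3
  simp only [smul_apply]
  rw [h3, Pi.smul_apply, h1]

theorem norm_mulOp_apply_le {A : α → Mat3} {M : ℝ} (h : MemLp A ⊤ μ)
    (hM : ∀ᵐ x ∂μ, ‖A x‖ ≤ M) (u : Lp E3 2 μ) : ‖mulOp μ A u‖ ≤ M * ‖u‖ := by
  refine Lp.norm_le_mul_norm_of_ae_le_mul ?_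
  filter_upwards [hM, coeFn_mulOp h u] with x h1 h2
  rw [h2]
  exact (ContinuousLinearMap.le_opNorm _ _).trans (by gcongr)

theorem norm_mulOp_le {A : α → Mat3} {M : ℝ} (hM0 : 0 ≤ M) (h : MemLp A ⊤ μ)
    (hM : ∀ᵐ x ∂μ, ‖A x‖ ≤ M) : ‖mulOp μ A‖ ≤ M :=
  ContinuousLinearMap.opNorm_le_bound _ hM0 (norm_mulOp_apply_le h hM)

theorem inner_toL2 {u v : α → E3} (hu : MemLp u 2 μ) (hv : MemLp v 2 μ) :
    inner ℝ (toL2 μ u) (toL2 μ v) = ∫ x, inner ℝ (u x) (v x) ∂μ := by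
  rw [L2.inner_def]
  refine integral_congr_ae ?_
  filter_upwards [coeFn_toL2 hu, coeFn_toL2 hv] with x h1 h2
  rw [h1, h2]

theorem inner_mulOp {A : α → Mat3} (h : MemLp A ⊤ μ) (u v : Lp E3 2 μ) :
    inner ℝ (mulOp μ A u) v = ∫ x, inner ℝ (A x (u x)) (v x) ∂μ := by
  rw [L2.inner_def]
  refine integral_congr_ae ?_
  filter_upwards [coeFn_mulOp h u] with x h1
  rw [h1]

theorem memLp_mulOp {A : α → Mat3} (h : MemLp A ⊤ μ) {u : α → E3} (hu : MemLp u 2 μ) :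
    MemLp (fun x => A x (u x)) 2 μ :=
  (ContinuousLinearMap.id ℝ Mat3).memLp_of_bilin (r := 2) h hu

theorem mulOp_toL2 {A : α → Mat3} (h : MemLp A ⊤ μ) {u : α → E3} (hu : MemLp u 2 μ) :
    mulOp μ A (toL2 μ u) = toL2 μ (fun x => A x (u x)) := by
  refine mulOp_ext h ?_
  filter_upwards [coeFn_toL2 hu, coeFn_toL2 (memLp_mulOp h hu)] with x h1 h2
  rw [h1, h2]

theorem le_inner_mulOp {A : α → Mat3} (h : MemLp A ⊤ μ) {c : ℝ}
    (hc : ∀ᵐ x ∂μ, ∀ ξ : E3, c * ‖ξ‖ ^ 2 ≤ inner ℝ ξ (A x ξ)) (u : Lp E3 2 μ) :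
    c * ‖u‖ ^ 2 ≤ inner ℝ (mulOp μ A u) u := by
  rw [inner_mulOp h, ← real_inner_self_eq_norm_sq, L2.inner_def, ← integral_const_mul]
  refine integral_mono_ae ((L2.integrable_inner (𝕜 := ℝ) u u).const_mul c)
    (integrable_inner (memLp_mulOp h (Lp.memLp u)) (Lp.memLp u)) ?_
  filter_upwards [hc] with x hx
  have := hx (u x)
  rw [real_inner_self_eq_norm_sq, real_inner_comm]
  exact this

theorem inner_mulOp_comm {A : α → Mat3} (h : MemLp A ⊤ μ)
    (hs : ∀ᵐ x ∂μ, ∀ ξ η : E3, inner ℝ (A x ξ) η = inner ℝ ξ (A x η)) (u v : Lp E3 2 μ) :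
    inner ℝ (mulOp μ A u) v = inner ℝ u (mulOp μ A v) := by
  rw [inner_mulOp h, real_inner_comm, inner_mulOp h]
  refine integral_congr_ae ?_
  filter_upwards [hs] with x hx
  rw [hx, real_inner_comm]

theorem bddFam_mulOp {A : ℝ → α → Mat3}
    (h : ∀ᶠ t in 𝓝[>] (0 : ℝ), MemLp (A t) ⊤ μ)
    (hM : ∃ M : ℝ, ∀ᶠ t in 𝓝[>] (0 : ℝ), ∀ᵐ x ∂μ, ‖A t x‖ ≤ M) :
    BddFam fun t => mulOp μ (A t) := by
  obtain ⟨M, hM⟩ := hM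
  refine ⟨max M 0, ?_⟩
  filter_upwards [h, hM] with t h1 h2
  exact norm_mulOp_le (le_max_right _ _) h1 (h2.mono fun x hx => hx.trans (le_max_left _ _))

theorem weakOpLim_mulOp_of_forall {A : ℝ → α → Mat3} {A₀ : α → Mat3}
    (h : ∀ᶠ t in 𝓝[>] (0 : ℝ), MemLp (A t) ⊤ μ) (h0 : MemLp A₀ ⊤ μ)
    (hM : ∃ M : ℝ, ∀ᶠ t in 𝓝[>] (0 : ℝ), ∀ᵐ x ∂μ, ‖A t x‖ ≤ M)
    (hlim : ∀ a b : Lp E3 2 μ, Tendsto (fun t => ∫ x, inner ℝ (A t x (a x)) (b x) ∂μ) (𝓝[>] 0)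
      (𝓝 (∫ x, inner ℝ (A₀ x (a x)) (b x) ∂μ))) :
    WeakOpLim (fun t => mulOp μ (A t)) (mulOp μ A₀) := by
  refine ⟨bddFam_mulOp h hM, fun a b => ?_⟩
  rw [inner_mulOp h0]
  refine (hlim a b).congr' ?_
  filter_upwards [h] with t ht
  rw [inner_mulOp ht]

theorem weakOpLim_mulOp {A : ℝ → α → Mat3} {A₀ : α → Mat3}
    (h : ∀ᶠ t in 𝓝[>] (0 : ℝ), MemLp (A t) ⊤ μ) (h0 : MemLp A₀ ⊤ μ)
    (hM : ∃ M : ℝ, ∀ᶠ t in 𝓝[>] (0 : ℝ), ∀ᵐ x ∂μ, ‖A t x‖ ≤ M)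
    (hlim : ∀ᵐ x ∂μ, Tendsto (fun t => A t x) (𝓝[>] 0) (𝓝 (A₀ x))) :
    WeakOpLim (fun t => mulOp μ (A t)) (mulOp μ A₀) := by
  refine weakOpLim_mulOp_of_forall h h0 hM fun a b => ?_
  obtain ⟨M, hM⟩ := hM
  refine tendsto_integral_filter_of_dominated_convergence (fun x => M * (‖a x‖ * ‖b x‖)) ?_ ?_ ?_ ?_
  · filter_upwards [h] with t ht
    exact (integrable_inner (memLp_mulOp ht (Lp.memLp a)) (Lp.memLp b)).1
  · filter_upwards [hM] with t ht
    filter_upwards [ht] with x hx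
    refine (norm_inner_le_norm _ _).trans ?_
    rw [← mul_assoc]
    gcongr
    exact (ContinuousLinearMap.le_opNorm _ _).trans (by gcongr)
  · exact ((Lp.memLp a).norm.integrable_mul (Lp.memLp b).norm).const_mul M
  · filter_upwards [hlim] with x hx
    have h1 : Tendsto (fun t => A t x (a x)) (𝓝[>] 0) (𝓝 (A₀ x (a x))) :=
      ((ContinuousLinearMap.apply ℝ E3 (a x)).continuous.tendsto (A₀ x)).comp hx
    exact h1.inner tendsto_const_nhds

theorem WeakOpLim.comp_left {V : Type*} [NormedAddCommGroup V] [InnerProductSpace ℝ V]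
    [CompleteSpace V] {A : ℝ → V →L[ℝ] V} {A₀ : V →L[ℝ] V} (hA : WeakOpLim A A₀) (B : V →L[ℝ] V) :
    WeakOpLim (fun t => B.comp (A t)) (B.comp A₀) := by
  refine ⟨?_, fun a b => ?_⟩
  · obtain ⟨M, hM⟩ := hA.bdd
    refine ⟨‖B‖ * M, hM.mono fun t ht => (ContinuousLinearMap.opNorm_comp_le _ _).trans (by gcongr)⟩
  · simp only [ContinuousLinearMap.comp_apply, ← ContinuousLinearMap.adjoint_inner_right B]
    exact hA.lim a _

/-- Bounded pointwise convergence on a finite measure space in fact gives strong $L^2$ convergence,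
by domination with a constant. -/
theorem weakLim_toL2 [IsFiniteMeasure μ] {u : ℝ → α → E3} {u₀ : α → E3}
    (h : ∀ᶠ t in 𝓝[>] (0 : ℝ), MemLp (u t) 2 μ) (h0 : MemLp u₀ 2 μ)
    (hM : ∃ M : ℝ, ∀ᶠ t in 𝓝[>] (0 : ℝ), ∀ᵐ x ∂μ, ‖u t x‖ ≤ M)
    (hlim : ∀ᵐ x ∂μ, Tendsto (fun t => u t x) (𝓝[>] 0) (𝓝 (u₀ x))) :
    WeakLim (fun t => toL2 μ (u t)) (toL2 μ u₀) := by
  obtain ⟨M, hM⟩ := hM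
  -- The exceptional null set depends on $t$; passing to a sequence leaves a countable union, so the
  -- bound survives in the limit.
  have hM0 : ∀ᵐ x ∂μ, ‖u₀ x‖ ≤ M := by
    obtain ⟨k, hk⟩ := exists_seq_tendsto (𝓝[>] (0 : ℝ))
    obtain ⟨N, hN⟩ := eventually_atTop.1 (hk.eventually hM)
    have hN' : ∀ᵐ x ∂μ, ∀ n : ℕ, N ≤ n → ‖u (k n) x‖ ≤ M :=
      ae_all_iff.2 fun n => eventually_imp_distrib_left.2 (hN n)
    filter_upwards [hlim, hN'] with x h1 h2
    exact le_of_tendsto (h1.comp hk).norm (eventually_atTop.2 ⟨N, fun n hn => h2 n hn⟩)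
  have key : Tendsto (fun t => toL2 μ (u t)) (𝓝[>] 0) (𝓝 (toL2 μ u₀)) := by
    rw [tendsto_iff_norm_sub_tendsto_zero]
    have h1 : Tendsto (fun t => eLpNorm (fun x => u t x - u₀ x) 2 μ) (𝓝[>] 0) (𝓝 0) := by
      refine tendsto_eLpNorm_two_zero (G := fun _ => M + M)
        (h.mono fun t ht => (ht.sub h0).1) (memLp_const _) ?_ ?_
      · filter_upwards [hM] with t ht
        filter_upwards [ht, hM0] with x h1 h2
        exact (norm_sub_le _ _).trans (add_le_add h1 h2)
      · filter_upwards [hlim] with x hx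
        simpa using hx.sub_const (u₀ x)
    refine ((ENNReal.tendsto_toReal ENNReal.zero_ne_top).comp h1).congr' ?_
    filter_upwards [h] with t ht
    rw [Lp.norm_def, Function.comp_apply]
    congr 1
    refine eLpNorm_congr_ae ?_
    filter_upwards [Lp.coeFn_sub (toL2 μ (u t)) (toL2 μ u₀), coeFn_toL2 ht, coeFn_toL2 h0]
      with x h1 h2 h3
    rw [h1, Pi.sub_apply, h2, h3]
  refine ⟨?_, fun b => key.inner tendsto_const_nhds⟩
  refine ⟨‖toL2 μ u₀‖ + 1, ?_⟩
  filter_upwards [key.norm.eventually_lt_const (lt_add_one _)] with t ht using ht.le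

end MulOp

/-! ### The Nemytskii operator of a Lipschitz map -/

section Nemytskii

variable {α : Type*} {m : MeasurableSpace α} {μ : Measure α}

theorem memLp_top_of_forall_le {F : Type*} [NormedAddCommGroup F] {A : α → F} {M : ℝ}
    (hA : AEStronglyMeasurable A μ) (hM : ∀ x, ‖A x‖ ≤ M) : MemLp A ⊤ μ :=
  memLp_top_of_bound hA M (Eventually.of_forall hM)

/-- Frechet differentiability of a Nemytskii operator on `L²`, tested with a fixed element. -/
theorem hasFDerivAt_inner_nemytskii {s : Set α} {Λ : E3 → E3} {L : ℝ≥0}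
    (hL : LipschitzWith L Λ) (hd : ∀ e, HasFDerivAt Λ (fderiv ℝ Λ e) e)
    {Φ : Lp E3 2 μ → Lp E3 2 μ} (hΦ : ∀ u, Φ u =ᵐ[μ] s.indicator fun x => Λ (u x))
    {A : α → Mat3} (E p : Lp E3 2 μ) (hA : A = s.indicator fun x => fderiv ℝ Λ (E x))
    (hAm : MemLp A ⊤ μ) :
    HasFDerivAt (fun v => inner ℝ (Φ v) p) ((innerSL ℝ p).comp (mulOp μ A)) E := by
  have hΛb : ∀ e, ‖fderiv ℝ Λ e‖ ≤ L := fun e => norm_fderiv_le_of_lipschitz ℝ hL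
  -- A superposition operator need not be Fréchet differentiable from $L^2$ to $L^2$. Paired with a
  -- fixed `p` it is: the pointwise relative remainder `r h` is at most $2L$, and the error is at
  -- most $\|r_h p\|\,\|h\|$, so it suffices that $r_h p\to0$ in $L^2$.
  set r : Lp E3 2 μ → α → ℝ := fun h x =>
    ‖Λ (E x + h x) - Λ (E x) - fderiv ℝ Λ (E x) (h x)‖ / ‖h x‖ with hr
  have hr2 : ∀ h x, |r h x| ≤ 2 * L := fun h x => by
    rw [hr, abs_of_nonneg (by positivity)]
    refine div_le_of_le_mul₀ (norm_nonneg _) (by positivity) ?_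
    have h1 := hL.norm_sub_le (E x + h x) (E x)
    rw [add_sub_cancel_left] at h1
    have h2 := (fderiv ℝ Λ (E x)).le_of_opNorm_le (hΛb _) (h x)
    linarith [norm_sub_le (Λ (E x + h x) - Λ (E x)) (fderiv ℝ Λ (E x) (h x))]
  have hm : ∀ h : Lp E3 2 μ, AEStronglyMeasurable
      (fun x => Λ (E x + h x) - Λ (E x) - fderiv ℝ Λ (E x) (h x)) μ := fun h => by
    have m1 : AEStronglyMeasurable (fun x => fderiv ℝ Λ (E x)) μ :=
      ((measurable_fderiv ℝ Λ).comp_aemeasurable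
        (Lp.aestronglyMeasurable E).aemeasurable).aestronglyMeasurable
    exact ((hL.continuous.comp_aestronglyMeasurable
      ((Lp.aestronglyMeasurable E).add (Lp.aestronglyMeasurable h))).sub
      (hL.continuous.comp_aestronglyMeasurable (Lp.aestronglyMeasurable E))).sub
      (AEStronglyMeasurable.apply_clm m1 (Lp.aestronglyMeasurable h))
  have hrm : ∀ h : Lp E3 2 μ, AEStronglyMeasurable (r h) μ := fun h =>
    ((hm h).norm.aemeasurable.div (Lp.aestronglyMeasurable h).norm.aemeasurable).aestronglyMeasurable
  have hrp : ∀ h : Lp E3 2 μ, MemLp (fun x => r h x • p x) 2 μ := fun h =>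
    (Lp.memLp p).of_le_mul (c := 2 * L) ((hrm h).smul (Lp.aestronglyMeasurable p))
      (Eventually.of_forall fun x => by
        rw [norm_smul, Real.norm_eq_abs]; gcongr; exact hr2 h x)
  have hest : ∀ h : Lp E3 2 μ,
      ‖inner ℝ (Φ (E + h)) p - inner ℝ (Φ E) p - (innerSL ℝ p).comp (mulOp μ A) h‖
        ≤ (eLpNorm (fun x => r h x • p x) 2 μ).toReal * ‖h‖ := fun h => by
    have e1 : inner ℝ (Φ (E + h)) p - inner ℝ (Φ E) p - (innerSL ℝ p).comp (mulOp μ A) h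
        = inner ℝ (Φ (E + h) - Φ E - mulOp μ A h) p := by
      rw [ContinuousLinearMap.comp_apply, innerSL_apply_apply, inner_sub_left, inner_sub_left,
        real_inner_comm (mulOp μ A h) p]
    have e2 : |∫ x, inner ℝ ((Φ (E + h) - Φ E - mulOp μ A h : Lp E3 2 μ) x) (p x) ∂μ|
        ≤ ∫ x, ‖r h x • p x‖ * ‖h x‖ ∂μ := by
      rw [← Real.norm_eq_abs]
      refine norm_integral_le_of_norm_le ((hrp h).norm.integrable_mul (Lp.memLp h).norm) ?_
      filter_upwards [Lp.coeFn_sub (Φ (E + h) - Φ E) (mulOp μ A h), Lp.coeFn_sub (Φ (E + h)) (Φ E),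
        coeFn_mulOp hAm h, hΦ (E + h), hΦ E, Lp.coeFn_add E h] with x h1 h2 h3 h4 h5 h6
      rw [h1, Pi.sub_apply, h2, Pi.sub_apply, h3, h4, h5, hA]
      by_cases hx : x ∈ s
      · simp only [Set.indicator_of_mem hx]
        rw [h6, Pi.add_apply]
        refine (norm_inner_le_norm _ _).trans (le_of_eq ?_)
        rw [norm_smul, hr, Real.norm_eq_abs, abs_of_nonneg (by positivity)]
        rcases eq_or_ne (h x) 0 with h0 | h0
        · simp [h0]
        · have := norm_ne_zero_iff.2 h0
          field_simp
      · simp only [Set.indicator_of_notMem hx]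
        simp only [zero_apply, sub_self, inner_zero_left, norm_zero]
        positivity
    rw [e1, L2.inner_def, Real.norm_eq_abs]
    refine e2.trans ?_
    have e3 := abs_integral_mul_le (hrp h).norm (Lp.memLp h).norm
    rw [Lp.norm_def]
    refine (le_abs_self _).trans (e3.trans ?_)
    rw [eLpNorm_norm, eLpNorm_norm]
  -- Any sequence tending to zero in $L^2$ has, along every subsequence, a further one converging
  -- almost everywhere; there pointwise differentiability and domination by $2L|p|$ apply.
  have hlim : Tendsto (fun h : Lp E3 2 μ => eLpNorm (fun x => r h x • p x) 2 μ) (𝓝 0) (𝓝 0) := by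
    refine tendsto_of_seq_tendsto fun k hk => ?_
    refine tendsto_of_subseq_tendsto fun ns hns => ?_
    have h1 : TendstoInMeasure μ (fun n x => (k (ns n) : α → E3) x) atTop
        (fun x => (0 : Lp E3 2 μ) x) := tendstoInMeasure_of_tendsto_Lp (hk.comp hns)
    obtain ⟨ms, -, hms⟩ := h1.exists_seq_tendsto_ae
    refine ⟨ms, ?_⟩
    refine tendsto_eLpNorm_two_zero (G := fun x => 2 * L * ‖p x‖)
      (Eventually.of_forall fun n => (hrp _).1) ((Lp.memLp p).norm.const_mul _)
      (Eventually.of_forall fun n => Eventually.of_forall fun x => ?_) ?_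
    · rw [norm_smul, Real.norm_eq_abs]
      gcongr
      exact hr2 _ x
    · filter_upwards [hms, Lp.coeFn_zero E3 2 μ] with x hx h0
      rw [h0, Pi.zero_apply] at hx
      have h2 := (hasFDerivAt_iff_tendsto.1 (hd (E x))).comp
        (show Tendsto (fun n => E x + k (ns (ms n)) x) atTop (𝓝 (E x)) by
          simpa using hx.const_add (E x))
      have h3 : Tendsto (fun n => r (k (ns (ms n))) x) atTop (𝓝 0) := by
        refine h2.congr fun n => ?_
        simp only [Function.comp_apply, add_sub_cancel_left, hr]
        rw [div_eq_inv_mul]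
      simpa using h3.smul_const (p x)
  rw [hasFDerivAt_iff_isLittleO_nhds_zero]
  refine Asymptotics.isLittleO_iff.2 fun c hc => ?_
  have hc' : (0 : ENNReal) < ENNReal.ofReal c := ENNReal.ofReal_pos.2 hc
  filter_upwards [hlim.eventually_lt_const hc'] with h hh
  refine (hest h).trans ?_
  gcongr
  exact ENNReal.toReal_le_of_le_ofReal hc.le hh.le

end Nemytskii

/-! ### `H₀(curl)` as a closed subspace of `L² × L²` -/

namespace InHZero

variable {Ω : Set E3} {u w u' w' : E3 → E3}

theorem congr (h : InHZero Ω u w) (hu : u =ᵐ[volume.restrict Ω] u')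
    (hw : w =ᵐ[volume.restrict Ω] w') : InHZero Ω u' w' := by
  refine ⟨h.memLp.ae_eq hu, h.memLp_curl.ae_eq hw, fun ε hε => ?_⟩
  obtain ⟨φ, h1, h2, h3⟩ := h.approx ε hε
  refine ⟨φ, h1, (eLpNorm_congr_ae ?_).trans_le h2, (eLpNorm_congr_ae ?_).trans_le h3⟩
  · filter_upwards [hu] with x hx
    rw [hx]
  · filter_upwards [hw] with x hx
    rw [hx]

theorem zero : InHZero Ω 0 0 := by
  have h := (IsTestField.zero (Ω := Ω)).inHZero
  have h0 : curl 0 = 0 := by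
    ext x i
    fin_cases i <;> simp [curl, partialDeriv]
  rwa [h0] at h

theorem add (h : InHZero Ω u w) (h' : InHZero Ω u' w') : InHZero Ω (u + u') (w + w') := by
  refine ⟨h.memLp.add h'.memLp, h.memLp_curl.add h'.memLp_curl, fun ε hε => ?_⟩
  have hε2 : ε / 2 ≠ 0 := (ENNReal.half_pos hε).ne'
  obtain ⟨φ, h1, h2, h3⟩ := h.approx _ hε2
  obtain ⟨ψ, k1, k2, k3⟩ := h'.approx _ hε2
  refine ⟨φ + ψ, h1.add k1, ?_, ?_⟩
  · have e : (fun x => (φ + ψ) x - (u + u') x) = (fun x => φ x - u x) + fun x => ψ x - u' x := by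
      ext1 x
      simp only [Pi.add_apply]
      abel
    rw [e]
    refine (eLpNorm_add_le ((h1.memLp _).sub h.memLp).1 ((k1.memLp _).sub h'.memLp).1
      (by norm_num)).trans ?_
    exact (add_le_add h2 k2).trans_eq (ENNReal.add_halves ε)
  · have e : (fun x => curl (φ + ψ) x - (w + w') x)
        = (fun x => curl φ x - w x) + fun x => curl ψ x - w' x := by
      ext1 x
      rw [h1.curl_add k1]
      simp only [Pi.add_apply]
      abel
    rw [e]
    refine (eLpNorm_add_le ((h1.memLp_curl _).sub h.memLp_curl).1
      ((k1.memLp_curl _).sub h'.memLp_curl).1 (by norm_num)).trans ?_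
    exact (add_le_add h3 k3).trans_eq (ENNReal.add_halves ε)

theorem smul (h : InHZero Ω u w) (c : ℝ) : InHZero Ω (c • u) (c • w) := by
  refine ⟨h.memLp.const_smul c, h.memLp_curl.const_smul c, fun ε hε => ?_⟩
  have hc : (1 + ‖c‖ₑ) ≠ ⊤ := ENNReal.add_ne_top.2 ⟨ENNReal.one_ne_top, enorm_ne_top⟩
  have hc0 : (1 + ‖c‖ₑ) ≠ 0 := by simp
  obtain ⟨φ, h1, h2, h3⟩ := h.approx (ε / (1 + ‖c‖ₑ)) (ENNReal.div_ne_zero.2 ⟨hε, hc⟩)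
  have hle : ‖c‖ₑ * (ε / (1 + ‖c‖ₑ)) ≤ ε :=
    (mul_le_mul_left le_add_self _).trans (ENNReal.mul_div_cancel hc0 hc).le
  refine ⟨c • φ, h1.smul c, ?_, ?_⟩
  · have e : (fun x => (c • φ) x - (c • u) x) = c • fun x => φ x - u x := by
      ext1 x
      simp only [Pi.smul_apply, smul_sub]
    rw [e, eLpNorm_const_smul]
    exact (mul_le_mul_right h2 _).trans hle
  · have e : (fun x => curl (c • φ) x - (c • w) x) = c • fun x => curl φ x - w x := by
      ext1 x
      rw [h1.curl_smul]
      simp only [Pi.smul_apply, smul_sub]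
    rw [e, eLpNorm_const_smul]
    exact (mul_le_mul_right h3 _).trans hle

end InHZero

/-- The graph of the curl on `H₀(curl)`. -/
def hZero (Ω : Set E3) :
    Submodule ℝ (Lp E3 2 (volume.restrict Ω) × Lp E3 2 (volume.restrict Ω)) where
  carrier := {p | InHZero Ω p.1 p.2}
  zero_mem' := InHZero.zero.congr (Lp.coeFn_zero E3 2 _).symm (Lp.coeFn_zero E3 2 _).symm
  add_mem' := fun {a b} ha hb =>
    (InHZero.add ha hb).congr (Lp.coeFn_add a.1 b.1).symm (Lp.coeFn_add a.2 b.2).symm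
  smul_mem' := fun c a ha =>
    (InHZero.smul ha c).congr (Lp.coeFn_smul c a.1).symm (Lp.coeFn_smul c a.2).symm

theorem mem_hZero {Ω : Set E3} {u w : Lp E3 2 (volume.restrict Ω)} :
    (u, w) ∈ hZero Ω ↔ InHZero Ω u w := Iff.rfl

theorem InHZero.toL2_mem {Ω : Set E3} {u w : E3 → E3} (h : InHZero Ω u w) :
    (toL2 (volume.restrict Ω) u, toL2 (volume.restrict Ω) w) ∈ hZero Ω :=
  h.congr (coeFn_toL2 h.memLp).symm (coeFn_toL2 h.memLp_curl).symm

theorem isClosed_hZero (Ω : Set E3) : IsClosed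
    (hZero Ω : Set (Lp E3 2 (volume.restrict Ω) × Lp E3 2 (volume.restrict Ω))) := by
  refine isClosed_of_closure_subset fun p hp => ?_
  refine InHZero.of_approx (Lp.memLp p.1) (Lp.memLp p.2) fun ε hε => ?_
  obtain ⟨δ, hδ0, hδ⟩ := ENNReal.lt_iff_exists_nnreal_btwn.1 (pos_iff_ne_zero.2 hε)
  obtain ⟨q, hq, hpq⟩ := Metric.mem_closure_iff.1 hp δ (by exact_mod_cast hδ0)
  have key : ∀ a b : Lp E3 2 (volume.restrict Ω), dist a b ≤ dist p q →
      eLpNorm (fun x => b x - a x) 2 (volume.restrict Ω) ≤ ε := fun a b hab => by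
    have h1 : eLpNorm (fun x => b x - a x) 2 (volume.restrict Ω)
        = ENNReal.ofReal ‖b - a‖ := by
      rw [Lp.norm_def, ENNReal.ofReal_toReal (Lp.eLpNorm_ne_top _)]
      exact eLpNorm_congr_ae (Lp.coeFn_sub b a).symm
    rw [h1, ← dist_eq_norm, dist_comm]
    refine (ENNReal.ofReal_le_ofReal (hab.trans hpq.le)).trans ?_
    rw [ENNReal.ofReal_coe_nnreal]
    exact hδ.le
  exact ⟨q.1, q.2, hq, key _ _ (le_max_left _ _), key _ _ (le_max_right _ _)⟩

/-! ### Solvability of monotone curl-curl problems -/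

section Solve

variable {V : Type*} [NormedAddCommGroup V] [InnerProductSpace ℝ V]

/-- Zarantonello's theorem for $(E,w)\mapsto(\mathrm{Ep}\,E+\Psi E-f,\;Nw)$ on the closed subspace
`H`; coercivity of both components makes this map strongly monotone. -/
theorem exists_solution [CompleteSpace V] {H : Submodule ℝ (V × V)} (hH : IsClosed (H : Set (V × V)))
    {N Ep : V →L[ℝ] V} {c : ℝ} (hc : 0 < c) (hN : ∀ v, c * ‖v‖ ^ 2 ≤ inner ℝ (N v) v)
    (hEp : ∀ v, c * ‖v‖ ^ 2 ≤ inner ℝ (Ep v) v) {Ψ : V → V} {L : ℝ≥0} (hL : LipschitzWith L Ψ)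
    (hΨ : ∀ a b, 0 ≤ inner ℝ (Ψ a - Ψ b) (a - b)) (f : V) :
    ∃ E w, (E, w) ∈ H ∧ ∀ v z, (v, z) ∈ H → inner ℝ (N w) z + inner ℝ (Ep E + Ψ E - f) v = 0 := by
  -- The product carries the sup norm, so it is first replaced by its Hilbert space version.
  let e := WithLp.prodContinuousLinearEquiv 2 ℝ V V
  let H' : Submodule ℝ (WithLp 2 (V × V)) := H.comap (e : WithLp 2 (V × V) →ₗ[ℝ] V × V)
  have hH' : IsClosed (H' : Set (WithLp 2 (V × V))) := hH.preimage e.continuous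
  have : CompleteSpace H' := hH'.completeSpace_coe
  let F : WithLp 2 (V × V) → WithLp 2 (V × V) := fun x =>
    WithLp.toLp 2 (Ep x.fst + Ψ x.fst - f, N x.snd)
  have hF1 : ∀ x y, (F x - F y).fst = Ep (x - y).fst + (Ψ x.fst - Ψ y.fst) := fun x y => by
    change Ep x.fst + Ψ x.fst - f - (Ep y.fst + Ψ y.fst - f) = Ep (x.fst - y.fst) + _
    rw [map_sub]
    abel
  have hF2 : ∀ x y, (F x - F y).snd = N (x - y).snd := fun x y => by
    change N x.snd - N y.snd = N (x.snd - y.snd)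
    rw [map_sub]
  have hF : LipschitzWith (‖Ep‖₊ + L + ‖N‖₊) F := by
    refine LipschitzWith.of_dist_le_mul fun x y => ?_
    rw [dist_eq_norm, dist_eq_norm]
    refine abs_le_of_sq_le_sq' ?_ (by positivity) |>.2
    have h1 : ‖(F x - F y).fst‖ ≤ (‖Ep‖ + L) * ‖(x - y).fst‖ := by
      rw [hF1, add_mul]
      exact (norm_add_le _ _).trans (add_le_add (Ep.le_opNorm _) (hL.norm_sub_le _ _))
    have h2 : ‖(F x - F y).snd‖ ≤ ‖N‖ * ‖(x - y).snd‖ := by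
      rw [hF2]
      exact N.le_opNorm _
    rw [mul_pow, WithLp.prod_norm_sq_eq_of_L2, WithLp.prod_norm_sq_eq_of_L2]
    set A := ((‖Ep‖₊ + L + ‖N‖₊ : ℝ≥0) : ℝ)
    have hA : A = ‖Ep‖ + L + ‖N‖ := by simp [A]
    have hL0 : (0 : ℝ) ≤ L := L.2
    have h3 : ‖(F x - F y).fst‖ ≤ A * ‖(x - y).fst‖ :=
      h1.trans (mul_le_mul_of_nonneg_right (by rw [hA]; linarith [norm_nonneg N]) (norm_nonneg _))
    have h4 : ‖(F x - F y).snd‖ ≤ A * ‖(x - y).snd‖ :=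
      h2.trans (mul_le_mul_of_nonneg_right (by rw [hA]; linarith [norm_nonneg Ep]) (norm_nonneg _))
    have h5 := pow_le_pow_left₀ (norm_nonneg _) h3 2
    have h6 := pow_le_pow_left₀ (norm_nonneg _) h4 2
    rw [mul_pow] at h5 h6
    linarith
  obtain ⟨x, hx, hx'⟩ := exists_mem_forall_inner_eq_zero H' F hF hc fun x _ y _ => by
    rw [WithLp.prod_norm_sq_eq_of_L2, WithLp.prod_inner_apply]
    change _ ≤ inner ℝ (F x - F y).fst (x - y).fst + inner ℝ (F x - F y).snd (x - y).snd
    rw [hF1, hF2, inner_add_left]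
    have h3 := hN (x - y).snd
    have h4 := hEp (x - y).fst
    have h5 : 0 ≤ inner ℝ (Ψ x.fst - Ψ y.fst) (x - y).fst := hΨ x.fst y.fst
    linarith
  refine ⟨x.fst, x.snd, hx, fun v z hvz => ?_⟩
  have h1 := hx' (WithLp.toLp 2 (v, z)) hvz
  rw [WithLp.prod_inner_apply] at h1
  rw [add_comm]
  exact h1

/-- Test the equation with the solution itself. The reaction `g` is dropped because of its sign, so
its size does not enter; this makes the state and adjoint bounds independent of $\gamma$. -/
theorem norm_le_of_solution {N Ep : V →L[ℝ] V} {c : ℝ} (hc : 0 < c)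
    (hN : ∀ v, c * ‖v‖ ^ 2 ≤ inner ℝ (N v) v) (hEp : ∀ v, c * ‖v‖ ^ 2 ≤ inner ℝ (Ep v) v)
    {E w g f : V} (hg : 0 ≤ inner ℝ g E) (h : inner ℝ (N w) w + inner ℝ (Ep E + g - f) E = 0) :
    ‖E‖ ≤ ‖f‖ / c ∧ ‖w‖ ≤ ‖f‖ / c := by
  rw [inner_sub_left, inner_add_left] at h
  have h1 := hN w
  have h2 := hEp E
  have h3 := real_inner_le_norm f E
  have hE : ‖E‖ ≤ ‖f‖ / c := by
    rw [le_div_iff₀ hc]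
    rcases (norm_nonneg E).eq_or_lt with h0 | h0
    · rw [← h0, zero_mul]
      exact norm_nonneg f
    · nlinarith [mul_nonneg hc.le (sq_nonneg ‖w‖)]
  refine ⟨hE, ?_⟩
  have h4 : ‖w‖ ^ 2 ≤ (‖f‖ / c) ^ 2 := by
    have h5 : c * ‖w‖ ^ 2 ≤ ‖f‖ * (‖f‖ / c) := by
      have : ‖f‖ * ‖E‖ ≤ ‖f‖ * (‖f‖ / c) := by gcongr
      nlinarith [mul_nonneg hc.le (sq_nonneg ‖E‖)]
    rw [← mul_le_mul_iff_right₀ hc]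
    refine h5.trans_eq ?_
    field_simp
  exact abs_le_of_sq_le_sq' h4 (by positivity) |>.2

end Solve

/-! ### Weak-star convergence of matrix fields -/

section WeakStar

variable {μ : Measure E3}

/-- `D t` is bounded and converges weakly-star to `D₀` as `t ↓ 0`. -/
structure WeakStarLim (μ : Measure E3) (D : ℝ → E3 → Mat3) (D₀ : E3 → Mat3) (C : ℝ) : Prop where
  meas : ∀ t, AEStronglyMeasurable (D t) μ
  meas_lim : AEStronglyMeasurable D₀ μ
  bound : ∀ᶠ t in 𝓝[>] (0 : ℝ), ∀ x, ‖D t x‖ ≤ C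
  bound_lim : ∀ x, ‖D₀ x‖ ≤ C
  lim : ∀ g : E3 → ℝ, Integrable g μ → ∀ (v : E3) (i : Fin 3),
    Tendsto (fun t => ∫ x, g x * D t x v i ∂μ) (𝓝[>] 0) (𝓝 (∫ x, g x * D₀ x v i ∂μ))

theorem inner_clm_eq_sum (A : Mat3) (a b : E3) :
    inner ℝ (A a) b = ∑ j, ∑ i, (a j * b i) * A (EuclideanSpace.single j 1) i := by
  have ha : a = ∑ j, a j • EuclideanSpace.single j (1 : ℝ) := by
    ext i
    simp [Pi.single_apply]
  conv_lhs => rw [ha]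
  rw [map_sum, sum_inner]
  refine Finset.sum_congr rfl fun j _ => ?_
  rw [map_smul, inner_smul_left, PiLp.inner_apply, Finset.mul_sum]
  refine Finset.sum_congr rfl fun i _ => ?_
  simp
  ring

theorem memLp_top_comp_clm {F : Type*} [NormedAddCommGroup F] {L : Mat3 → F} (hL : Continuous L)
    {A : E3 → Mat3} (hA : AEStronglyMeasurable A μ) {C : ℝ} (hC : ∀ x, ‖A x‖ ≤ C) :
    MemLp (fun x => L (A x)) ⊤ μ := by
  obtain ⟨M, -, hM⟩ := exists_bound_of_continuous hL C
  exact memLp_top_of_forall_le (hL.comp_aestronglyMeasurable hA) fun x => hM _ (hC x)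

namespace WeakStarLim

variable {D : ℝ → E3 → Mat3} {D₀ : E3 → Mat3} {C : ℝ}

theorem memLp (h : WeakStarLim μ D D₀ C) {F : Type*} [NormedAddCommGroup F] {L : Mat3 → F}
    (hL : Continuous L) : ∀ᶠ t in 𝓝[>] (0 : ℝ), MemLp (fun x => L (D t x)) ⊤ μ := by
  filter_upwards [h.bound] with t ht
  exact memLp_top_comp_clm hL (h.meas t) ht

theorem memLp_lim (h : WeakStarLim μ D D₀ C) {F : Type*} [NormedAddCommGroup F] {L : Mat3 → F}
    (hL : Continuous L) : MemLp (fun x => L (D₀ x)) ⊤ μ :=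
  memLp_top_comp_clm hL h.meas_lim h.bound_lim

theorem bounded (h : WeakStarLim μ D D₀ C) {F : Type*} [NormedAddCommGroup F] {L : Mat3 → F}
    (hL : Continuous L) : ∃ M : ℝ, ∀ᶠ t in 𝓝[>] (0 : ℝ), ∀ᵐ x ∂μ, ‖L (D t x)‖ ≤ M := by
  obtain ⟨M, -, hM⟩ := exists_bound_of_continuous hL C
  exact ⟨M, h.bound.mono fun t ht => Eventually.of_forall fun x => hM _ (ht x)⟩

theorem bddFam (h : WeakStarLim μ D D₀ C) {L : Mat3 → Mat3} (hL : Continuous L) :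
    BddFam fun t => mulOp μ fun x => L (D t x) :=
  bddFam_mulOp (h.memLp hL) (h.bounded hL)

theorem continuous_entry (v : E3) (i : Fin 3) : Continuous fun A : Mat3 => A v i :=
  (EuclideanSpace.proj (𝕜 := ℝ) i).continuous.comp
    (ContinuousLinearMap.apply ℝ E3 v).continuous

theorem integrable_mul {L : Mat3 → ℝ} (hL : Continuous L) {A : E3 → Mat3}
    (hA : AEStronglyMeasurable A μ) (hC : ∀ x, ‖A x‖ ≤ C) {g : E3 → ℝ} (hg : Integrable g μ) :
    Integrable (fun x => g x * L (A x)) μ := by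
  obtain ⟨M, -, hM⟩ := exists_bound_of_continuous hL C
  exact hg.mul_bdd (c := M) (hL.comp_aestronglyMeasurable hA) (Eventually.of_forall fun x => hM _ (hC x))

/-- Expanded in matrix entries, the integral becomes a finite sum of entries tested with the
integrable products $a_jb_i$. -/
theorem tendsto_integral_inner (h : WeakStarLim μ D D₀ C) {a b : E3 → E3} (ha : MemLp a 2 μ)
    (hb : MemLp b 2 μ) : Tendsto (fun t => ∫ x, inner ℝ (D t x (a x)) (b x) ∂μ) (𝓝[>] 0)
      (𝓝 (∫ x, inner ℝ (D₀ x (a x)) (b x) ∂μ)) := by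
  have hco : ∀ {u : E3 → E3} (i : Fin 3), MemLp u 2 μ → MemLp (fun x => u x i) 2 μ :=
    fun i hu => (EuclideanSpace.proj (𝕜 := ℝ) i).comp_memLp' hu
  have hg : ∀ i j, Integrable (fun x => a x j * b x i) μ := fun i j =>
    (hco j ha).integrable_mul (hco i hb)
  have key : ∀ A : E3 → Mat3, AEStronglyMeasurable A μ → (∀ x, ‖A x‖ ≤ C) →
      ∫ x, inner ℝ (A x (a x)) (b x) ∂μ
        = ∑ j, ∑ i, ∫ x, (a x j * b x i) * A x (EuclideanSpace.single j 1) i ∂μ := by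
    intro A hA hC
    simp only [inner_clm_eq_sum]
    rw [integral_finsetSum _ fun j _ => integrable_finsetSum _ fun i _ =>
      integrable_mul (continuous_entry _ i) hA hC (hg i j)]
    refine Finset.sum_congr rfl fun j _ => ?_
    rw [integral_finsetSum _ fun i _ => integrable_mul (continuous_entry _ i) hA hC (hg i j)]
  rw [key _ h.meas_lim h.bound_lim]
  refine (tendsto_finsetSum _ fun j _ => tendsto_finsetSum _ fun i _ =>
    h.lim _ (hg i j) (EuclideanSpace.single j 1) i).congr' ?_
  filter_upwards [h.bound] with t ht
  rw [key _ (h.meas t) ht]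

theorem tendsto_integral_tr (h : WeakStarLim μ D D₀ C) {g : E3 → ℝ} (hg : Integrable g μ) :
    Tendsto (fun t => ∫ x, g x * tr3 (D t x) ∂μ) (𝓝[>] 0) (𝓝 (∫ x, g x * tr3 (D₀ x) ∂μ)) := by
  have key : ∀ A : E3 → Mat3, AEStronglyMeasurable A μ → (∀ x, ‖A x‖ ≤ C) →
      ∫ x, g x * tr3 (A x) ∂μ = ∑ i, ∫ x, g x * A x (EuclideanSpace.single i 1) i ∂μ := by
    intro A hA hC
    simp only [tr3_eq, Finset.mul_sum]
    rw [integral_finsetSum _ fun i _ => integrable_mul (continuous_entry _ i) hA hC hg]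
  rw [key _ h.meas_lim h.bound_lim]
  refine (tendsto_finsetSum _ fun i _ => h.lim _ hg (EuclideanSpace.single i 1) i).congr' ?_
  filter_upwards [h.bound] with t ht
  rw [key _ (h.meas t) ht]

theorem weakOpLim (h : WeakStarLim μ D D₀ C) :
    WeakOpLim (fun t => mulOp μ (D t)) (mulOp μ D₀) :=
  weakOpLim_mulOp_of_forall (h.memLp continuous_id) (h.memLp_lim continuous_id)
    (h.bounded continuous_id) fun a b => h.tendsto_integral_inner (Lp.memLp a) (Lp.memLp b)

theorem weakOpLim_adjoint (h : WeakStarLim μ D D₀ C) :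
    WeakOpLim (fun t => mulOp μ fun x => ContinuousLinearMap.adjoint (D t x))
      (mulOp μ fun x => ContinuousLinearMap.adjoint (D₀ x)) := by
  have hc : Continuous fun A : Mat3 => ContinuousLinearMap.adjoint A :=
    (ContinuousLinearMap.adjoint (𝕜 := ℝ) (E := E3) (F := E3)).continuous
  refine weakOpLim_mulOp_of_forall (h.memLp hc) (h.memLp_lim hc) (h.bounded hc) fun a b => ?_
  simp only [ContinuousLinearMap.adjoint_inner_left]
  simpa only [real_inner_comm] using! h.tendsto_integral_inner (Lp.memLp b) (Lp.memLp a)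

theorem weakOpLim_tr (h : WeakStarLim μ D D₀ C) :
    WeakOpLim (fun t => mulOp μ fun x => tr3 (D t x) • 1) (mulOp μ fun x => tr3 (D₀ x) • 1) := by
  have hc : Continuous fun A : Mat3 => tr3 A • (1 : Mat3) := continuous_tr3.smul continuous_const
  refine weakOpLim_mulOp_of_forall (h.memLp hc) (h.memLp_lim hc) (h.bounded hc) fun a b => ?_
  have := h.tendsto_integral_tr (integrable_inner (Lp.memLp a) (Lp.memLp b))
  simpa only [smul_apply, one_apply_eq_self, inner_smul_left, RCLike.conj_to_real, mul_comm]
    using! this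

end WeakStarLim

end WeakStar

theorem tendsto_mul_const_nhdsGT (c : ℝ) : Tendsto (fun t : ℝ => t * c) (𝓝[>] 0) (𝓝 0) := by
  have h : Tendsto (fun t : ℝ => t * c) (𝓝 0) (𝓝 (0 * c)) := tendsto_id.mul_const c
  rw [zero_mul] at h
  exact tendsto_nhdsWithin_of_tendsto_nhds h

/-! ### The flow of a Lipschitz field as a family of deformations -/

/-- The difference quotient `(T_t - id) / t`. -/
def flowQuot (T : ℝ → E3 ≃ₜ E3) (t : ℝ) (x : E3) : E3 := t⁻¹ • (T t x - x)

/-- For small `t > 0`, `T t` is the time-`t` flow map of the Lipschitz field `θ` supported in `B`. -/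
structure IsShapeFlow (B : Set E3) (θ : E3 → E3) (T : ℝ → E3 ≃ₜ E3) (C : ℝ≥0) : Prop where
  lipschitz : LipschitzWith C θ
  bounded : ∀ x, ‖θ x‖ ≤ C
  compactSupport : HasCompactSupport θ
  subset : tsupport θ ⊆ B
  deformation : ∀ᶠ t in 𝓝[>] (0 : ℝ), IsDeformation B (T t)
  flow : ∀ᶠ t in 𝓝[>] (0 : ℝ), ∀ ω, flowImage θ t ω = T t '' ω
  quot_lipschitz : ∀ᶠ t in 𝓝[>] (0 : ℝ), LipschitzWith C (flowQuot T t)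
  quot_close : ∀ᶠ t in 𝓝[>] (0 : ℝ), ∀ x, ‖flowQuot T t x - θ x‖ ≤ t * C
  eq_self : ∀ᶠ t in 𝓝[>] (0 : ℝ), ∀ x ∉ tsupport θ, T t x = x

open Classical in
theorem exists_isShapeFlow {B : Set E3} (θ : lipschitzFields B) : ∃ T C, IsShapeFlow B θ T C := by
  obtain ⟨⟨K, hK⟩, hc, hB⟩ := θ.2
  obtain ⟨M, hM⟩ := hc.exists_bound_of_continuous hK.continuous
  have hM' : ∀ x, ‖(θ : E3 → E3) x‖ ≤ (M.toNNReal : ℝ) := fun x =>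
    (hM x).trans (Real.le_coe_toNNReal M)
  obtain ⟨S, hS⟩ := exists_flow hK hM'
  -- The value for times at which the flow map is not known to be bi-Lipschitz is irrelevant, since
  -- only small $t$ matter.
  let T : ℝ → E3 ≃ₜ E3 := fun t =>
    if h : ∃ g : E3 ≃ₜ E3, ⇑g = S t ∧ LipschitzWith 2 g ∧ LipschitzWith 2 g.symm then h.choose
    else Homeomorph.refl E3
  set c : ℝ := K * Real.exp K with hcdef
  have hc0 : 0 ≤ c := by positivity
  -- One constant dominates the Lipschitz constant of $\theta$, its sup norm, the Lipschitz constant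
  -- $Ke^K$ of the flow quotients and their second-order error $KM$.
  set C : ℝ≥0 := K + M.toNNReal + (K * Real.exp K).toNNReal + K * M.toNNReal with hC
  have hCr : (C : ℝ) = K + M.toNNReal + c + K * M.toNNReal := by
    rw [hC]
    push_cast
    rw [Real.coe_toNNReal _ hc0]
  have hM0 : (0 : ℝ) ≤ M.toNNReal := NNReal.coe_nonneg _
  have hK0 : (0 : ℝ) ≤ K := NNReal.coe_nonneg _
  have hKM : (0 : ℝ) ≤ K * M.toNNReal := by positivity
  have hsmall : ∀ᶠ t in 𝓝[>] (0 : ℝ), 0 < t ∧ t ≤ 1 ∧ t * c ≤ 1 / 2 := by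
    have h1 : Tendsto (fun t : ℝ => t * c) (𝓝[>] 0) (𝓝 0) :=
      tendsto_mul_const_nhdsGT _
    filter_upwards [self_mem_nhdsWithin, Ioc_mem_nhdsGT one_pos,
      h1.eventually_le_const (by norm_num : (0 : ℝ) < 1 / 2)] with t h1 h2 h3
    exact ⟨h1, h2.2, h3⟩
  have hT : ∀ᶠ t in 𝓝[>] (0 : ℝ), ⇑(T t) = S t ∧ LipschitzWith 2 (T t) ∧
      LipschitzWith 2 (T t).symm := by
    filter_upwards [hsmall] with t ht
    have h := exists_homeomorph_of_lipschitz_sub_id ht.2.2 (hS t ⟨ht.1.le, ht.2.1⟩).2.1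
    simp only [T, dif_pos h]
    exact h.choose_spec
  have hself : ∀ᶠ t in 𝓝[>] (0 : ℝ), ∀ x ∉ tsupport (θ : E3 → E3), T t x = x := by
    filter_upwards [hT, hsmall] with t h1 ht x hx
    rw [h1.1]
    exact (hS t ⟨ht.1.le, ht.2.1⟩).2.2.2 x (image_eq_zero_of_notMem_tsupport hx)
  refine ⟨T, C, hK.weaken ?_, fun x => (hM' x).trans ?_, hc, hB, ?_, ?_, ?_, ?_, hself⟩
  · rw [← NNReal.coe_le_coe, hCr]
    linarith
  · rw [hCr]
    linarith
  · filter_upwards [hT, hself] with t h1 h2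
    exact ⟨h1.2.1, h1.2.2, _, hc.isCompact, hB, h2⟩
  · filter_upwards [hT, hsmall] with t h1 ht ω
    rw [h1.1]
    exact (hS t ⟨ht.1.le, ht.2.1⟩).1 ω
  · filter_upwards [hT, hsmall] with t h1 ht
    refine LipschitzWith.of_dist_le_mul fun x y => ?_
    have h2 := (hS t ⟨ht.1.le, ht.2.1⟩).2.1 x y
    rw [dist_eq_norm, dist_eq_norm, flowQuot, flowQuot, ← smul_sub, h1.1, norm_smul, norm_inv,
      Real.norm_eq_abs, abs_of_pos ht.1, inv_mul_le_iff₀ ht.1]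
    refine h2.trans ?_
    rw [mul_assoc]
    have h3 : c ≤ C := by
      rw [hCr]
      linarith
    exact mul_le_mul_of_nonneg_left (mul_le_mul_of_nonneg_right h3 (norm_nonneg _)) ht.1.le
  · filter_upwards [hT, hsmall] with t h1 ht x
    have h2 := (hS t ⟨ht.1.le, ht.2.1⟩).2.2.1 x
    have h3 : flowQuot T t x - (θ : E3 → E3) x = t⁻¹ • (S t x - x - t • (θ : E3 → E3) x) := by
      rw [flowQuot, h1.1, smul_sub t⁻¹ (S t x - x), smul_smul, inv_mul_cancel₀ ht.1.ne', one_smul]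
    rw [h3, norm_smul, norm_inv, Real.norm_eq_abs, abs_of_pos ht.1, inv_mul_le_iff₀ ht.1]
    refine h2.trans ?_
    rw [sq, mul_assoc]
    have h4 : (K : ℝ) * M.toNNReal ≤ C := by
      rw [hCr]
      linarith
    exact mul_le_mul_of_nonneg_left (mul_le_mul_of_nonneg_left h4 ht.1.le) ht.1.le

namespace IsShapeFlow

variable {B : Set E3} {θ : E3 → E3} {T : ℝ → E3 ≃ₜ E3} {C : ℝ≥0}

/-- The quotients $(T_t-\mathrm{id})/t$ are uniformly Lipschitz and converge uniformly to $\theta$;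
their derivatives therefore converge weakly-star, with no continuity of $D\theta$ needed. -/
theorem weakStarLim (h : IsShapeFlow B θ T C) {U : Set E3} (hU : MeasurableSet U) :
    WeakStarLim (volume.restrict U) (fun t => fderiv ℝ (flowQuot T t)) (fderiv ℝ θ) C where
  meas t := (measurable_fderiv ℝ _).aestronglyMeasurable
  meas_lim := (measurable_fderiv ℝ _).aestronglyMeasurable
  bound := h.quot_lipschitz.mono fun _ ht _ => norm_fderiv_le_of_lipschitz ℝ ht
  bound_lim _ := norm_fderiv_le_of_lipschitz ℝ h.lipschitz
  lim g hg v i := by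
    refine tendsto_integral_mul_fderiv h.quot_lipschitz h.lipschitz (fun ε hε => ?_) hU hg v i
    have h1 : Tendsto (fun t : ℝ => t * C) (𝓝[>] 0) (𝓝 0) :=
      tendsto_mul_const_nhdsGT _
    filter_upwards [h.quot_close, h1.eventually_le_const hε] with t h2 h3 x
    exact (h2 x).trans h3

theorem fderiv_eq (h : IsShapeFlow B θ T C) :
    ∀ᶠ t in 𝓝[>] (0 : ℝ), ∀ᵐ x, fderiv ℝ (T t) x = 1 + t • fderiv ℝ (flowQuot T t) x := by
  filter_upwards [h.quot_lipschitz, self_mem_nhdsWithin] with t h1 ht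
  have ht : (0 : ℝ) < t := ht
  filter_upwards [h1.ae_differentiableAt] with x hx
  have h2 : ⇑(T t) = fun y => y + t • flowQuot T t y := by
    ext1 y
    rw [flowQuot, smul_smul, mul_inv_cancel₀ ht.ne', one_smul, add_sub_cancel]
  have h3 : HasFDerivAt (fun y => y + t • flowQuot T t y)
      (1 + t • fderiv ℝ (flowQuot T t) x) x :=
    (hasFDerivAt_id x).add (hx.hasFDerivAt.fun_const_smul t)
  rw [h2]
  exact h3.fderiv

theorem tendsto_quot (h : IsShapeFlow B θ T C) (x : E3) :
    Tendsto (fun t => t⁻¹ • (T t x - x)) (𝓝[>] 0) (𝓝 (θ x)) := by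
  rw [tendsto_iff_norm_sub_tendsto_zero]
  have h1 : Tendsto (fun t : ℝ => t * C) (𝓝[>] 0) (𝓝 0) :=
      tendsto_mul_const_nhdsGT _
  exact squeeze_zero' (Eventually.of_forall fun _ => norm_nonneg _)
    (h.quot_close.mono fun t ht => ht x) h1

theorem norm_sub_le (h : IsShapeFlow B θ T C) :
    ∀ᶠ t in 𝓝[>] (0 : ℝ), ∀ x, ‖T t x - x‖ ≤ t * (2 * C) := by
  filter_upwards [h.quot_close, self_mem_nhdsWithin, Ioc_mem_nhdsGT one_pos] with t h1 ht ht1 x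
  have ht : (0 : ℝ) < t := ht
  have h2 : T t x - x = t • (flowQuot T t x - θ x + θ x) := by
    rw [sub_add_cancel, flowQuot, smul_smul, mul_inv_cancel₀ ht.ne', one_smul]
  rw [h2, norm_smul, Real.norm_eq_abs, abs_of_pos ht]
  gcongr
  have h3 : t * C ≤ 1 * C := by gcongr; exact ht1.2
  linarith [norm_add_le (flowQuot T t x - θ x) (θ x), h1 x, h.bounded x]

variable {F : Type*} [NormedAddCommGroup F] [NormedSpace ℝ F] {g : E3 → F}

/-- $B$ need not be convex, so the mean value inequality is used on balls of one radius $\delta$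
around points of the support of $\theta$; these lie in $B$ and contain $T_tx$ for small $t$. Off the
support the quotient vanishes. -/
theorem exists_quot_comp_le (h : IsShapeFlow B θ T C) (hB : IsOpen B) (hg : IsC1On B g) :
    ∃ M : ℝ, 0 ≤ M ∧ ∀ᶠ t in 𝓝[>] (0 : ℝ), ∀ x, ‖t⁻¹ • (g (T t x) - g x)‖ ≤ M := by
  obtain ⟨M, hM⟩ := hg.deriv_bounded
  obtain ⟨δ, hδ, hδB⟩ := h.compactSupport.isCompact.exists_cthickening_subset_open hB h.subset
  refine ⟨|M| * (2 * C), by positivity, ?_⟩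
  have h1 : Tendsto (fun t : ℝ => t * (2 * C)) (𝓝[>] 0) (𝓝 0) :=
      tendsto_mul_const_nhdsGT _
  filter_upwards [h.norm_sub_le, h.eq_self, h1.eventually_lt_const hδ, self_mem_nhdsWithin]
    with t h2 h3 h4 ht x
  have ht : (0 : ℝ) < t := ht
  by_cases hx : x ∈ tsupport θ
  · have hball : Metric.ball x δ ⊆ B := fun y hy =>
      hδB (Metric.mem_cthickening_of_dist_le y x δ _ hx (Metric.mem_ball.1 hy).le)
    have h5 := (convex_ball x δ).norm_image_sub_le_of_norm_fderiv_le (𝕜 := ℝ) (f := g) (C := |M|)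
      (fun y hy => (hg.contDiffOn.differentiableOn (by simp)).differentiableAt
        (hB.mem_nhds (hball hy)))
      (fun y hy => (hM y (hball hy)).trans (le_abs_self M)) (Metric.mem_ball_self hδ)
      (show T t x ∈ Metric.ball x δ by
        rw [mem_ball_iff_norm]
        exact (h2 x).trans_lt h4)
    rw [norm_smul, norm_inv, Real.norm_eq_abs, abs_of_pos ht, inv_mul_le_iff₀ ht]
    refine h5.trans ?_
    rw [mul_left_comm]
    gcongr
    exact h2 x
  · rw [h3 x hx, sub_self, smul_zero, norm_zero]
    positivity

theorem tendsto_quot_comp (h : IsShapeFlow B θ T C) (hB : IsOpen B) (hg : IsC1On B g) (x : E3) :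
    Tendsto (fun t => t⁻¹ • (g (T t x) - g x)) (𝓝[>] 0) (𝓝 (fderiv ℝ g x (θ x))) := by
  by_cases hx : x ∈ tsupport θ
  · have hd : HasFDerivAt g (fderiv ℝ g x) x :=
      ((hg.contDiffOn.differentiableOn (by simp)).differentiableAt
        (hB.mem_nhds (h.subset hx))).hasFDerivAt
    have h1 : Tendsto (fun t : ℝ => t * (2 * C)) (𝓝[>] 0) (𝓝 0) :=
      tendsto_mul_const_nhdsGT _
    have h2 : Tendsto (fun t => T t x - x) (𝓝[>] 0) (𝓝 0) :=
      squeeze_zero_norm' (h.norm_sub_le.mono fun t ht => ht x) h1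
    have h3 := (hd.hasFDerivWithinAt (s := Set.univ)).lim h2
      (Eventually.of_forall fun _ => Set.mem_univ _) (h.tendsto_quot x)
    simpa only [add_sub_cancel] using h3
  · rw [image_eq_zero_of_notMem_tsupport hx, map_zero]
    refine tendsto_const_nhds.congr' ?_
    filter_upwards [h.eq_self] with t ht
    rw [ht x hx, sub_self, smul_zero]

theorem aestronglyMeasurable_quot_comp (h : IsShapeFlow B θ T C) (hB : IsOpen B)
    (hg : IsC1On B g) (μ : Measure E3) : ∀ᶠ t in 𝓝[>] (0 : ℝ),
      AEStronglyMeasurable (fun x => t⁻¹ • (g (T t x) - g x)) μ := by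
  filter_upwards [h.eq_self, h.deformation] with t h1 h2
  have h3 : (fun x => t⁻¹ • (g (T t x) - g x))
      = B.indicator fun x => t⁻¹ • (g (T t x) - g x) := by
    ext1 x
    by_cases hx : x ∈ B
    · rw [Set.indicator_of_mem hx]
    · rw [Set.indicator_of_notMem hx, h1 x fun hx' => hx (h.subset hx'), sub_self, smul_zero]
  rw [h3, aestronglyMeasurable_indicator_iff hB.measurableSet]
  have c : ContinuousOn g B := hg.contDiffOn.continuousOn
  exact (((c.comp (T t).continuous.continuousOn h2.mapsTo).sub c).const_smul t⁻¹).aestronglyMeasurable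
    hB.measurableSet

theorem memLp_quot_comp (h : IsShapeFlow B θ T C) (hB : IsOpen B)
    (hg : IsC1On B g) (μ : Measure E3) : ∀ᶠ t in 𝓝[>] (0 : ℝ),
      MemLp (fun x => t⁻¹ • (g (T t x) - g x)) ⊤ μ := by
  obtain ⟨M, -, hM⟩ := h.exists_quot_comp_le hB hg
  filter_upwards [hM, h.aestronglyMeasurable_quot_comp hB hg μ] with t h1 h2
  exact memLp_top_of_forall_le h2 h1

end IsShapeFlow

theorem aestronglyMeasurable_fderiv_apply {F : Type*} [NormedAddCommGroup F] [NormedSpace ℝ F]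
    [FiniteDimensional ℝ F] (g : E3 → F) {θ : E3 → E3} (hθ : Continuous θ) (μ : Measure E3) :
    AEStronglyMeasurable (fun x => fderiv ℝ g x (θ x)) μ := by
  have : CompleteSpace F := FiniteDimensional.complete ℝ F
  have : ProperSpace F := FiniteDimensional.proper ℝ F
  borelize (E3 →L[ℝ] F)
  have h1 : AEStronglyMeasurable (fderiv ℝ g) μ := (measurable_fderiv ℝ g).aestronglyMeasurable
  exact (isBoundedBilinearMap_apply (𝕜 := ℝ) (E := E3) (F := F)).continuous.comp_aestronglyMeasurable
    (h1.prodMk hθ.aestronglyMeasurable)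

/-- The bound holds at all points because $\theta$ vanishes outside $B$, where nothing is known
about the derivative of $g$. -/
theorem IsC1On.exists_fderiv_apply_le {F : Type*} [NormedAddCommGroup F] [NormedSpace ℝ F]
    {B : Set E3} {g : E3 → F} (hg : IsC1On B g) : ∃ M : ℝ, 0 ≤ M ∧ ∀ θ : E3 → E3,
      tsupport θ ⊆ B → ∀ x, ‖fderiv ℝ g x (θ x)‖ ≤ M * ‖θ x‖ := by
  obtain ⟨M, hM⟩ := hg.deriv_bounded
  refine ⟨|M|, abs_nonneg M, fun θ hθ x => ?_⟩
  by_cases hx : x ∈ B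
  · exact (fderiv ℝ g x).le_of_opNorm_le ((hM x hx).trans (le_abs_self M)) _
  · rw [image_eq_zero_of_notMem_tsupport fun h => hx (hθ h), map_zero]
    simp

/-! ### The penalized problem in operator form -/

section Operators

variable {α : Type*} {m : MeasurableSpace α} {μ : Measure α}

theorem inner_eq_integral {U W : Lp E3 2 μ} {u w : α → E3} (hu : U =ᵐ[μ] u) (hw : W =ᵐ[μ] w) :
    inner ℝ U W = ∫ x, inner ℝ (u x) (w x) ∂μ := by
  rw [L2.inner_def]
  refine integral_congr_ae ?_
  filter_upwards [hu, hw] with x h1 h2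
  rw [h1, h2]

/-- The Nemytskii operator of `dualVar`, localized to `s`. -/
def reaction (μ : Measure α) (jc γ : ℝ) (s : Set α) (u : Lp E3 2 μ) : Lp E3 2 μ :=
  toL2 μ (s.indicator fun x => dualVar jc γ (u x))

variable {jc γ : ℝ} {s : Set α}

theorem memLp_indicator_dualVar (hj : 0 < jc) (hγ : 0 < γ) (hs : MeasurableSet s) {u : α → E3}
    (hu : MemLp u 2 μ) : MemLp (s.indicator fun x => dualVar jc γ (u x)) 2 μ :=
  ((lipschitzWith_dualVar hj hγ).comp_memLp (dualVar_zero jc γ) hu).indicator hs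

theorem coeFn_reaction (hj : 0 < jc) (hγ : 0 < γ) (hs : MeasurableSet s) (u : Lp E3 2 μ) :
    reaction μ jc γ s u =ᵐ[μ] s.indicator fun x => dualVar jc γ (u x) :=
  coeFn_toL2 (memLp_indicator_dualVar hj hγ hs (Lp.memLp u))

theorem reaction_toL2 (hj : 0 < jc) (hγ : 0 < γ) (hs : MeasurableSet s) {u : α → E3}
    (hu : MemLp u 2 μ) :
    reaction μ jc γ s (toL2 μ u) =ᵐ[μ] s.indicator fun x => dualVar jc γ (u x) := by
  filter_upwards [coeFn_reaction hj hγ hs (toL2 μ u), coeFn_toL2 hu] with x h1 h2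
  rw [h1]
  simp only [Set.indicator, h2]

theorem lipschitzWith_reaction (hj : 0 < jc) (hγ : 0 < γ) (hs : MeasurableSet s) :
    LipschitzWith (2 * (jc * γ)).toNNReal (reaction μ jc γ s) := by
  refine LipschitzWith.of_dist_le_mul fun u v => ?_
  rw [dist_eq_norm, dist_eq_norm]
  refine Lp.norm_le_mul_norm_of_ae_le_mul ?_
  filter_upwards [coeFn_reaction hj hγ hs u, coeFn_reaction hj hγ hs v,
    Lp.coeFn_sub (reaction μ jc γ s u) (reaction μ jc γ s v), Lp.coeFn_sub u v] with x h1 h2 h3 h4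
  rw [h3, h4, Pi.sub_apply, Pi.sub_apply, h1, h2]
  by_cases hx : x ∈ s
  · simp only [Set.indicator_of_mem hx]
    exact (lipschitzWith_dualVar hj hγ).norm_sub_le _ _
  · simp only [Set.indicator_of_notMem hx, sub_self, norm_zero]
    positivity

theorem reaction_monotone (hj : 0 < jc) (hγ : 0 < γ) (hs : MeasurableSet s) (u v : Lp E3 2 μ) :
    0 ≤ inner ℝ (reaction μ jc γ s u - reaction μ jc γ s v) (u - v) := by
  rw [L2.inner_def]
  refine integral_nonneg_of_ae ?_
  filter_upwards [coeFn_reaction hj hγ hs u, coeFn_reaction hj hγ hs v,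
    Lp.coeFn_sub (reaction μ jc γ s u) (reaction μ jc γ s v), Lp.coeFn_sub u v] with x h1 h2 h3 h4
  rw [h3, h4, Pi.sub_apply, Pi.sub_apply, h1, h2]
  by_cases hx : x ∈ s
  · simp only [Set.indicator_of_mem hx]
    exact dualVar_monotone hj hγ _ _
  · simp [Set.indicator_of_notMem hx]

theorem inner_reaction_nonneg (hj : 0 < jc) (hγ : 0 < γ) (hs : MeasurableSet s) (u : Lp E3 2 μ) :
    0 ≤ inner ℝ (reaction μ jc γ s u) u := by
  rw [L2.inner_def]
  refine integral_nonneg_of_ae ?_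
  filter_upwards [coeFn_reaction hj hγ hs u] with x h1
  rw [h1]
  by_cases hx : x ∈ s
  · simp only [Set.indicator_of_mem hx]
    have := dualVar_monotone hj hγ (u x) 0
    rwa [dualVar_zero, sub_zero, sub_zero] at this
  · simp [Set.indicator_of_notMem hx]

/-- The pointwise bound by $j_c$ gives an $L^2$ bound that does not involve $\gamma$. -/
theorem norm_reaction_le [IsFiniteMeasure μ] (hj : 0 < jc) (hγ : 0 < γ) (hs : MeasurableSet s)
    (u : Lp E3 2 μ) :
    ‖reaction μ jc γ s u‖ ≤ (measureUnivNNReal μ : ℝ) ^ (ENNReal.toReal 2)⁻¹ * jc := by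
  refine Lp.norm_le_of_ae_bound hj.le ?_
  filter_upwards [coeFn_reaction hj hγ hs u] with x h1
  rw [h1]
  by_cases hx : x ∈ s
  · rw [Set.indicator_of_mem hx]
    exact norm_dualVar_le hj hγ _
  · rw [Set.indicator_of_notMem hx, norm_zero]
    exact hj.le

/-- The field of Frechet derivatives of the reaction term. -/
def reactionDeriv (jc γ : ℝ) (s : Set α) (u : α → E3) : α → Mat3 :=
  s.indicator fun x => fderiv ℝ (dualVar jc γ) (u x)

theorem norm_reactionDeriv_le (hj : 0 < jc) (hγ : 0 < γ) (u : α → E3) (x : α) :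
    ‖reactionDeriv jc γ s u x‖ ≤ 2 * (jc * γ) := by
  rw [reactionDeriv]
  by_cases hx : x ∈ s
  · rw [Set.indicator_of_mem hx]
    exact norm_fderiv_dualVar_le hj hγ _
  · rw [Set.indicator_of_notMem hx, norm_zero]
    positivity

theorem norm_reactionDeriv_mul_le (hj : 0 < jc) (hγ : 0 < γ) (u : α → E3) (x : α) :
    ‖reactionDeriv jc γ s u x‖ * ‖u x‖ ≤ 2 * jc := by
  rw [reactionDeriv]
  by_cases hx : x ∈ s
  · rw [Set.indicator_of_mem hx]
    exact norm_fderiv_dualVar_mul_le hj hγ _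
  · rw [Set.indicator_of_notMem hx, norm_zero, zero_mul]
    positivity

theorem memLp_reactionDeriv (hj : 0 < jc) (hγ : 0 < γ) (hs : MeasurableSet s) {u : α → E3}
    (hu : AEStronglyMeasurable u μ) : MemLp (reactionDeriv jc γ s u) ⊤ μ := by
  refine memLp_top_of_forall_le ?_ (norm_reactionDeriv_le hj hγ u)
  have h1 : AEStronglyMeasurable (fun x => fderiv ℝ (dualVar jc γ) (u x)) μ :=
    ((measurable_fderiv ℝ (dualVar jc γ)).comp_aemeasurable hu.aemeasurable).aestronglyMeasurable
  exact h1.indicator hs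

theorem hasFDerivAt_inner_reaction (hj : 0 < jc) (hγ : 0 < γ) (hs : MeasurableSet s)
    (E p : Lp E3 2 μ) :
    HasFDerivAt (fun v => inner ℝ (reaction μ jc γ s v) p)
      ((innerSL ℝ p).comp (mulOp μ (reactionDeriv jc γ s E))) E :=
  hasFDerivAt_inner_nemytskii (lipschitzWith_dualVar hj hγ) (hasFDerivAt_dualVar hj hγ)
    (coeFn_reaction hj hγ hs) E p rfl
    (memLp_reactionDeriv hj hγ hs (Lp.aestronglyMeasurable E))

theorem inner_mulOp_reactionDeriv_nonneg (hj : 0 < jc) (hγ : 0 < γ) (hs : MeasurableSet s)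
    (E v : Lp E3 2 μ) : 0 ≤ inner ℝ (mulOp μ (reactionDeriv jc γ s E) v) v := by
  rw [inner_mulOp (memLp_reactionDeriv hj hγ hs (Lp.aestronglyMeasurable E))]
  refine integral_nonneg fun x => ?_
  simp only [reactionDeriv]
  by_cases hx : x ∈ s
  · rw [Set.indicator_of_mem hx]
    exact inner_fderiv_dualVar_nonneg hj hγ _ _
  · simp [Set.indicator_of_notMem hx]

end Operators

namespace ProblemData

variable (D : ProblemData)

/-- The Hilbert space of square-integrable fields on `Ω`. -/
abbrev L2Space : Type := Lp E3 2 (volume.restrict D.Ω)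

/-- The weight `κ` of the tracking term, extended by zero. -/
def weight : E3 → Mat3 := fun x => D.B.indicator D.κ x • 1

/-- The target field extended by zero. -/
def target : E3 → E3 := D.B.indicator D.Ed

/-- Multiplication by `ν`. -/
def opν : D.L2Space →L[ℝ] D.L2Space := mulOp _ D.ν

/-- Multiplication by `ε`. -/
def opε : D.L2Space →L[ℝ] D.L2Space := mulOp _ D.ε

/-- Multiplication by `κ` on `B`. -/
def opκ : D.L2Space →L[ℝ] D.L2Space := mulOp _ D.weight

/-- The source. -/
def source : D.L2Space := toL2 _ D.f

/-- The target. -/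
def targetL2 : D.L2Space := toL2 _ D.target

/-- The reaction term on the shape `ω`. -/
def reactionOn (γ : ℝ) (ω : Set E3) : D.L2Space → D.L2Space := reaction _ D.jc γ ω

/-- Operator form of the state equation. -/
structure IsStateL2 (γ : ℝ) (ω : Set E3) (E w : D.L2Space) : Prop where
  mem : (E, w) ∈ hZero D.Ω
  eq : ∀ v z, (v, z) ∈ hZero D.Ω →
    inner ℝ (D.opν w) z + inner ℝ (D.opε E + D.reactionOn γ ω E - D.source) v = 0

variable {D}

namespace Admissible

variable (hD : D.Admissible)
include hD

theorem isFiniteMeasure : IsFiniteMeasure (volume.restrict D.Ω) :=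
  ⟨by
    rw [Measure.restrict_apply_univ]
    exact hD.omega_domain.isBounded.measure_lt_top⟩

theorem volume_ne_top : volume D.Ω ≠ ⊤ := hD.omega_domain.isBounded.measure_lt_top.ne

theorem exists_coercive : ∃ c : ℝ, 0 < c ∧
    (∀ v, c * ‖v‖ ^ 2 ≤ inner ℝ (D.opν v) v) ∧ ∀ v, c * ‖v‖ ^ 2 ≤ inner ℝ (D.opε v) v := by
  obtain ⟨c, hc, h⟩ := hD.nu_material.posDef
  obtain ⟨c', hc', h'⟩ := hD.eps_material.posDef
  refine ⟨min c c', lt_min hc hc', fun v => ?_, fun v => ?_⟩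
  · refine le_trans ?_ (le_inner_mulOp hD.nu_material.memLp h v)
    gcongr
    exact min_le_left _ _
  · refine le_trans ?_ (le_inner_mulOp hD.eps_material.memLp h' v)
    gcongr
    exact min_le_right _ _

theorem memLp_weight : MemLp D.weight ⊤ (volume.restrict D.Ω) := by
  obtain ⟨M, hM⟩ := hD.kappa_c1.bounded
  have h1 : AEStronglyMeasurable (D.B.indicator D.κ) (volume.restrict D.Ω) := by
    rw [aestronglyMeasurable_indicator_iff hD.B_domain.isOpen.measurableSet]
    exact hD.kappa_c1.contDiffOn.continuousOn.aestronglyMeasurable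
      hD.B_domain.isOpen.measurableSet
  refine memLp_top_of_forall_le (M := |M| * ‖(1 : Mat3)‖) (h1.smul_const _) fun x => ?_
  rw [weight, norm_smul]
  gcongr
  by_cases hx : x ∈ D.B
  · rw [Set.indicator_of_mem hx]
    exact (hM x hx).trans (le_abs_self M)
  · rw [Set.indicator_of_notMem hx, norm_zero]
    exact abs_nonneg M

theorem memLp_target : MemLp D.target 2 (volume.restrict D.Ω) := by
  have := hD.isFiniteMeasure
  obtain ⟨M, hM⟩ := hD.Ed_c1.bounded
  have h1 : AEStronglyMeasurable D.target (volume.restrict D.Ω) := by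
    rw [target, aestronglyMeasurable_indicator_iff hD.B_domain.isOpen.measurableSet]
    exact hD.Ed_c1.contDiffOn.continuousOn.aestronglyMeasurable
      hD.B_domain.isOpen.measurableSet
  refine MemLp.of_bound h1 |M| (Eventually.of_forall fun x => ?_)
  rw [target]
  by_cases hx : x ∈ D.B
  · rw [Set.indicator_of_mem hx]
    exact (hM x hx).trans (le_abs_self M)
  · rw [Set.indicator_of_notMem hx, norm_zero]
    exact abs_nonneg M

theorem opκ_symm (a b : D.L2Space) : inner ℝ (D.opκ a) b = inner ℝ a (D.opκ b) :=
  inner_mulOp_comm hD.memLp_weight (Eventually.of_forall fun x ξ η => by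
    simp [weight, inner_smul_left, inner_smul_right]) a b

theorem exists_isStateL2 {γ : ℝ} (hγ : 0 < γ) {ω : Set E3} (hω : MeasurableSet ω) :
    ∃ E w, D.IsStateL2 γ ω E w := by
  obtain ⟨c, hc, h1, h2⟩ := hD.exists_coercive
  obtain ⟨E, w, h3, h4⟩ := exists_solution (isClosed_hZero D.Ω) hc h1 h2
    (lipschitzWith_reaction hD.jc_pos hγ hω) (reaction_monotone hD.jc_pos hγ hω) D.source
  exact ⟨E, w, h3, h4⟩

/-- The weak formulation, tested with functions, in terms of `L²` classes. -/
theorem inner_eq_weakForm {γ : ℝ} (hγ : 0 < γ) {ω : Set E3} (hω : MeasurableSet ω)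
    (hωΩ : ω ⊆ D.Ω) {E w v z : E3 → E3} (hE : InHZero D.Ω E w) (hv : InHZero D.Ω v z) :
    inner ℝ (D.opν (toL2 _ w)) (toL2 _ z)
      + inner ℝ (D.opε (toL2 _ E) + D.reactionOn γ ω (toL2 _ E) - D.source) (toL2 _ v)
    = (∫ x in D.Ω, inner ℝ (D.ν x (w x)) (z x)) + (∫ x in D.Ω, inner ℝ (D.ε x (E x)) (v x))
        + (∫ x in ω, inner ℝ (dualVar D.jc γ (E x)) (v x)) - ∫ x in D.Ω, inner ℝ (D.f x) (v x) := by
  have h1 : inner ℝ (D.opν (toL2 _ w)) (toL2 (volume.restrict D.Ω) z)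
      = ∫ x in D.Ω, inner ℝ (D.ν x (w x)) (z x) := by
    rw [opν, mulOp_toL2 hD.nu_material.memLp hE.memLp_curl,
      inner_toL2 (memLp_mulOp hD.nu_material.memLp hE.memLp_curl) hv.memLp_curl]
  have h2 : inner ℝ (D.opε (toL2 _ E)) (toL2 (volume.restrict D.Ω) v)
      = ∫ x in D.Ω, inner ℝ (D.ε x (E x)) (v x) := by
    rw [opε, mulOp_toL2 hD.eps_material.memLp hE.memLp,
      inner_toL2 (memLp_mulOp hD.eps_material.memLp hE.memLp) hv.memLp]
  have h3 : inner ℝ (D.reactionOn γ ω (toL2 _ E)) (toL2 (volume.restrict D.Ω) v)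
      = ∫ x in ω, inner ℝ (dualVar D.jc γ (E x)) (v x) := by
    rw [reactionOn, inner_eq_integral (reaction_toL2 hD.jc_pos hγ hω hE.memLp) (coeFn_toL2 hv.memLp)]
    have h5 : (fun x => inner ℝ (ω.indicator (fun x => dualVar D.jc γ (E x)) x) (v x))
        = ω.indicator fun x => inner ℝ (dualVar D.jc γ (E x)) (v x) := by
      ext1 x
      by_cases hx : x ∈ ω
      · simp only [Set.indicator_of_mem hx]
      · simp only [Set.indicator_of_notMem hx, inner_zero_left]
    rw [h5, integral_indicator hω, Measure.restrict_restrict hω,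
      Set.inter_eq_self_of_subset_left hωΩ]
  have h4 : inner ℝ D.source (toL2 (volume.restrict D.Ω) v) = ∫ x in D.Ω, inner ℝ (D.f x) (v x) :=
    inner_toL2 hD.f_memLp hv.memLp
  rw [inner_sub_left, inner_add_left, h1, h2, h3, h4]
  ring

theorem exists_isState {γ : ℝ} (hγ : 0 < γ) {ω : Set E3} (hω : MeasurableSet ω)
    (hωΩ : ω ⊆ D.Ω) : ∃ E, D.IsState γ ω E := by
  obtain ⟨E, w, h1, h2⟩ := hD.exists_isStateL2 hγ hω
  refine ⟨E, w, isHZeroCurl_iff.2 h1, fun v z hvz => ?_⟩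
  have h3 := isHZeroCurl_iff.1 hvz
  have h4 := hD.inner_eq_weakForm hγ hω hωΩ (mem_hZero.1 h1) h3
  rw [toL2_coeFn, toL2_coeFn, h2 _ _ h3.toL2_mem] at h4
  linarith

/-- Existence is all that is required to unfold the choice made in `state`: the later estimates hold
for every solution, so no separate uniqueness argument is needed. -/
theorem isState_state {γ : ℝ} (hγ : 0 < γ) {ω : Set E3} (hω : MeasurableSet ω)
    (hωΩ : ω ⊆ D.Ω) : ∃ w, InHZero D.Ω (D.state γ ω) w ∧
      ∀ v z, InHZero D.Ω v z →
        (∫ x in D.Ω, inner ℝ (D.ν x (w x)) (z x))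
        + (∫ x in D.Ω, inner ℝ (D.ε x (D.state γ ω x)) (v x))
        + (∫ x in ω, inner ℝ (dualVar D.jc γ (D.state γ ω x)) (v x))
        - ∫ x in D.Ω, inner ℝ (D.f x) (v x) = 0 := by
  obtain ⟨w, h1, h2⟩ : D.IsState γ ω (D.state γ ω) :=
    Classical.epsilon_spec (hD.exists_isState hγ hω hωΩ)
  refine ⟨w, isHZeroCurl_iff.1 h1, fun v z hvz => ?_⟩
  rw [h2 v z (isHZeroCurl_iff.2 hvz), sub_self]

theorem isStateL2_toL2 {γ : ℝ} (hγ : 0 < γ) {ω : Set E3} (hω : MeasurableSet ω)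
    (hωΩ : ω ⊆ D.Ω) {E w : E3 → E3} (hE : InHZero D.Ω E w) (h : ∀ v z, InHZero D.Ω v z →
        (∫ x in D.Ω, inner ℝ (D.ν x (w x)) (z x))
        + (∫ x in D.Ω, inner ℝ (D.ε x (E x)) (v x))
        + (∫ x in ω, inner ℝ (dualVar D.jc γ (E x)) (v x))
        - ∫ x in D.Ω, inner ℝ (D.f x) (v x) = 0) :
    D.IsStateL2 γ ω (toL2 _ E) (toL2 _ w) := by
  refine ⟨hE.toL2_mem, fun v z hvz => ?_⟩
  have h1 := hD.inner_eq_weakForm hγ hω hωΩ hE (mem_hZero.1 hvz)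
  rwa [toL2_coeFn, toL2_coeFn, h _ _ (mem_hZero.1 hvz)] at h1

/-- A priori bounds for the state, uniform in the penalty parameter and in the shape. -/
theorem exists_norm_state_le : ∃ M : ℝ, ∀ γ : ℝ, 0 < γ → ∀ ω : Set E3, MeasurableSet ω →
    ∀ E w, D.IsStateL2 γ ω E w → ‖E‖ ≤ M ∧ ‖w‖ ≤ M := by
  obtain ⟨c, hc, h1, h2⟩ := hD.exists_coercive
  exact ⟨‖D.source‖ / c, fun γ hγ ω hω E w h => norm_le_of_solution hc h1 h2
    (inner_reaction_nonneg hD.jc_pos hγ hω E) (h.eq E w h.mem)⟩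

/-- The adjoint state, with bounds uniform in the penalty parameter. -/
theorem exists_adjoint : ∃ M : ℝ, ∀ γ : ℝ, 0 < γ → ∀ ω : Set E3, MeasurableSet ω →
    ∀ E g : D.L2Space, ∃ p q : D.L2Space, (p, q) ∈ hZero D.Ω ∧
      (∀ v z, (v, z) ∈ hZero D.Ω → inner ℝ (D.opν z) q + inner ℝ (D.opε v) p
        + inner ℝ (mulOp _ (reactionDeriv D.jc γ ω E) v) p = -inner ℝ g v) ∧
      ‖p‖ ≤ M * ‖g‖ ∧ ‖q‖ ≤ M * ‖g‖ := by
  obtain ⟨c, hc, h1, h2⟩ := hD.exists_coercive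
  refine ⟨1 / c, fun γ hγ ω hω E g => ?_⟩
  set A : D.L2Space →L[ℝ] D.L2Space := mulOp _ (reactionDeriv D.jc γ ω E)
  have hA : ∀ v, 0 ≤ inner ℝ (A v) v := inner_mulOp_reactionDeriv_nonneg hD.jc_pos hγ hω E
  have hadj : ∀ (T : D.L2Space →L[ℝ] D.L2Space) (v : D.L2Space),
      inner ℝ (ContinuousLinearMap.adjoint T v) v = inner ℝ (T v) v := fun T v => by
    rw [ContinuousLinearMap.adjoint_inner_left, real_inner_comm]
  have k1 : ∀ v, c * ‖v‖ ^ 2 ≤ inner ℝ (ContinuousLinearMap.adjoint D.opν v) v := fun v => by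
    rw [hadj]; exact h1 v
  have k2 : ∀ v, c * ‖v‖ ^ 2 ≤ inner ℝ (ContinuousLinearMap.adjoint D.opε v) v := fun v => by
    rw [hadj]; exact h2 v
  -- The adjoint problem is the same kind of problem for the transposed operators. Transposition
  -- preserves the associated quadratic forms, hence the coercivity constant and the sign of the
  -- linearized reaction.
  obtain ⟨p, q, h3, h4⟩ := exists_solution (isClosed_hZero D.Ω) hc k1 k2
    (ContinuousLinearMap.adjoint A).lipschitz (fun a b => by
      rw [← map_sub, hadj]; exact hA _) (-g)
  refine ⟨p, q, h3, fun v z hvz => ?_, ?_⟩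
  · have h5 := h4 v z hvz
    rw [inner_sub_left, inner_add_left, ContinuousLinearMap.adjoint_inner_left,
      ContinuousLinearMap.adjoint_inner_left, ContinuousLinearMap.adjoint_inner_left,
      inner_neg_left, real_inner_comm, real_inner_comm _ p, real_inner_comm _ p] at h5
    linarith
  · have h5 := norm_le_of_solution hc k1 k2 (by rw [hadj]; exact hA p) (h4 p q h3)
    rw [norm_neg] at h5
    rwa [one_div, inv_mul_eq_div]

end Admissible

end ProblemData

/-! ### Change of variables -/

namespace IsDeformation

variable {U A : Set E3} {T : E3 ≃ₜ E3}

/-- The Jacobian turns the curl pull-back under $T^{-1}$ into multiplication by $DT$, and the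
covariant pull-back into multiplication by the cofactor matrix; no inverse derivative is left. -/
theorem ae_abs_det_smul (h : IsDeformation U T) (hdet : ∀ᵐ x, 0 < (fderiv ℝ T x).det) :
    ∀ᵐ x, ∀ z : E3, |(fderiv ℝ T x).det| • adjg (fderiv ℝ T.symm (T x)) z = fderiv ℝ T x z ∧
      |(fderiv ℝ T x).det| • ContinuousLinearMap.adjoint (fderiv ℝ T.symm (T x)) z
        = cofr (fderiv ℝ T x) z := by
  filter_upwards [h.ae_fderiv_comp_fderiv_symm, hdet] with x h1 h2 z
  obtain ⟨h3, h4⟩ := adjg_smul_of_mul_eq_one (F := fderiv ℝ T x) h1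
  rw [abs_of_pos h2]
  refine ⟨?_, ?_⟩
  · rw [← smul_apply, h4]
  · rw [cofr, ← h3, map_smul]
    rfl

theorem setIntegral_inner_curlPull (h : IsDeformation U T)
    (hdet : ∀ᵐ x, 0 < (fderiv ℝ T x).det) (hA : MeasurableSet A) (X z : E3 → E3) :
    ∫ y in T '' A, inner ℝ (X y) (curlPull T.symm z y)
      = ∫ x in A, inner ℝ (X (T x)) (fderiv ℝ T x (z x)) := by
  rw [h.setIntegral_image hA]
  refine integral_congr_ae ?_
  filter_upwards [ae_restrict_of_ae (h.ae_abs_det_smul hdet)] with x hx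
  rw [curlPull, T.symm_apply_apply, smul_eq_mul, ← real_inner_smul_right, (hx _).1]

theorem setIntegral_inner_covPull (h : IsDeformation U T)
    (hdet : ∀ᵐ x, 0 < (fderiv ℝ T x).det) (hA : MeasurableSet A) (X v : E3 → E3) :
    ∫ y in T '' A, inner ℝ (X y) (covPull T.symm v y)
      = ∫ x in A, inner ℝ (X (T x)) (cofr (fderiv ℝ T x) (v x)) := by
  rw [h.setIntegral_image hA]
  refine integral_congr_ae ?_
  filter_upwards [ae_restrict_of_ae (h.ae_abs_det_smul hdet)] with x hx
  rw [covPull, T.symm_apply_apply, smul_eq_mul, ← real_inner_smul_right, (hx _).2]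

end IsDeformation

/-- The second order remainder of the determinant: `det (1 + t A) = 1 + t (tr A + t m)`. -/
def detRem (t : ℝ) (A : Mat3) : ℝ := tr3 (adjg A) + t * A.det

theorem det_one_add_smul' (t : ℝ) (A : Mat3) :
    (1 + t • A).det = 1 + t * (tr3 A + t * detRem t A) := det_one_add_smul t A

theorem continuous_detRem (t : ℝ) : Continuous (detRem t) :=
  (continuous_tr3.comp continuous_adjg).add (continuous_const.mul continuous_det3)

theorem exists_abs_detRem_le (C : ℝ) : ∃ M : ℝ, 0 ≤ M ∧ ∀ t ∈ Set.Ioc (0 : ℝ) 1, ∀ A : Mat3,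
    ‖A‖ ≤ C → |detRem t A| ≤ M ∧ |tr3 A| ≤ M ∧ |tr3 A + t * detRem t A| ≤ M := by
  obtain ⟨M1, h1, hM1⟩ := exists_bound_of_continuous (continuous_tr3.comp continuous_adjg) C
  obtain ⟨M2, h2, hM2⟩ := exists_bound_of_continuous continuous_det3 C
  obtain ⟨M3, h3, hM3⟩ := exists_bound_of_continuous continuous_tr3 C
  refine ⟨M1 + M2 + M3, by positivity, fun t ht A hA => ?_⟩
  have e1 : |tr3 (adjg A)| ≤ M1 := hM1 A hA
  have e2 : |A.det| ≤ M2 := hM2 A hA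
  have e3 : |tr3 A| ≤ M3 := hM3 A hA
  have e4 : |t * A.det| ≤ M2 := by
    rw [abs_mul, abs_of_pos ht.1]
    exact (mul_le_of_le_one_left (abs_nonneg _) ht.2).trans e2
  have e5 : |detRem t A| ≤ M1 + M2 := (abs_add_le _ _).trans (add_le_add e1 e4)
  have e6 : |t * detRem t A| ≤ M1 + M2 := by
    rw [abs_mul, abs_of_pos ht.1]
    exact (mul_le_of_le_one_left (abs_nonneg _) ht.2).trans e5
  exact ⟨by linarith, by linarith, by linarith [abs_add_le (tr3 A) (t * detRem t A)]⟩

namespace IsShapeFlow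

variable {B : Set E3} {θ : E3 → E3} {T : ℝ → E3 ≃ₜ E3} {C : ℝ≥0}

theorem det_eq (h : IsShapeFlow B θ T C) : ∀ᶠ t in 𝓝[>] (0 : ℝ), ∀ᵐ x,
    (fderiv ℝ (T t) x).det = 1 + t * (tr3 (fderiv ℝ (flowQuot T t) x)
      + t * detRem t (fderiv ℝ (flowQuot T t) x)) := by
  filter_upwards [h.fderiv_eq] with t ht
  filter_upwards [ht] with x hx
  rw [hx, det_one_add_smul']

theorem det_pos (h : IsShapeFlow B θ T C) :
    ∀ᶠ t in 𝓝[>] (0 : ℝ), ∀ᵐ x, 0 < (fderiv ℝ (T t) x).det := by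
  obtain ⟨M, -, hM⟩ := exists_abs_detRem_le C
  filter_upwards [h.det_eq, h.quot_lipschitz, Ioc_mem_nhdsGT one_pos,
    (tendsto_mul_const_nhdsGT M).eventually_lt_const one_pos] with t h1 h2 h3 h4
  filter_upwards [h1] with x hx
  rw [hx]
  have h5 := (hM t h3 _ (norm_fderiv_le_of_lipschitz ℝ h2 (x₀ := x))).2.2
  have h6 := mul_le_mul_of_nonneg_left (neg_le_of_abs_le h5) h3.1.le
  linarith

end IsShapeFlow

/-! ### The transported problem -/

section FieldOps

variable (μ : Measure E3)

/-- Multiplication by the Jacobian of `ρ`. -/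
def opGrad (ρ : E3 → E3) : Lp E3 2 μ →L[ℝ] Lp E3 2 μ := mulOp μ (fderiv ℝ ρ)

/-- Multiplication by the transposed Jacobian of `ρ`. -/
def opGradT (ρ : E3 → E3) : Lp E3 2 μ →L[ℝ] Lp E3 2 μ :=
  mulOp μ fun x => ContinuousLinearMap.adjoint (fderiv ℝ ρ x)

/-- Multiplication by the divergence of `ρ`. -/
def opDiv (ρ : E3 → E3) : Lp E3 2 μ →L[ℝ] Lp E3 2 μ := mulOp μ fun x => tr3 (fderiv ℝ ρ x) • 1

/-- Multiplication by the derivative of `g` along `θ`. -/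
def opDir (g : E3 → Mat3) (θ : E3 → E3) : Lp E3 2 μ →L[ℝ] Lp E3 2 μ :=
  mulOp μ fun x => fderiv ℝ g x (θ x)

/-- The difference quotient of `g` along `T`. -/
def quotComp {F : Type*} [NormedAddCommGroup F] [NormedSpace ℝ F] (T : ℝ → E3 ≃ₜ E3)
    (g : E3 → F) (t : ℝ) (x : E3) : F := t⁻¹ • (g (T t x) - g x)

variable {μ} {ρ : E3 → E3} {C : ℝ≥0}

theorem memLp_comp_fderiv (hρ : LipschitzWith C ρ) {F : Type*}
    [NormedAddCommGroup F] {L : Mat3 → F} (hL : Continuous L) :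
    MemLp (fun x => L (fderiv ℝ ρ x)) ⊤ μ :=
  memLp_top_comp_clm hL (measurable_fderiv ℝ ρ).aestronglyMeasurable
    fun _ => norm_fderiv_le_of_lipschitz ℝ hρ

theorem continuous_adjoint3 : Continuous fun A : Mat3 => ContinuousLinearMap.adjoint A :=
  (ContinuousLinearMap.adjoint (𝕜 := ℝ) (E := E3) (F := E3)).continuous

theorem continuous_tr3_smul : Continuous fun A : Mat3 => tr3 A • (1 : Mat3) :=
  continuous_tr3.smul continuous_const

theorem coeFn_opGrad (hρ : LipschitzWith C ρ) (u : Lp E3 2 μ) :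
    opGrad μ ρ u =ᵐ[μ] fun x => fderiv ℝ ρ x (u x) :=
  coeFn_mulOp (memLp_comp_fderiv hρ continuous_id) u

theorem coeFn_opGradT (hρ : LipschitzWith C ρ) (u : Lp E3 2 μ) :
    opGradT μ ρ u =ᵐ[μ] fun x => ContinuousLinearMap.adjoint (fderiv ℝ ρ x) (u x) :=
  coeFn_mulOp (memLp_comp_fderiv hρ continuous_adjoint3) u

theorem coeFn_opDiv (hρ : LipschitzWith C ρ) (u : Lp E3 2 μ) :
    opDiv μ ρ u =ᵐ[μ] fun x => tr3 (fderiv ℝ ρ x) • u x := by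
  filter_upwards [coeFn_mulOp (memLp_comp_fderiv (μ := μ) hρ continuous_tr3_smul) u] with x hx
  rw [opDiv, hx]
  rfl

/-- The operator form of `v ↦ F v`, for `F = 1 + t Dρ`. -/
theorem coeFn_add_smul_opGrad (hρ : LipschitzWith C ρ) (t : ℝ) (u : Lp E3 2 μ) :
    ((u + t • opGrad μ ρ u : Lp E3 2 μ) : E3 → E3) =ᵐ[μ]
      fun x => (1 + t • fderiv ℝ ρ x : Mat3) (u x) := by
  filter_upwards [coeFn_opGrad hρ u, Lp.coeFn_add u (t • opGrad μ ρ u),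
    Lp.coeFn_smul t (opGrad μ ρ u)] with x h1 h2 h3
  rw [h2, Pi.add_apply, h3, Pi.smul_apply, h1]
  rfl

theorem coeFn_add_smul_opGradT (hρ : LipschitzWith C ρ) (t : ℝ) (u : Lp E3 2 μ) :
    ((u + t • opGradT μ ρ u : Lp E3 2 μ) : E3 → E3) =ᵐ[μ]
      fun x => ContinuousLinearMap.adjoint (1 + t • fderiv ℝ ρ x : Mat3) (u x) := by
  filter_upwards [coeFn_opGradT hρ u, Lp.coeFn_add u (t • opGradT μ ρ u),
    Lp.coeFn_smul t (opGradT μ ρ u)] with x h1 h2 h3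
  rw [h2, Pi.add_apply, h3, Pi.smul_apply, h1, ← ContinuousLinearMap.star_eq_adjoint,
    ← ContinuousLinearMap.star_eq_adjoint, star_add, star_smul, star_one, star_trivial t]
  rfl

theorem coeFn_adjg (hρ : LipschitzWith C ρ) (t : ℝ) (u : Lp E3 2 μ) :
    ((u + t • (opDiv μ ρ - opGrad μ ρ + t • mulOp μ fun x => adjg (fderiv ℝ ρ x)) u :
      Lp E3 2 μ) : E3 → E3) =ᵐ[μ] fun x => adjg (1 + t • fderiv ℝ ρ x) (u x) := by
  have h0 := coeFn_mulOp (memLp_comp_fderiv (μ := μ) hρ continuous_adjg) u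
  simp only [add_apply, sub_apply, smul_apply]
  set a := opDiv μ ρ u
  set b := opGrad μ ρ u
  set c := mulOp μ (fun x => adjg (fderiv ℝ ρ x)) u
  filter_upwards [coeFn_opGrad hρ u, coeFn_opDiv hρ u, h0, Lp.coeFn_add u (t • (a - b + t • c)),
    Lp.coeFn_smul t (a - b + t • c), Lp.coeFn_add (a - b) (t • c), Lp.coeFn_sub a b,
    Lp.coeFn_smul t c] with x h1 h2 h3 h4 h5 h6 h7 h8
  rw [h4, Pi.add_apply, h5, Pi.smul_apply, h6, Pi.add_apply, h7, Pi.sub_apply, h8, Pi.smul_apply,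
    h1, h2, h3, adjg_one_add_smul]
  rfl

theorem coeFn_cofr (hρ : LipschitzWith C ρ) (t : ℝ) (u : Lp E3 2 μ) :
    ((u + t • (opDiv μ ρ - opGradT μ ρ + t • mulOp μ fun x => cofr (fderiv ℝ ρ x)) u :
      Lp E3 2 μ) : E3 → E3) =ᵐ[μ] fun x => cofr (1 + t • fderiv ℝ ρ x) (u x) := by
  have h0 := coeFn_mulOp (memLp_comp_fderiv (μ := μ) hρ continuous_cofr) u
  simp only [add_apply, sub_apply, smul_apply]
  set a := opDiv μ ρ u
  set b := opGradT μ ρ u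
  set c := mulOp μ (fun x => cofr (fderiv ℝ ρ x)) u
  filter_upwards [coeFn_opGradT hρ u, coeFn_opDiv hρ u, h0, Lp.coeFn_add u (t • (a - b + t • c)),
    Lp.coeFn_smul t (a - b + t • c), Lp.coeFn_add (a - b) (t • c), Lp.coeFn_sub a b,
    Lp.coeFn_smul t c] with x h1 h2 h3 h4 h5 h6 h7 h8
  rw [h4, Pi.add_apply, h5, Pi.smul_apply, h6, Pi.add_apply, h7, Pi.sub_apply, h8, Pi.smul_apply,
    h1, h2, h3, cofr_one_add_smul]
  rfl

theorem coeFn_mulOp_add_quot {g : E3 → Mat3} {T : ℝ → E3 ≃ₜ E3} {t : ℝ} (ht : 0 < t)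
    (hg : MemLp g ⊤ μ) (hq : MemLp (quotComp T g t) ⊤ μ) (u : Lp E3 2 μ) :
    (((mulOp μ g + t • mulOp μ (quotComp T g t)) u : Lp E3 2 μ) : E3 → E3) =ᵐ[μ]
      fun x => g (T t x) (u x) := by
  simp only [add_apply, smul_apply]
  filter_upwards [coeFn_mulOp hg u, coeFn_mulOp hq u,
    Lp.coeFn_add (mulOp μ g u) (t • mulOp μ (quotComp T g t) u),
    Lp.coeFn_smul t (mulOp μ (quotComp T g t) u)] with x h1 h2 h3 h4
  rw [h3, Pi.add_apply, h4, Pi.smul_apply, h1, h2, quotComp, smul_apply, smul_smul,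
    mul_inv_cancel₀ ht.ne', one_smul, sub_apply, add_sub_cancel]

theorem coeFn_toL2_add_quot {g : E3 → E3} {T : ℝ → E3 ≃ₜ E3} {t : ℝ} (ht : 0 < t)
    (hg : MemLp g 2 μ) (hq : MemLp (quotComp T g t) 2 μ) :
    ((toL2 μ g + t • toL2 μ (quotComp T g t) : Lp E3 2 μ) : E3 → E3) =ᵐ[μ]
      fun x => g (T t x) := by
  filter_upwards [coeFn_toL2 hg, coeFn_toL2 hq,
    Lp.coeFn_add (toL2 μ g) (t • toL2 μ (quotComp T g t)),
    Lp.coeFn_smul t (toL2 μ (quotComp T g t))] with x h1 h2 h3 h4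
  rw [h3, Pi.add_apply, h4, Pi.smul_apply, h1, h2, quotComp, smul_smul,
    mul_inv_cancel₀ ht.ne', one_smul, add_sub_cancel]

end FieldOps

namespace ProblemData

variable {D : ProblemData}

/-- Lebesgue measure on `Ω`. -/
abbrev vol (D : ProblemData) : Measure E3 := volume.restrict D.Ω

/-- A representative `(E, w)` of the state and its curl solves the weak formulation. -/
structure IsWeakState (D : ProblemData) (γ : ℝ) (ω : Set E3) (E w : E3 → E3) : Prop where
  mem : InHZero D.Ω E w
  eq : ∀ v z, InHZero D.Ω v z →
    (∫ x in D.Ω, inner ℝ (D.ν x (w x)) (z x)) + (∫ x in D.Ω, inner ℝ (D.ε x (E x)) (v x))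
      + (∫ x in ω, inner ℝ (dualVar D.jc γ (E x)) (v x))
      - ∫ x in D.Ω, inner ℝ (D.f x) (v x) = 0

namespace Admissible

variable (hD : D.Admissible) {γ : ℝ} {ω : Set E3} {θ : E3 → E3} {T : ℝ → E3 ≃ₜ E3} {C : ℝ≥0}
include hD

/-- By the exact expansions of $DT_t^\top$ and $\operatorname{adj}(DT_t)$ this pair is the covariant
pull-back of the state on the transported shape, together with its curl. -/
theorem pert_mem {S : E3 ≃ₜ E3} (hS : IsDeformation D.Ω S) {ρ : E3 → E3} (hρ : LipschitzWith C ρ)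
    {t : ℝ} (hF : ∀ᵐ x, fderiv ℝ S x = 1 + t • fderiv ℝ ρ x) {E w : E3 → E3}
    (hE : InHZero D.Ω E w) {e u : D.L2Space} (he : e = toL2 D.vol fun x => E (S x))
    (hu : u = toL2 D.vol fun x => w (S x)) :
    (e + t • opGradT D.vol ρ e, u + t • (opDiv D.vol ρ - opGrad D.vol ρ
      + t • mulOp D.vol fun x => adjg (fderiv ℝ ρ x)) u) ∈ hZero D.Ω := by
  have he' : e =ᵐ[volume.restrict D.Ω] fun x => E (S x) := by
    rw [he]; exact coeFn_toL2 (hS.memLp_comp hE.memLp)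
  have hu' : u =ᵐ[volume.restrict D.Ω] fun x => w (S x) := by
    rw [hu]; exact coeFn_toL2 (hS.memLp_comp hE.memLp_curl)
  rw [mem_hZero]
  refine (hS.inHZero_pull hD.omega_domain.isOpen hD.volume_ne_top hE).congr ?_ ?_
  · filter_upwards [coeFn_add_smul_opGradT hρ t e, he', ae_restrict_of_ae hF] with x h1 h2 h3
    rw [h1, h2, covPull, h3]
  · filter_upwards [coeFn_adjg hρ t u, hu', ae_restrict_of_ae hF] with x h1 h2 h3
    rw [h1, h2, curlPull, h3]

/-- The equation on $T_t(\omega)$ is tested with the pull-back of $(v,z)$ under $T_t^{-1}$ and the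
variables are changed. Integrals over $\Omega$ stay over $\Omega$, the integral over $T_t(\omega)$
becomes one over $\omega$, and $\Lambda_\gamma(E)\circ T_t=\Lambda_\gamma(E\circ T_t)$ keeps the
nonlinearity intact. -/
theorem pert_state (hγ : 0 < γ) (hω : MeasurableSet ω) (hωΩ : ω ⊆ D.Ω)
    {t : ℝ} (ht : 0 < t) (hS : IsDeformation D.Ω (T t)) {ρ : E3 → E3} (hρ : LipschitzWith C ρ)
    (hF : ∀ᵐ x, fderiv ℝ (T t) x = 1 + t • fderiv ℝ ρ x)
    (hdet : ∀ᵐ x, 0 < (fderiv ℝ (T t) x).det)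
    (hν : MemLp (quotComp T D.ν t) ⊤ (volume.restrict D.Ω))
    (hε : MemLp (quotComp T D.ε t) ⊤ (volume.restrict D.Ω))
    (hf : MemLp (quotComp T D.f t) 2 (volume.restrict D.Ω))
    {E w : E3 → E3} (hE : D.IsWeakState γ (T t '' ω) E w) {e u : D.L2Space}
    (he : e = toL2 D.vol fun x => E (T t x)) (hu : u = toL2 D.vol fun x => w (T t x))
    {v z : D.L2Space} (hvz : (v, z) ∈ hZero D.Ω) :
    inner ℝ ((D.opν + t • mulOp D.vol (quotComp T D.ν t)) u) (z + t • opGrad D.vol ρ z)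
      + inner ℝ ((D.opε + t • mulOp D.vol (quotComp T D.ε t)) e + D.reactionOn γ ω e
          - (D.source + t • toL2 D.vol (quotComp T D.f t)))
        (v + t • (opDiv D.vol ρ - opGradT D.vol ρ + t • mulOp D.vol fun x => cofr (fderiv ℝ ρ x)) v) = 0 := by
  have me := hS.memLp_comp hE.mem.memLp
  have mu := hS.memLp_comp hE.mem.memLp_curl
  have he' : e =ᵐ[volume.restrict D.Ω] fun x => E (T t x) := by
    rw [he]; exact coeFn_toL2 me
  have hu' : u =ᵐ[volume.restrict D.Ω] fun x => w (T t x) := by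
    rw [hu]; exact coeFn_toL2 mu
  have hcof : ((v + t • (opDiv D.vol ρ - opGradT D.vol ρ + t • mulOp D.vol fun x => cofr (fderiv ℝ ρ x)) v :
      D.L2Space) : E3 → E3) =ᵐ[volume.restrict D.Ω] fun x => cofr (fderiv ℝ (T t) x) (v x) := by
    filter_upwards [coeFn_cofr hρ t v, ae_restrict_of_ae hF] with x h1 h2
    rw [h1, h2]
  have hgr : ((z + t • opGrad D.vol ρ z : D.L2Space) : E3 → E3) =ᵐ[volume.restrict D.Ω]
      fun x => fderiv ℝ (T t) x (z x) := by
    filter_upwards [coeFn_add_smul_opGrad hρ t z, ae_restrict_of_ae hF] with x h1 h2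
    rw [h1, h2]
  have hpull := hS.symm.inHZero_pull hD.omega_domain.isOpen hD.volume_ne_top (mem_hZero.1 hvz)
  have key := hE.eq _ _ hpull
  have e1 : inner ℝ ((D.opν + t • mulOp D.vol (quotComp T D.ν t)) u) (z + t • opGrad D.vol ρ z)
      = ∫ x in D.Ω, inner ℝ (D.ν x (w x)) (curlPull (T t).symm z x) := by
    have h1 : (((D.opν + t • mulOp D.vol (quotComp T D.ν t)) u : D.L2Space) : E3 → E3)
        =ᵐ[volume.restrict D.Ω] fun x => D.ν (T t x) (w (T t x)) := by
      filter_upwards [coeFn_mulOp_add_quot ht hD.nu_material.memLp hν u, hu'] with x h1 h2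
      rw [opν, h1, h2]
    have h2 := hS.setIntegral_inner_curlPull hdet hD.omega_domain.isOpen.measurableSet
      (fun x => D.ν x (w x)) z
    rw [hS.image_eq] at h2
    rw [inner_eq_integral h1 hgr, h2]
  have e2 : inner ℝ ((D.opε + t • mulOp D.vol (quotComp T D.ε t)) e)
      (v + t • (opDiv D.vol ρ - opGradT D.vol ρ + t • mulOp D.vol fun x => cofr (fderiv ℝ ρ x)) v)
      = ∫ x in D.Ω, inner ℝ (D.ε x (E x)) (covPull (T t).symm v x) := by
    have h1 : (((D.opε + t • mulOp D.vol (quotComp T D.ε t)) e : D.L2Space) : E3 → E3)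
        =ᵐ[volume.restrict D.Ω] fun x => D.ε (T t x) (E (T t x)) := by
      filter_upwards [coeFn_mulOp_add_quot ht hD.eps_material.memLp hε e, he'] with x h1 h2
      rw [opε, h1, h2]
    have h2 := hS.setIntegral_inner_covPull hdet hD.omega_domain.isOpen.measurableSet
      (fun x => D.ε x (E x)) v
    rw [hS.image_eq] at h2
    rw [inner_eq_integral h1 hcof, h2]
  have e3 : inner ℝ (D.reactionOn γ ω e)
      (v + t • (opDiv D.vol ρ - opGradT D.vol ρ + t • mulOp D.vol fun x => cofr (fderiv ℝ ρ x)) v)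
      = ∫ x in T t '' ω, inner ℝ (dualVar D.jc γ (E x)) (covPull (T t).symm v x) := by
    rw [hS.setIntegral_inner_covPull hdet hω (fun x => dualVar D.jc γ (E x)) v, he, reactionOn,
      inner_eq_integral (reaction_toL2 hD.jc_pos hγ hω me) hcof]
    have h5 : (fun x => inner ℝ (ω.indicator (fun x => dualVar D.jc γ (E (T t x))) x)
          (cofr (fderiv ℝ (T t) x) (v x)))
        = ω.indicator fun x => inner ℝ (dualVar D.jc γ (E (T t x)))
          (cofr (fderiv ℝ (T t) x) (v x)) := by
      ext1 x
      by_cases hx : x ∈ ω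
      · simp only [Set.indicator_of_mem hx]
      · simp only [Set.indicator_of_notMem hx, inner_zero_left]
    rw [h5, integral_indicator hω, Measure.restrict_restrict hω,
      Set.inter_eq_self_of_subset_left hωΩ]
  have e4 : inner ℝ (D.source + t • toL2 D.vol (quotComp T D.f t))
      (v + t • (opDiv D.vol ρ - opGradT D.vol ρ + t • mulOp D.vol fun x => cofr (fderiv ℝ ρ x)) v)
      = ∫ x in D.Ω, inner ℝ (D.f x) (covPull (T t).symm v x) := by
    have h2 := hS.setIntegral_inner_covPull hdet hD.omega_domain.isOpen.measurableSet D.f v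
    rw [hS.image_eq] at h2
    rw [source, inner_eq_integral (coeFn_toL2_add_quot ht hD.f_memLp hf) hcof, h2]
  rw [inner_sub_left, inner_add_left, e1, e2, e3, e4]
  linarith

end Admissible

end ProblemData

/-! ### Weak limits of the transported coefficients -/

namespace IsShapeFlow

variable {B : Set E3} {θ : E3 → E3} {T : ℝ → E3 ≃ₜ E3} {C : ℝ≥0}

theorem memLp_fderiv_apply (h : IsShapeFlow B θ T C) {F : Type*} [NormedAddCommGroup F]
    [NormedSpace ℝ F] [FiniteDimensional ℝ F] {g : E3 → F} (hg : IsC1On B g) (μ : Measure E3) :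
    MemLp (fun x => fderiv ℝ g x (θ x)) ⊤ μ := by
  obtain ⟨M, hM0, hM⟩ := hg.exists_fderiv_apply_le
  exact memLp_top_of_forall_le (aestronglyMeasurable_fderiv_apply g h.lipschitz.continuous μ)
    fun x => (hM θ h.subset x).trans (mul_le_mul_of_nonneg_left (h.bounded x) hM0)

theorem weakOpLim_quotComp (h : IsShapeFlow B θ T C) (hB : IsOpen B) {g : E3 → Mat3}
    (hg : IsC1On B g) (μ : Measure E3) :
    WeakOpLim (fun t => mulOp μ (quotComp T g t)) (opDir μ g θ) := by
  obtain ⟨M, -, hM⟩ := h.exists_quot_comp_le hB hg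
  exact weakOpLim_mulOp (h.memLp_quot_comp hB hg μ) (h.memLp_fderiv_apply hg μ)
    ⟨M, hM.mono fun t ht => Eventually.of_forall ht⟩
    (Eventually.of_forall (h.tendsto_quot_comp hB hg))

theorem weakLim_quotComp (h : IsShapeFlow B θ T C) (hB : IsOpen B) {g : E3 → E3}
    (hg : IsC1On B g) (μ : Measure E3) [IsFiniteMeasure μ] :
    WeakLim (fun t => toL2 μ (quotComp T g t)) (toL2 μ fun x => fderiv ℝ g x (θ x)) := by
  obtain ⟨M, -, hM⟩ := h.exists_quot_comp_le hB hg
  exact weakLim_toL2 ((h.memLp_quot_comp hB hg μ).mono fun t ht => ht.mono_exponent le_top)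
    ((h.memLp_fderiv_apply hg μ).mono_exponent le_top)
    ⟨M, hM.mono fun t ht => Eventually.of_forall ht⟩
    (Eventually.of_forall (h.tendsto_quot_comp hB hg))

/-- The volume term. -/
theorem tendsto_volume_quot (h : IsShapeFlow B θ T C) {ω : Set E3} (hω : MeasurableSet ω)
    (hfin : volume ω ≠ ⊤) :
    Tendsto (fun t => t⁻¹ * ((∫ _y in T t '' ω, (1 : ℝ)) - ∫ _y in ω, (1 : ℝ))) (𝓝[>] 0)
      (𝓝 (∫ x in ω, tr3 (fderiv ℝ θ x))) := by
  have : IsFiniteMeasure (volume.restrict ω) :=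
    ⟨by rw [Measure.restrict_apply_univ]; exact hfin.lt_top⟩
  have hw := h.weakStarLim hω
  have h1 := hw.tendsto_integral_tr (g := fun _ => 1) (integrable_const _)
  simp only [one_mul] at h1
  obtain ⟨M, hM0, hM⟩ := exists_abs_detRem_le C
  have h2 : Tendsto (fun t => t * ∫ x in ω, detRem t (fderiv ℝ (flowQuot T t) x)) (𝓝[>] 0)
      (𝓝 0) := by
    refine squeeze_zero_norm' ?_ (tendsto_mul_const_nhdsGT (M * volume.real ω))
    filter_upwards [hw.bound, Ioc_mem_nhdsGT one_pos] with t h3 h4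
    rw [norm_mul, Real.norm_eq_abs, abs_of_pos h4.1]
    refine mul_le_mul_of_nonneg_left ?_ h4.1.le
    exact norm_setIntegral_le_of_norm_le_const hfin.lt_top fun x _ => (hM t h4 _ (h3 x)).1
  have h3 := h1.add h2
  rw [add_zero] at h3
  refine h3.congr' ?_
  filter_upwards [hw.bound, Ioc_mem_nhdsGT one_pos, h.deformation, h.det_eq, h.det_pos]
    with t h4 h5 h6 h7 h8
  have i1 : IntegrableOn (fun x => tr3 (fderiv ℝ (flowQuot T t) x)) ω :=
    Integrable.of_bound (continuous_tr3.comp_aestronglyMeasurable (hw.meas t)) M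
      (Eventually.of_forall fun x => (hM t h5 _ (h4 x)).2.1)
  have i2 : IntegrableOn (fun x => detRem t (fderiv ℝ (flowQuot T t) x)) ω :=
    Integrable.of_bound ((continuous_detRem t).comp_aestronglyMeasurable (hw.meas t)) M
      (Eventually.of_forall fun x => (hM t h5 _ (h4 x)).1)
  have i3 : IntegrableOn (fun x => t * (tr3 (fderiv ℝ (flowQuot T t) x)
      + t * detRem t (fderiv ℝ (flowQuot T t) x))) ω := (i1.add (i2.const_mul t)).const_mul t
  have e1 : ∫ _y in T t '' ω, (1 : ℝ) = ∫ x in ω, (1 + t * (tr3 (fderiv ℝ (flowQuot T t) x)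
      + t * detRem t (fderiv ℝ (flowQuot T t) x))) := by
    rw [h6.setIntegral_image hω]
    refine integral_congr_ae ?_
    filter_upwards [ae_restrict_of_ae h7, ae_restrict_of_ae h8] with x k1 k2
    rw [abs_of_pos k2, smul_eq_mul, mul_one, k1]
  rw [e1, integral_add (integrable_const _) i3, add_sub_cancel_left, integral_const_mul,
    integral_add i1 (i2.const_mul t), integral_const_mul, inv_mul_cancel_left₀ h5.1.ne']

end IsShapeFlow

theorem IsC1On.smul_one {B : Set E3} (hB : IsOpen B) {g : E3 → ℝ} (hg : IsC1On B g) :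
    IsC1On B fun x => g x • (1 : Mat3) := by
  obtain ⟨M, hM⟩ := hg.bounded
  obtain ⟨M', hM'⟩ := hg.deriv_bounded
  refine ⟨hg.contDiffOn.smul contDiffOn_const, ⟨M * ‖(1 : Mat3)‖, fun x hx => ?_⟩,
    M' * ‖(1 : Mat3)‖, fun x hx => ?_⟩
  · rw [norm_smul]
    gcongr
    exact hM x hx
  · have hd : DifferentiableAt ℝ g x :=
      (hg.contDiffOn.differentiableOn (by simp)).differentiableAt (hB.mem_nhds hx)
    rw [(hd.hasFDerivAt.smul_const (1 : Mat3)).fderiv, ContinuousLinearMap.norm_smulRight_apply]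
    gcongr
    exact hM' x hx

namespace ProblemData

variable {D : ProblemData}

/-- The weight as a matrix field. -/
def kappaMat (D : ProblemData) : E3 → Mat3 := fun x => D.κ x • 1

/-- The second order remainder of the transported weight. -/
def costRem (D : ProblemData) (T : ℝ → E3 ≃ₜ E3) (t : ℝ) (x : E3) : Mat3 :=
  tr3 (fderiv ℝ (flowQuot T t) x) • quotComp T D.kappaMat t x
    + (detRem t (fderiv ℝ (flowQuot T t) x) • D.weight x
      + (t * detRem t (fderiv ℝ (flowQuot T t) x)) • quotComp T D.kappaMat t x)

/-- The difference quotient of the transported weight. -/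
def costQuot (D : ProblemData) (T : ℝ → E3 ≃ₜ E3) (t : ℝ) : D.L2Space →L[ℝ] D.L2Space :=
  (mulOp D.vol (quotComp T D.kappaMat t) + D.opκ.comp (opDiv D.vol (flowQuot T t)))
    + t • mulOp D.vol (D.costRem T t)

/-- The weak limit of `costQuot`. -/
def costDeriv (D : ProblemData) (θ : E3 → E3) : D.L2Space →L[ℝ] D.L2Space :=
  opDir D.vol D.kappaMat θ + D.opκ.comp (opDiv D.vol θ)

namespace Admissible

variable (hD : D.Admissible) {γ : ℝ} {ω : Set E3} {θ : E3 → E3} {T : ℝ → E3 ≃ₜ E3} {C : ℝ≥0}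
include hD

theorem kappaMat_c1 : IsC1On D.B D.kappaMat := hD.kappa_c1.smul_one hD.B_domain.isOpen

theorem exists_norm_weight_le : ∃ M : ℝ, 0 ≤ M ∧ ∀ x, ‖D.weight x‖ ≤ M := by
  obtain ⟨M, hM⟩ := hD.kappaMat_c1.bounded
  refine ⟨|M|, abs_nonneg M, fun x => ?_⟩
  by_cases hx : x ∈ D.B
  · rw [weight, Set.indicator_of_mem hx]
    exact (hM x hx).trans (le_abs_self M)
  · rw [weight, Set.indicator_of_notMem hx]
    simp

theorem costRem_bounds (h : IsShapeFlow D.B θ T C) :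
    (∀ᶠ t in 𝓝[>] (0 : ℝ), MemLp (D.costRem T t) ⊤ D.vol) ∧
      ∃ M : ℝ, ∀ᶠ t in 𝓝[>] (0 : ℝ), ∀ x, ‖D.costRem T t x‖ ≤ M := by
  obtain ⟨Mw, hw0, hw⟩ := hD.exists_norm_weight_le
  obtain ⟨Mq, hq0, hq⟩ := h.exists_quot_comp_le hD.B_domain.isOpen hD.kappaMat_c1
  obtain ⟨Md, hd0, hd⟩ := exists_abs_detRem_le C
  have hs := h.weakStarLim hD.omega_domain.isOpen.measurableSet
  have hb : ∀ᶠ t in 𝓝[>] (0 : ℝ), ∀ x, ‖D.costRem T t x‖ ≤ Md * Mq + (Md * Mw + Md * Mq) := by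
    filter_upwards [hq, hs.bound, Ioc_mem_nhdsGT one_pos] with t h1 h2 h3 x
    obtain ⟨k1, k2, -⟩ := hd t h3 _ (h2 x)
    refine (norm_add_le _ _).trans (add_le_add ?_ ((norm_add_le _ _).trans (add_le_add ?_ ?_)))
    · rw [norm_smul]
      exact mul_le_mul k2 (h1 x) (norm_nonneg _) hd0
    · rw [norm_smul]
      exact mul_le_mul k1 (hw x) (norm_nonneg _) hd0
    · rw [norm_smul]
      refine mul_le_mul ?_ (h1 x) (norm_nonneg _) hd0
      rw [Real.norm_eq_abs, abs_mul, abs_of_pos h3.1]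
      exact (mul_le_of_le_one_left (abs_nonneg _) h3.2).trans k1
  refine ⟨?_, _, hb⟩
  filter_upwards [hb, h.aestronglyMeasurable_quot_comp hD.B_domain.isOpen hD.kappaMat_c1 D.vol]
    with t h1 h2
  have m1 : AEStronglyMeasurable (fun x => detRem t (fderiv ℝ (flowQuot T t) x)) D.vol :=
    (continuous_detRem t).comp_aestronglyMeasurable (hs.meas t)
  have m2 : AEStronglyMeasurable (fun x => tr3 (fderiv ℝ (flowQuot T t) x)) D.vol :=
    continuous_tr3.comp_aestronglyMeasurable (hs.meas t)
  exact memLp_top_of_forall_le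
    ((m2.smul h2).add ((m1.smul hD.memLp_weight.1).add ((m1.const_mul t).smul h2))) h1

theorem weakOpLim_costQuot (h : IsShapeFlow D.B θ T C) :
    WeakOpLim (D.costQuot T) (D.costDeriv θ) := by
  obtain ⟨h1, M, h2⟩ := hD.costRem_bounds h
  exact ((h.weakOpLim_quotComp hD.B_domain.isOpen hD.kappaMat_c1 D.vol).add
    ((h.weakStarLim hD.omega_domain.isOpen.measurableSet).weakOpLim_tr.comp_left D.opκ)).add_smul
      (bddFam_mulOp h1 ⟨M, h2.mono fun t ht => Eventually.of_forall ht⟩)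

theorem coeFn_opκ (g : D.L2Space) : D.opκ g =ᵐ[D.vol] fun x => D.B.indicator D.κ x • g x := by
  filter_upwards [coeFn_mulOp hD.memLp_weight g] with x hx
  rw [opκ, hx]
  rfl

/-- With $m$ the determinant remainder and $q$ the quotient of $\kappa$, the transported weight on
$B$ is $(1+t(\operatorname{tr}+tm))(\kappa+tq)$. `costQuot` collects what is left after removing
$\kappa$ and dividing by $t$; its terms with a further factor $t$ make up `costRem`. Outside $B$ the
flow is the identity and the weight is zero. -/
theorem coeFn_add_costQuot (h : IsShapeFlow D.B θ T C) : ∀ᶠ t in 𝓝[>] (0 : ℝ),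
    ∀ g : D.L2Space, ((D.opκ + t • D.costQuot T t) g : E3 → E3) =ᵐ[D.vol]
      fun x => D.B.indicator (fun y => (fderiv ℝ (T t) y).det * D.κ (T t y)) x • g x := by
  filter_upwards [h.memLp_quot_comp hD.B_domain.isOpen hD.kappaMat_c1 D.vol,
    (hD.costRem_bounds h).1, h.quot_lipschitz, h.det_eq, h.eq_self, self_mem_nhdsWithin]
    with t h1 h2 h3 h4 h5 ht g
  have ht : (0 : ℝ) < t := ht
  have hq := coeFn_mulOp (A := quotComp T D.kappaMat t) h1 g
  simp only [costQuot, add_apply, smul_apply, ContinuousLinearMap.comp_apply]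
  set a := D.opκ g
  set b := mulOp D.vol (quotComp T D.kappaMat t) g
  set c := D.opκ (opDiv D.vol (flowQuot T t) g)
  set r := mulOp D.vol (D.costRem T t) g
  filter_upwards [hD.coeFn_opκ g, hq, hD.coeFn_opκ (opDiv D.vol (flowQuot T t) g),
    coeFn_opDiv h3 g, coeFn_mulOp h2 g, Lp.coeFn_add a (t • (b + c + t • r)),
    Lp.coeFn_smul t (b + c + t • r), Lp.coeFn_add (b + c) (t • r), Lp.coeFn_add b c,
    Lp.coeFn_smul t r, ae_restrict_of_ae h4] with x k1 k2 k3 k4 k5 k6 k7 k8 k9 k10 k11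
  rw [k6, Pi.add_apply, k7, Pi.smul_apply, k8, Pi.add_apply, k9, Pi.add_apply, k10, Pi.smul_apply,
    k1, k2, k3, k4, k5]
  by_cases hx : x ∈ D.B
  · simp only [Set.indicator_of_mem hx, costRem, weight, quotComp, kappaMat, k11, smul_apply,
      one_apply_eq_self, add_apply, sub_apply]
    match_scalars
    field_simp
    ring
  · have hT : T t x = x := h5 x fun hx' => hx (h.subset hx')
    simp [Set.indicator_of_notMem hx, costRem, weight, quotComp, hT]

/-- The tracking term on a transported shape. -/
theorem tracking_transported (h : IsShapeFlow D.B θ T C) : ∀ᶠ t in 𝓝[>] (0 : ℝ),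
    ∀ E : E3 → E3, MemLp E 2 D.vol →
      ∫ x in D.B, D.κ x * ‖E x - D.Ed x‖ ^ 2 = inner ℝ ((D.opκ + t • D.costQuot T t)
        (toL2 D.vol (fun x => E (T t x)) - (D.targetL2 + t • toL2 D.vol (quotComp T D.Ed t))))
        (toL2 D.vol (fun x => E (T t x)) - (D.targetL2 + t • toL2 D.vol (quotComp T D.Ed t))) := by
  have := hD.isFiniteMeasure
  filter_upwards [hD.coeFn_add_costQuot h, h.deformation, h.det_pos,
    h.memLp_quot_comp hD.B_domain.isOpen hD.Ed_c1 D.vol, self_mem_nhdsWithin] with t h1 h2 h3 h4 ht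
  intro E hE
  have ht : (0 : ℝ) < t := ht
  have hBm := hD.B_domain.isOpen.measurableSet
  have hE' : MemLp (fun x => E (T t x)) 2 D.vol := (h2.mono hD.B_subset).memLp_comp hE
  have h4' : MemLp (quotComp T D.Ed t) 2 D.vol := MemLp.mono_exponent h4 le_top
  set e := toL2 D.vol fun x => E (T t x)
  set d' := toL2 D.vol (quotComp T D.Ed t)
  set g := e - (D.targetL2 + t • d') with hg
  have hgx : ∀ᵐ x ∂D.vol, x ∈ D.B → g x = E (T t x) - D.Ed (T t x) := by
    filter_upwards [coeFn_toL2 hE', coeFn_toL2 h4', coeFn_toL2 hD.memLp_target,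
      Lp.coeFn_sub e (D.targetL2 + t • d'), Lp.coeFn_add D.targetL2 (t • d'),
      Lp.coeFn_smul t d'] with x k1 k2 k3 k4 k5 k6 hx
    rw [hg, k4, Pi.sub_apply, k5, Pi.add_apply, k6, Pi.smul_apply, k1, k2, targetL2, k3, target,
      Set.indicator_of_mem hx, quotComp, smul_smul, mul_inv_cancel₀ ht.ne', one_smul,
      add_sub_cancel]
  have e1 : ∫ x in D.B, D.κ x * ‖E x - D.Ed x‖ ^ 2 = ∫ x in D.B,
      (fderiv ℝ (T t) x).det * D.κ (T t x) * ‖E (T t x) - D.Ed (T t x)‖ ^ 2 := by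
    conv_lhs => rw [← h2.image_eq]
    rw [h2.setIntegral_image hBm]
    refine integral_congr_ae ?_
    filter_upwards [ae_restrict_of_ae h3] with x hx
    rw [abs_of_pos hx, smul_eq_mul, mul_assoc]
  rw [e1, inner_eq_integral (h1 g) (ae_eq_refl (g : E3 → E3)),
    ← Set.inter_eq_self_of_subset_left hD.B_subset, ← Measure.restrict_restrict hBm,
    ← integral_indicator hBm]
  refine integral_congr_ae ?_
  filter_upwards [hgx] with x hx
  by_cases hxB : x ∈ D.B
  · have hB' : x ∈ D.B ∩ D.Ω := ⟨hxB, hD.B_subset hxB⟩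
    simp only [Set.indicator_of_mem hxB, Set.indicator_of_mem hB', hx hxB, inner_smul_left,
      real_inner_self_eq_norm_sq, RCLike.conj_to_real]
  · have hB' : x ∉ D.B ∩ D.Ω := fun h => hxB h.1
    simp [Set.indicator_of_notMem hxB, Set.indicator_of_notMem hB']

theorem tracking_eq {E : E3 → E3} (hE : MemLp E 2 D.vol) :
    ∫ x in D.B, D.κ x * ‖E x - D.Ed x‖ ^ 2
      = inner ℝ (D.opκ (toL2 D.vol E - D.targetL2)) (toL2 D.vol E - D.targetL2) := by
  have hBm := hD.B_domain.isOpen.measurableSet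
  set g := toL2 D.vol E - D.targetL2 with hg
  have hgx : ∀ᵐ x ∂D.vol, x ∈ D.B → g x = E x - D.Ed x := by
    filter_upwards [coeFn_toL2 hE, coeFn_toL2 hD.memLp_target,
      Lp.coeFn_sub (toL2 D.vol E) D.targetL2] with x k1 k3 k4 hx
    rw [hg, k4, Pi.sub_apply, k1, targetL2, k3, target, Set.indicator_of_mem hx]
  rw [inner_eq_integral (hD.coeFn_opκ g) (ae_eq_refl (g : E3 → E3)),
    ← Set.inter_eq_self_of_subset_left hD.B_subset, ← Measure.restrict_restrict hBm,
    ← integral_indicator hBm]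
  refine integral_congr_ae ?_
  filter_upwards [hgx] with x hx
  by_cases hxB : x ∈ D.B
  · have hB' : x ∈ D.B ∩ D.Ω := ⟨hxB, hD.B_subset hxB⟩
    simp only [Set.indicator_of_mem hxB, Set.indicator_of_mem hB', hx hxB, inner_smul_left,
      real_inner_self_eq_norm_sq, RCLike.conj_to_real]
  · have hB' : x ∉ D.B ∩ D.Ω := fun h => hxB h.1
    simp [Set.indicator_of_notMem hxB, Set.indicator_of_notMem hB']

/-- The state and adjoint state on `ω` and the transported states form a `TransportedProblem`. -/
theorem transportedProblem (hγ : 0 < γ) (hω : MeasurableSet ω) (hωB : ω ⊆ D.B)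
    (h : IsShapeFlow D.B θ T C) {E w p q : D.L2Space} (hE : D.IsStateL2 γ ω E w)
    (hp : (p, q) ∈ hZero D.Ω)
    (hadj : ∀ v z, (v, z) ∈ hZero D.Ω → inner ℝ (D.opν z) q + inner ℝ (D.opε v) p
      + inner ℝ (mulOp D.vol (reactionDeriv D.jc γ ω E) v) p
        = -inner ℝ (D.opκ (E - D.targetL2)) v)
    {Et wt : ℝ → E3 → E3} (hEt : ∀ᶠ t in 𝓝[>] (0 : ℝ), D.IsWeakState γ (T t '' ω) (Et t) (wt t)) :
    TransportedProblem (hZero D.Ω) D.opν D.opε D.opκ (mulOp D.vol (reactionDeriv D.jc γ ω E))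
      (D.reactionOn γ ω) D.source D.targetL2 E w p q
      (fun t => opGrad D.vol (flowQuot T t)) (fun t => opGradT D.vol (flowQuot T t))
      (fun t => opDiv D.vol (flowQuot T t))
      (fun t => mulOp D.vol fun x => cofr (fderiv ℝ (flowQuot T t) x))
      (fun t => mulOp D.vol fun x => adjg (fderiv ℝ (flowQuot T t) x))
      (fun t => mulOp D.vol (quotComp T D.ν t)) (fun t => mulOp D.vol (quotComp T D.ε t))
      (D.costQuot T) (fun t => toL2 D.vol (quotComp T D.f t))
      (fun t => toL2 D.vol (quotComp T D.Ed t))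
      (fun t => toL2 D.vol fun x => Et t (T t x)) (fun t => toL2 D.vol fun x => wt t (T t x))
      (opGrad D.vol θ) (opGradT D.vol θ) (opDiv D.vol θ) (opDir D.vol D.ν θ) (opDir D.vol D.ε θ)
      (D.costDeriv θ) (toL2 D.vol fun x => fderiv ℝ D.f x (θ x))
      (toL2 D.vol fun x => fderiv ℝ D.Ed x (θ x)) := by
  have := hD.isFiniteMeasure
  have hB := hD.B_domain.isOpen
  have hωΩ := hωB.trans hD.B_subset
  have hs := h.weakStarLim hD.omega_domain.isOpen.measurableSet
  obtain ⟨M, hM⟩ := hD.exists_norm_state_le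
  have hdef : ∀ᶠ t in 𝓝[>] (0 : ℝ), IsDeformation D.Ω (T t) :=
    h.deformation.mono fun t ht => ht.mono hD.B_subset
  have hsub : ∀ᶠ t in 𝓝[>] (0 : ℝ), T t '' ω ⊆ D.Ω :=
    hdef.mono fun t ht => (Set.image_mono hωΩ).trans ht.image_eq.subset
  have hmeas : ∀ t, MeasurableSet (T t '' ω) := fun t =>
    (T t).measurableEmbedding.measurableSet_image.2 hω
  -- Composition with a deformation enlarges the $L^2$ norm by at most the factor $3$.
  have hcomp : ∀ᶠ t in 𝓝[>] (0 : ℝ), ∀ u : E3 → E3, MemLp u 2 D.vol → ‖toL2 D.vol u‖ ≤ M →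
      ‖toL2 D.vol fun x => u (T t x)‖ ≤ 3 * M := by
    filter_upwards [hdef] with t ht u hu huM
    rw [norm_toL2 (ht.memLp_comp hu)]
    rw [norm_toL2 hu] at huM
    have h1 := ENNReal.toReal_mono (ENNReal.mul_ne_top (by norm_num) hu.2.ne)
      (ht.eLpNorm_comp_le hu.1)
    rw [ENNReal.toReal_mul] at h1
    refine h1.trans ?_
    have : (3 : ENNReal).toReal = 3 := by norm_num
    rw [this]
    gcongr
  -- The a priori bound does not depend on the shape, so it applies to all transported shapes at
  -- once.
  have hbound : ∀ᶠ t in 𝓝[>] (0 : ℝ), ‖toL2 D.vol (Et t)‖ ≤ M ∧ ‖toL2 D.vol (wt t)‖ ≤ M := by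
    filter_upwards [hsub, hEt] with t h1 h2
    exact hM γ hγ _ (hmeas t) _ _ (hD.isStateL2_toL2 hγ (hmeas t) h1 h2.mem h2.eq)
  refine ⟨?_, hD.opκ_symm, reaction_monotone hD.jc_pos hγ hω,
    ⟨_, lipschitzWith_reaction hD.jc_pos hγ hω⟩, hasFDerivAt_inner_reaction hD.jc_pos hγ hω E p,
    hE.mem, hE.eq, hp, hadj, hs.weakOpLim, hs.weakOpLim_adjoint, hs.weakOpLim_tr,
    hs.bddFam continuous_cofr, hs.bddFam continuous_adjg,
    h.weakOpLim_quotComp hB hD.nu_material.c1 _, h.weakOpLim_quotComp hB hD.eps_material.c1 _,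
    hD.weakOpLim_costQuot h, h.weakLim_quotComp hB hD.f_c1 _, h.weakLim_quotComp hB hD.Ed_c1 _,
    ⟨3 * M, ?_⟩, ⟨3 * M, ?_⟩, ?_, ?_⟩
  · obtain ⟨c, hc, h1, h2⟩ := hD.exists_coercive
    exact ⟨c, hc, fun v => ⟨h1 v, h2 v⟩⟩
  · filter_upwards [hcomp, hbound, hEt] with t h1 h2 h3
    exact h1 _ h3.mem.memLp h2.1
  · filter_upwards [hcomp, hbound, hEt] with t h1 h2 h3
    exact h1 _ h3.mem.memLp_curl h2.2
  · filter_upwards [hdef, h.quot_lipschitz, h.fderiv_eq, hEt] with t h1 h2 h3 h4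
    exact hD.pert_mem h1 h2 h3 h4.mem rfl rfl
  · filter_upwards [hdef, h.quot_lipschitz, h.fderiv_eq, h.det_pos,
      h.memLp_quot_comp hB hD.nu_material.c1 D.vol, h.memLp_quot_comp hB hD.eps_material.c1 D.vol,
      h.memLp_quot_comp hB hD.f_c1 D.vol, self_mem_nhdsWithin, hEt]
      with t h1 h2 h3 h4 h5 h6 h7 ht h8 v z hvz
    exact hD.pert_state hγ hω hωΩ ht h1 h2 h3 h4 h5 h6 (MemLp.mono_exponent h7 le_top) h8 rfl rfl
      hvz

end Admissible

end ProblemData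

/-! ### Bounds by the `C^{0,1}` norm -/

section LipNorm

variable {B : Set E3}

theorem bddAbove_lipNorm (θ : lipschitzFields B) :
    BddAbove (Set.range fun x : B => ‖(θ : E3 → E3) x‖) ∧
      BddAbove (Set.range fun p : B × B =>
        ‖(θ : E3 → E3) p.1 - (θ : E3 → E3) p.2‖ / ‖(p.1 : E3) - p.2‖) := by
  obtain ⟨⟨K, hK⟩, hc, -⟩ := θ.2
  obtain ⟨M, hM⟩ := hc.exists_bound_of_continuous hK.continuous
  refine ⟨⟨M, ?_⟩, ⟨K, ?_⟩⟩
  · rintro _ ⟨x, rfl⟩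
    exact hM x
  · rintro _ ⟨p, rfl⟩
    exact div_le_of_le_mul₀ (norm_nonneg _) K.2 (hK.norm_sub_le _ _)

theorem lipNorm_parts_nonneg (θ : E3 → E3) : 0 ≤ (⨆ x : B, ‖θ x‖) ∧
    0 ≤ ⨆ p : B × B, ‖θ p.1 - θ p.2‖ / ‖(p.1 : E3) - p.2‖ :=
  ⟨Real.iSup_nonneg fun _ => norm_nonneg _, Real.iSup_nonneg fun _ => by positivity⟩

theorem lipNorm_nonneg (θ : E3 → E3) : 0 ≤ lipNorm B θ :=
  add_nonneg (lipNorm_parts_nonneg θ).1 (lipNorm_parts_nonneg θ).2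

theorem norm_le_lipNorm (θ : lipschitzFields B) (x : E3) :
    ‖(θ : E3 → E3) x‖ ≤ lipNorm B θ := by
  by_cases hx : x ∈ B
  · exact (le_ciSup (bddAbove_lipNorm θ).1 ⟨x, hx⟩).trans
      (le_add_of_nonneg_right (lipNorm_parts_nonneg (θ : E3 → E3)).2)
  · rw [image_eq_zero_of_notMem_tsupport fun h => hx (θ.2.2.2 h), norm_zero]
    exact lipNorm_nonneg _

/-- Inside the open set $B$ the derivative is controlled by the Lipschitz constant on $B$; outside
$B$ it vanishes, since $B$ contains the closed support of $\theta$. -/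
theorem norm_fderiv_le_lipNorm (hB : IsOpen B) (θ : lipschitzFields B) (x : E3) :
    ‖fderiv ℝ (θ : E3 → E3) x‖ ≤ lipNorm B θ := by
  by_cases hx : x ∈ B
  · have h0 := lipNorm_parts_nonneg (B := B) (θ : E3 → E3)
    set c := ⨆ p : B × B, ‖(θ : E3 → E3) p.1 - (θ : E3 → E3) p.2‖ / ‖(p.1 : E3) - p.2‖
    refine le_trans ?_ (le_add_of_nonneg_left h0.1)
    have hl : LipschitzOnWith c.toNNReal (θ : E3 → E3) B := by
      refine LipschitzOnWith.of_dist_le_mul fun y hy z hz => ?_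
      rw [Real.coe_toNNReal _ h0.2, dist_eq_norm, dist_eq_norm]
      rcases eq_or_ne y z with rfl | hyz
      · simp
      · have h1 : ‖(θ : E3 → E3) y - (θ : E3 → E3) z‖ / ‖y - z‖ ≤ c :=
          le_ciSup (bddAbove_lipNorm θ).2 (⟨y, hy⟩, ⟨z, hz⟩)
        rwa [div_le_iff₀ (norm_pos_iff.2 (sub_ne_zero.2 hyz))] at h1
    have h2 := norm_fderiv_le_of_lipschitzOn ℝ (hB.mem_nhds hx) hl
    rwa [Real.coe_toNNReal _ h0.2] at h2
  · have h1 : fderiv ℝ (θ : E3 → E3) x = 0 :=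
      Function.notMem_support.1 fun h => hx (θ.2.2.2 (support_fderiv_subset ℝ h))
    rw [h1, norm_zero]
    exact lipNorm_nonneg _

theorem abs_tr3_le (A : Mat3) : |tr3 A| ≤ 3 * ‖A‖ := by
  rw [tr3_eq]
  refine (Finset.abs_sum_le_sum_abs _ _).trans ?_
  have h : ∀ i ∈ Finset.univ, |A (EuclideanSpace.single (i : Fin 3) 1) i| ≤ ‖A‖ := fun i _ => by
    refine (PiLp.norm_apply_le (A (EuclideanSpace.single i 1)) i).trans ?_
    simpa using A.le_opNorm (EuclideanSpace.single i 1)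
  refine (Finset.sum_le_sum h).trans_eq ?_
  simp

end LipNorm

/-! ### Linear dependence on the field -/

section Linear

variable {B : Set E3} {μ : Measure E3}

theorem isLinearMap_mulOp {A : lipschitzFields B → E3 → Mat3} (hm : ∀ θ, MemLp (A θ) ⊤ μ)
    (hadd : ∀ θ θ', A (θ + θ') =ᵐ[μ] fun x => A θ x + A θ' x)
    (hsmul : ∀ (c : ℝ) θ, A (c • θ) =ᵐ[μ] fun x => c • A θ x) :
    IsLinearMap ℝ fun θ => mulOp μ (A θ) :=
  ⟨fun θ θ' => by rw [mulOp_congr (hadd θ θ'), mulOp_add (hm θ) (hm θ')],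
    fun c θ => by rw [mulOp_congr (hsmul c θ), mulOp_smul (hm θ)]⟩

theorem isLinearMap_toL2 {u : lipschitzFields B → E3 → E3} (hm : ∀ θ, MemLp (u θ) 2 μ)
    (hadd : ∀ θ θ', u (θ + θ') = u θ + u θ') (hsmul : ∀ (c : ℝ) θ, u (c • θ) = c • u θ) :
    IsLinearMap ℝ fun θ => toL2 μ (u θ) := by
  refine ⟨fun θ θ' => Lp.ext ?_, fun c θ => Lp.ext ?_⟩
  · filter_upwards [coeFn_toL2 (hm (θ + θ')), coeFn_toL2 (hm θ), coeFn_toL2 (hm θ'),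
      Lp.coeFn_add (toL2 μ (u θ)) (toL2 μ (u θ'))] with x h1 h2 h3 h4
    rw [h1, h4, Pi.add_apply, h2, h3, hadd, Pi.add_apply]
  · filter_upwards [coeFn_toL2 (hm (c • θ)), coeFn_toL2 (hm θ),
      Lp.coeFn_smul c (toL2 μ (u θ))] with x h1 h2 h3
    rw [h1, h3, Pi.smul_apply, h2, hsmul, Pi.smul_apply]

theorem ae_differentiableAt_field (θ : lipschitzFields B) :
    ∀ᵐ x, DifferentiableAt ℝ (θ : E3 → E3) x := by
  obtain ⟨⟨K, hK⟩, -⟩ := θ.2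
  exact hK.ae_differentiableAt

theorem ae_fderiv_field_add (θ θ' : lipschitzFields B) : ∀ᵐ x,
    fderiv ℝ ((θ + θ' : lipschitzFields B) : E3 → E3) x
      = fderiv ℝ (θ : E3 → E3) x + fderiv ℝ (θ' : E3 → E3) x := by
  filter_upwards [ae_differentiableAt_field θ, ae_differentiableAt_field θ'] with x h1 h2
  exact fderiv_add h1 h2

theorem ae_fderiv_field_smul (c : ℝ) (θ : lipschitzFields B) : ∀ᵐ x,
    fderiv ℝ ((c • θ : lipschitzFields B) : E3 → E3) x = c • fderiv ℝ (θ : E3 → E3) x := by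
  filter_upwards [ae_differentiableAt_field θ] with x h1
  exact fderiv_const_smul h1 c

theorem memLp_clm_fderiv_field {F : Type*} [NormedAddCommGroup F] {L : Mat3 → F}
    (hL : Continuous L) (θ : lipschitzFields B) :
    MemLp (fun x => L (fderiv ℝ (θ : E3 → E3) x)) ⊤ μ := by
  obtain ⟨⟨K, hK⟩, -⟩ := θ.2
  exact memLp_comp_fderiv hK hL

theorem isLinearMap_mulOp_fderiv {s : Set E3} (L : Mat3 →ₗ[ℝ] Mat3) :
    IsLinearMap ℝ fun θ : lipschitzFields B =>
      mulOp (volume.restrict s) fun x => L (fderiv ℝ (θ : E3 → E3) x) := by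
  have hL : Continuous L := L.continuous_of_finiteDimensional
  refine isLinearMap_mulOp (memLp_clm_fderiv_field hL) (fun θ θ' => ?_) fun c θ => ?_
  · filter_upwards [ae_restrict_of_ae (ae_fderiv_field_add θ θ')] with x hx
    rw [hx, map_add]
  · filter_upwards [ae_restrict_of_ae (ae_fderiv_field_smul c θ)] with x hx
    rw [hx, map_smul]

/-- The trace as a linear map. -/
def tr3Lin : Mat3 →ₗ[ℝ] ℝ where
  toFun := tr3
  map_add' A A' := by simp [tr3, Matrix.trace_add]
  map_smul' c A := by simp [tr3, Matrix.trace_smul]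

theorem isLinearMap_opGrad {s : Set E3} :
    IsLinearMap ℝ fun θ : lipschitzFields B => opGrad (volume.restrict s) θ :=
  isLinearMap_mulOp_fderiv LinearMap.id

theorem isLinearMap_opGradT {s : Set E3} :
    IsLinearMap ℝ fun θ : lipschitzFields B => opGradT (volume.restrict s) θ :=
  isLinearMap_mulOp_fderiv ⟨⟨fun A => ContinuousLinearMap.adjoint A, map_add _⟩, fun c A => by
    simp⟩

theorem isLinearMap_opDiv {s : Set E3} :
    IsLinearMap ℝ fun θ : lipschitzFields B => opDiv (volume.restrict s) θ :=
  isLinearMap_mulOp_fderiv (tr3Lin.smulRight (1 : Mat3))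

theorem isLinearMap_setIntegral_tr3 {s : Set E3} (hs : volume s ≠ ⊤) :
    IsLinearMap ℝ fun θ : lipschitzFields B => ∫ x in s, tr3 (fderiv ℝ (θ : E3 → E3) x) := by
  have : IsFiniteMeasure (volume.restrict s) :=
    ⟨by rw [Measure.restrict_apply_univ]; exact hs.lt_top⟩
  have hi : ∀ θ : lipschitzFields B,
      Integrable (fun x => tr3 (fderiv ℝ (θ : E3 → E3) x)) (volume.restrict s) := fun θ =>
    memLp_one_iff_integrable.1 ((memLp_clm_fderiv_field continuous_tr3 θ).mono_exponent le_top)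
  refine ⟨fun θ θ' => ?_, fun c θ => ?_⟩
  · rw [← integral_add (hi θ) (hi θ')]
    refine integral_congr_ae ?_
    filter_upwards [ae_restrict_of_ae (ae_fderiv_field_add θ θ')] with x hx
    rw [hx]
    exact map_add tr3Lin _ _
  · rw [smul_eq_mul, ← integral_const_mul]
    refine integral_congr_ae ?_
    filter_upwards [ae_restrict_of_ae (ae_fderiv_field_smul c θ)] with x hx
    rw [hx]
    exact map_smul tr3Lin c _

theorem IsC1On.memLp_fderiv_field {F : Type*} [NormedAddCommGroup F] [NormedSpace ℝ F]
    [FiniteDimensional ℝ F] {g : E3 → F} (hg : IsC1On B g) (θ : lipschitzFields B) :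
    MemLp (fun x => fderiv ℝ g x ((θ : E3 → E3) x)) ⊤ μ := by
  obtain ⟨T, C, h⟩ := exists_isShapeFlow θ
  exact h.memLp_fderiv_apply hg μ

theorem isLinearMap_opDir {g : E3 → Mat3} (hg : IsC1On B g) :
    IsLinearMap ℝ fun θ : lipschitzFields B => opDir μ g θ :=
  isLinearMap_mulOp hg.memLp_fderiv_field
    (fun _ _ => Eventually.of_forall fun _ => map_add _ _ _)
    fun _ _ => Eventually.of_forall fun x => (fderiv ℝ g x).map_smul _ _

theorem isLinearMap_toL2_fderiv [IsFiniteMeasure μ] {g : E3 → E3} (hg : IsC1On B g) :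
    IsLinearMap ℝ fun θ : lipschitzFields B =>
      toL2 μ fun x => fderiv ℝ g x ((θ : E3 → E3) x) :=
  isLinearMap_toL2 (fun θ => (hg.memLp_fderiv_field θ).mono_exponent le_top)
    (fun _ _ => funext fun _ => map_add _ _ _) fun _ _ => funext fun x => (fderiv ℝ g x).map_smul _ _

end Linear

/-! ### The shape derivative -/

/-- The weak formula for the derivative of the tracking term in terms of the state `(E, w)` and
the adjoint state `(p, q)`. -/
def sensitivity {V : Type*} [NormedAddCommGroup V] [InnerProductSpace ℝ V]
    (N Ep K Λ' : V →L[ℝ] V) (Z d E w p q : V) (R₀ Rs₀ τ₀ N₀ Ep₀ K₀ : V →L[ℝ] V) (f₀ d₀ : V) : ℝ :=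
  1 / 2 * inner ℝ (K₀ (E - d)) (E - d) - inner ℝ (K (E - d)) (Rs₀ E + d₀)
    + inner ℝ (N₀ w) q + inner ℝ (N ((R₀ - τ₀) w)) q + inner ℝ (N w) (R₀ q)
    + inner ℝ (Ep₀ E) p - inner ℝ (Ep (Rs₀ E)) p
    + inner ℝ Z ((τ₀ - Rs₀) p) - inner ℝ (Λ' (Rs₀ E)) p - inner ℝ f₀ p

theorem TransportedProblem.tendsto_sensitivity {V : Type*} [NormedAddCommGroup V]
    [InnerProductSpace ℝ V] [CompleteSpace V] {H : Submodule ℝ (V × V)} {N Ep K Λ' : V →L[ℝ] V}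
    {Φ : V → V} {f d E w p q : V} {R Rs τ C Cs N' Ep' K' : ℝ → V →L[ℝ] V} {f' d' e u : ℝ → V}
    {R₀ Rs₀ τ₀ N₀ Ep₀ K₀ : V →L[ℝ] V} {f₀ d₀ : V}
    (h : TransportedProblem H N Ep K Λ' Φ f d E w p q R Rs τ C Cs N' Ep' K' f' d' e u R₀ Rs₀ τ₀ N₀
      Ep₀ K₀ f₀ d₀) {G : ℝ → ℝ} {a : ℝ}
    (hG : ∀ᶠ t in 𝓝[>] (0 : ℝ), G t
      = inner ℝ ((K + t • K' t) (e t - (d + t • d' t))) (e t - (d + t • d' t)))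
    (ha : a = inner ℝ (K (E - d)) (E - d)) :
    Tendsto (fun t => t⁻¹ * (1 / 2 * G t - 1 / 2 * a)) (𝓝[>] 0)
      (𝓝 (sensitivity N Ep K Λ' (Ep E + Φ E - f) d E w p q R₀ Rs₀ τ₀ N₀ Ep₀ K₀ f₀ d₀)) := by
  refine h.tendsto_quotient.congr' ?_
  filter_upwards [hG] with t ht
  rw [ht, ha]

/-- State and adjoint state do not depend on $\theta$, and every term is of degree one in the limit
data. -/
theorem isLinearMap_sensitivity {Θ V : Type*} [AddCommGroup Θ] [Module ℝ Θ]
    [NormedAddCommGroup V] [InnerProductSpace ℝ V]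
    {N Ep K Λ' : V →L[ℝ] V} {Z d E w p q : V} {R₀ Rs₀ τ₀ N₀ Ep₀ K₀ : Θ → V →L[ℝ] V} {f₀ d₀ : Θ → V}
    (h1 : IsLinearMap ℝ R₀) (h2 : IsLinearMap ℝ Rs₀) (h3 : IsLinearMap ℝ τ₀)
    (h4 : IsLinearMap ℝ N₀) (h5 : IsLinearMap ℝ Ep₀) (h6 : IsLinearMap ℝ K₀)
    (h7 : IsLinearMap ℝ f₀) (h8 : IsLinearMap ℝ d₀) :
    IsLinearMap ℝ fun θ => sensitivity N Ep K Λ' Z d E w p q (R₀ θ) (Rs₀ θ) (τ₀ θ) (N₀ θ) (Ep₀ θ)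
      (K₀ θ) (f₀ θ) (d₀ θ) := by
  refine ⟨fun θ θ' => ?_, fun c θ => ?_⟩
  · simp only [sensitivity, h1.map_add, h2.map_add, h3.map_add, h4.map_add, h5.map_add,
      h6.map_add, h7.map_add, h8.map_add, add_apply, sub_apply, map_add, map_sub, inner_add_left,
      inner_add_right, inner_sub_left, inner_sub_right]
    ring
  · simp only [sensitivity, h1.map_smul, h2.map_smul, h3.map_smul, h4.map_smul, h5.map_smul,
      h6.map_smul, h7.map_smul, h8.map_smul, smul_apply, sub_apply, map_smul, map_sub,
      inner_add_right, inner_sub_left, inner_sub_right, real_inner_smul_left,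
      real_inner_smul_right, smul_eq_mul]
    ring

/-- The operator `Λ'` occurs only in the product `Λ' (Rs₀ E)`, which is estimated as a whole in
`hΛ`. Its operator norm, which may grow with $\gamma$, is deliberately not used. -/
theorem abs_sensitivity_le {V : Type*} [NormedAddCommGroup V] [InnerProductSpace ℝ V]
    {N Ep K Λ' : V →L[ℝ] V} {Z d E w p q : V} {R₀ Rs₀ τ₀ N₀ Ep₀ K₀ : V →L[ℝ] V} {f₀ d₀ : V}
    {M l : ℝ} (hl : 0 ≤ l) (hN : ‖N‖ ≤ M) (hEp : ‖Ep‖ ≤ M) (hK : ‖K (E - d)‖ ≤ M)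
    (hZ : ‖Z‖ ≤ M) (hd : ‖E - d‖ ≤ M) (hE : ‖E‖ ≤ M) (hw : ‖w‖ ≤ M) (hp : ‖p‖ ≤ M) (hq : ‖q‖ ≤ M)
    (hR : ‖R₀‖ ≤ M * l) (hRs : ‖Rs₀‖ ≤ M * l) (hτ : ‖τ₀‖ ≤ M * l) (hN₀ : ‖N₀‖ ≤ M * l)
    (hEp₀ : ‖Ep₀‖ ≤ M * l) (hK₀ : ‖K₀‖ ≤ M * l) (hf : ‖f₀‖ ≤ M * l) (hd₀ : ‖d₀‖ ≤ M * l)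
    (hΛ : ‖Λ' (Rs₀ E)‖ ≤ M * l) :
    |sensitivity N Ep K Λ' Z d E w p q R₀ Rs₀ τ₀ N₀ Ep₀ K₀ f₀ d₀|
      ≤ (8 * M ^ 3 + 4 * M ^ 4 + 3 * M ^ 2) * l := by
  have hM : 0 ≤ M := (norm_nonneg _).trans hE
  have hMl : 0 ≤ M * l := mul_nonneg hM hl
  have app : ∀ {A : V →L[ℝ] V} {x : V} {a b : ℝ}, ‖A‖ ≤ a → ‖x‖ ≤ b → ‖A x‖ ≤ a * b :=
    fun hA hx => (ContinuousLinearMap.le_opNorm _ _).trans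
      (mul_le_mul hA hx (norm_nonneg _) ((norm_nonneg _).trans hA))
  have inn : ∀ {x y : V} {a b : ℝ}, ‖x‖ ≤ a → ‖y‖ ≤ b → |inner ℝ x y| ≤ a * b :=
    fun hx hy => (abs_real_inner_le_norm _ _).trans
      (mul_le_mul hx hy (norm_nonneg _) ((norm_nonneg _).trans hx))
  have sb : ∀ {A A' : V →L[ℝ] V}, ‖A‖ ≤ M * l → ‖A'‖ ≤ M * l → ‖A - A'‖ ≤ M * l + M * l :=
    fun h h' => (norm_sub_le _ _).trans (add_le_add h h')
  have b1 := abs_le.1 (inn (app hK₀ hd) hd)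
  have b2 := abs_le.1 (inn hK ((norm_add_le _ _).trans (add_le_add (app hRs hE) hd₀)))
  have b3 := abs_le.1 (inn (app hN₀ hw) hq)
  have b4 := abs_le.1 (inn (app hN (app (sb hR hτ) hw)) hq)
  have b5 := abs_le.1 (inn (app hN hw) (app hR hq))
  have b6 := abs_le.1 (inn (app hEp₀ hE) hp)
  have b7 := abs_le.1 (inn (app hEp (app hRs hE)) hp)
  have b8 := abs_le.1 (inn hZ (app (sb hτ hRs) hp))
  have b9 := abs_le.1 (inn hΛ hp)
  have b10 := abs_le.1 (inn hf hp)
  -- The ten terms need at most $6M^3+4M^4+3M^2$ times $l$; the remaining $2M^3l$ is slack.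
  have key : (8 * M ^ 3 + 4 * M ^ 4 + 3 * M ^ 2) * l = M * l * M * M + M * (M * l * M + M * l)
      + M * l * M * M + M * ((M * l + M * l) * M) * M + M * M * (M * l * M) + M * l * M * M
      + M * (M * l * M) * M + M * ((M * l + M * l) * M) + M * l * M + M * l * M
      + 2 * (M * l * M * M) := by ring
  have h0 : 0 ≤ M * l * M * M := by positivity
  rw [key, sensitivity]
  refine abs_le.2 ⟨?_, ?_⟩ <;> linarith [b1.1, b1.2]

namespace ProblemData

variable {D : ProblemData}

/-- The shape derivative in terms of the state `(E, w)` and the adjoint state `(p, q)`. -/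
def shapeDeriv (D : ProblemData) (γ : ℝ) (ω : Set E3) (E w p q : D.L2Space) (θ : E3 → E3) : ℝ :=
  sensitivity D.opν D.opε D.opκ (mulOp D.vol (reactionDeriv D.jc γ ω E))
    (D.opε E + D.reactionOn γ ω E - D.source) D.targetL2 E w p q (opGrad D.vol θ)
    (opGradT D.vol θ) (opDiv D.vol θ) (opDir D.vol D.ν θ) (opDir D.vol D.ε θ) (D.costDeriv θ)
    (toL2 D.vol fun x => fderiv ℝ D.f x (θ x)) (toL2 D.vol fun x => fderiv ℝ D.Ed x (θ x))
  + ∫ x in ω, tr3 (fderiv ℝ θ x)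

namespace Admissible

variable (hD : D.Admissible) {γ : ℝ} {ω : Set E3}
include hD

theorem volume_shape_ne_top (hωB : ω ⊆ D.B) : volume ω ≠ ⊤ :=
  measure_ne_top_of_subset (hωB.trans hD.B_subset) hD.volume_ne_top

theorem isLinearMap_shapeDeriv (hωB : ω ⊆ D.B) (E w p q : D.L2Space) :
    IsLinearMap ℝ fun θ : lipschitzFields D.B => D.shapeDeriv γ ω E w p q θ := by
  have := hD.isFiniteMeasure
  have hc : IsLinearMap ℝ fun θ : lipschitzFields D.B => D.costDeriv θ := by
    have h1 := isLinearMap_opDir (μ := D.vol) hD.kappaMat_c1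
    have h2 := isLinearMap_opDiv (B := D.B) (s := D.Ω)
    refine ⟨fun θ θ' => ?_, fun c θ => ?_⟩
    · rw [costDeriv, h1.map_add, h2.map_add, ContinuousLinearMap.comp_add, costDeriv, costDeriv]
      abel
    · rw [costDeriv, h1.map_smul, h2.map_smul, ContinuousLinearMap.comp_smul, costDeriv, smul_add]
  have h1 : IsLinearMap ℝ fun θ : lipschitzFields D.B => sensitivity D.opν D.opε D.opκ
      (mulOp D.vol (reactionDeriv D.jc γ ω E)) (D.opε E + D.reactionOn γ ω E - D.source)
      D.targetL2 E w p q (opGrad D.vol θ) (opGradT D.vol θ) (opDiv D.vol θ) (opDir D.vol D.ν θ)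
      (opDir D.vol D.ε θ) (D.costDeriv θ)
      (toL2 D.vol fun x => fderiv ℝ D.f x ((θ : E3 → E3) x))
      (toL2 D.vol fun x => fderiv ℝ D.Ed x ((θ : E3 → E3) x)) :=
    isLinearMap_sensitivity isLinearMap_opGrad isLinearMap_opGradT isLinearMap_opDiv
      (isLinearMap_opDir hD.nu_material.c1) (isLinearMap_opDir hD.eps_material.c1) hc
      (isLinearMap_toL2_fderiv hD.f_c1) (isLinearMap_toL2_fderiv hD.Ed_c1)
  have h2 := isLinearMap_setIntegral_tr3 (B := D.B) (hD.volume_shape_ne_top hωB)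
  refine ⟨fun θ θ' => ?_, fun c θ => ?_⟩
  · rw [shapeDeriv, h1.map_add, h2.map_add, shapeDeriv, shapeDeriv]
    ring
  · rw [shapeDeriv, h1.map_smul, h2.map_smul, shapeDeriv, smul_add]

theorem hasEulerianSemiderivative (hγ : 0 < γ) (hω : MeasurableSet ω) (hωB : ω ⊆ D.B)
    {w₀ : E3 → E3} (hst : D.IsWeakState γ ω (D.state γ ω) w₀) {p q : D.L2Space}
    (hp : (p, q) ∈ hZero D.Ω)
    (hadj : ∀ v z, (v, z) ∈ hZero D.Ω → inner ℝ (D.opν z) q + inner ℝ (D.opε v) p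
      + inner ℝ (mulOp D.vol (reactionDeriv D.jc γ ω (toL2 D.vol (D.state γ ω))) v) p
        = -inner ℝ (D.opκ (toL2 D.vol (D.state γ ω) - D.targetL2)) v)
    (θ : lipschitzFields D.B) :
    HasEulerianSemiderivative (D.J γ) ω θ
      (D.shapeDeriv γ ω (toL2 D.vol (D.state γ ω)) (toL2 D.vol w₀) p q θ) := by
  obtain ⟨T, C, h⟩ := exists_isShapeFlow θ
  have hmeas : ∀ t, MeasurableSet (T t '' ω) := fun t =>
    (T t).measurableEmbedding.measurableSet_image.2 hω
  have hsub : ∀ᶠ t in 𝓝[>] (0 : ℝ), T t '' ω ⊆ D.Ω := h.deformation.mono fun t ht =>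
    ((Set.image_mono hωB).trans ht.image_eq.subset).trans hD.B_subset
  have hex : ∀ t, ∃ wt : E3 → E3, T t '' ω ⊆ D.Ω →
      D.IsWeakState γ (T t '' ω) (D.state γ (T t '' ω)) wt := fun t => by
    by_cases ht : T t '' ω ⊆ D.Ω
    · obtain ⟨wt, h1, h2⟩ := hD.isState_state hγ (hmeas t) ht
      exact ⟨wt, fun _ => ⟨h1, h2⟩⟩
    · exact ⟨0, fun h' => absurd h' ht⟩
  choose wt hwt using hex
  have hEt : ∀ᶠ t in 𝓝[>] (0 : ℝ),
      D.IsWeakState γ (T t '' ω) (D.state γ (T t '' ω)) (wt t) := hsub.mono fun t ht => hwt t ht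
  have hE := hD.isStateL2_toL2 hγ hω (hωB.trans hD.B_subset) hst.mem hst.eq
  have hP := hD.transportedProblem hγ hω hωB h hE hp hadj
    (Et := fun t => D.state γ (T t '' ω)) (wt := wt) hEt
  have htr := ((hD.tracking_transported h).and hEt).mono fun t ht => ht.1 _ ht.2.mem.memLp
  have key := hP.tendsto_sensitivity htr (hD.tracking_eq hst.mem.memLp)
  have hvol := h.tendsto_volume_quot hω (hD.volume_shape_ne_top hωB)
  have hsum := key.add hvol
  rw [HasEulerianSemiderivative, shapeDeriv]
  refine hsum.congr' ?_
  filter_upwards [h.flow] with t h1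
  rw [h1 ω, J, J]
  ring

set_option maxHeartbeats 1000000 in
/-- A bound for the shape derivative which is uniform in the penalty parameter. -/
theorem exists_abs_shapeDeriv_le (hω : MeasurableSet ω) (hωB : ω ⊆ D.B) (M₀ : ℝ) :
    ∃ C : ℝ, ∀ γ : ℝ, 0 < γ → ∀ E w p q : D.L2Space, ‖E‖ ≤ M₀ → ‖w‖ ≤ M₀ → ‖p‖ ≤ M₀ → ‖q‖ ≤ M₀ →
      ∀ θ : lipschitzFields D.B, |D.shapeDeriv γ ω E w p q θ| ≤ C * lipNorm D.B θ := by
  have := hD.isFiniteMeasure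
  obtain ⟨Mν, hν0, hν⟩ := hD.nu_material.c1.exists_fderiv_apply_le
  obtain ⟨Mε, hε0, hε⟩ := hD.eps_material.c1.exists_fderiv_apply_le
  obtain ⟨Mκ, hκ0, hκ⟩ := hD.kappaMat_c1.exists_fderiv_apply_le
  obtain ⟨Mf, hf0, hf⟩ := hD.f_c1.exists_fderiv_apply_le
  obtain ⟨Md, hd0, hd⟩ := hD.Ed_c1.exists_fderiv_apply_le
  -- This is $|\Omega|^{1/2}$, the factor that converts sup bounds into $L^2$ bounds.
  set s : ℝ := (measureUnivNNReal D.vol : ℝ) ^ (ENNReal.toReal 2)⁻¹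
  have hs : 0 ≤ s := by positivity
  have hjc := hD.jc_pos.le
  -- A sum of nonnegative quantities, each dominating one of the hypotheses of `abs_sensitivity_le`;
  -- none involves $\gamma$.
  set M : ℝ := |M₀| + ‖D.opν‖ + ‖D.opε‖ + ‖D.opκ‖ * (|M₀| + ‖D.targetL2‖)
    + (‖D.opε‖ * |M₀| + s * D.jc + ‖D.source‖) + (|M₀| + ‖D.targetL2‖) + 3 + Mν + Mε
    + (Mκ + ‖D.opκ‖ * 3) + s * Mf + s * Md + s * (2 * D.jc) with hM
  refine ⟨(8 * M ^ 3 + 4 * M ^ 4 + 3 * M ^ 2) + 3 * volume.real ω, ?_⟩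
  intro γ hγ E w p q hE hw hp hq θ
  set l := lipNorm D.B θ
  have hl : 0 ≤ l := lipNorm_nonneg _
  have g1 := norm_le_lipNorm θ
  have g2 := norm_fderiv_le_lipNorm hD.B_domain.isOpen θ
  have hone : ‖(1 : Mat3)‖ ≤ 1 := ContinuousLinearMap.norm_id_le
  have hE' := hE.trans (le_abs_self M₀)
  have hEd : ‖E - D.targetL2‖ ≤ |M₀| + ‖D.targetL2‖ :=
    (norm_sub_le _ _).trans (add_le_add_left hE' _)
  have n1 := norm_nonneg D.opν
  have n2 := norm_nonneg D.opε
  have n3 := norm_nonneg D.opκ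
  have n4 := norm_nonneg D.targetL2
  have n5 := norm_nonneg D.source
  have n6 := abs_nonneg M₀
  have z1 : 0 ≤ ‖D.opκ‖ * (|M₀| + ‖D.targetL2‖) := by positivity
  have z2 : 0 ≤ ‖D.opε‖ * |M₀| + s * D.jc + ‖D.source‖ := by positivity
  have z3 : 0 ≤ s * Mf := by positivity
  have z4 : 0 ≤ s * Md := by positivity
  have z5 : 0 ≤ s * (2 * D.jc) := by positivity
  have z6 : 0 ≤ Mκ + ‖D.opκ‖ * 3 := by positivity
  have up : ∀ {x c : ℝ}, x ≤ c * l → c ≤ M → x ≤ M * l := fun hx hc =>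
    hx.trans (mul_le_mul_of_nonneg_right hc hl)
  have hdivb : ‖opDiv D.vol θ‖ ≤ 3 * l := by
    refine norm_mulOp_le (by positivity) (memLp_clm_fderiv_field continuous_tr3_smul θ)
      (Eventually.of_forall fun x => ?_)
    rw [norm_smul, Real.norm_eq_abs]
    calc _ ≤ 3 * ‖fderiv ℝ (θ : E3 → E3) x‖ * 1 :=
          mul_le_mul (abs_tr3_le _) hone (norm_nonneg _) (by positivity)
      _ ≤ 3 * l := by
          rw [mul_one]
          exact mul_le_mul_of_nonneg_left (g2 x) (by norm_num)
  have hgradT : ‖opGradT D.vol θ‖ ≤ 1 * l := by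
    refine norm_mulOp_le (by positivity) (memLp_clm_fderiv_field continuous_adjoint3 θ)
      (Eventually.of_forall fun x => ?_)
    rw [one_mul, LinearIsometryEquiv.norm_map]
    exact g2 x
  have hdir : ∀ {g : E3 → Mat3} {c : ℝ}, IsC1On D.B g → 0 ≤ c →
      (∀ θ : E3 → E3, tsupport θ ⊆ D.B → ∀ x, ‖fderiv ℝ g x (θ x)‖ ≤ c * ‖θ x‖) →
      ‖opDir D.vol g θ‖ ≤ c * l := fun hg hc h =>
    norm_mulOp_le (by positivity) (hg.memLp_fderiv_field θ) (Eventually.of_forall fun x =>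
      (h θ θ.2.2.2 x).trans (mul_le_mul_of_nonneg_left (g1 x) hc))
  have hvec : ∀ {g : E3 → E3} {c : ℝ}, IsC1On D.B g → 0 ≤ c →
      (∀ θ : E3 → E3, tsupport θ ⊆ D.B → ∀ x, ‖fderiv ℝ g x (θ x)‖ ≤ c * ‖θ x‖) →
      ‖toL2 D.vol fun x => fderiv ℝ g x ((θ : E3 → E3) x)‖ ≤ s * c * l := by
    intro g c hg hc h
    have hm : MemLp (fun x => fderiv ℝ g x ((θ : E3 → E3) x)) 2 D.vol :=
      (hg.memLp_fderiv_field θ).mono_exponent le_top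
    rw [mul_assoc]
    refine Lp.norm_le_of_ae_bound (by positivity) ?_
    filter_upwards [coeFn_toL2 hm] with x hx
    rw [hx]
    exact (h θ θ.2.2.2 x).trans (mul_le_mul_of_nonneg_left (g1 x) hc)
  have hcost : ‖D.costDeriv θ‖ ≤ (Mκ + ‖D.opκ‖ * 3) * l := by
    rw [add_mul, mul_assoc]
    refine (norm_add_le _ _).trans (add_le_add (hdir hD.kappaMat_c1 hκ0 hκ) ?_)
    exact (ContinuousLinearMap.opNorm_comp_le _ _).trans (mul_le_mul_of_nonneg_left hdivb n3)
  -- The decisive estimate. The transposed Jacobian is applied pointwise to $E$ itself, so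
  -- $|\Lambda_\gamma'(E)|\,|E|\le 2j_c$ can be used before taking the $L^2$ norm.
  have hreact : ‖mulOp D.vol (reactionDeriv D.jc γ ω E) (opGradT D.vol θ E)‖
      ≤ s * (2 * D.jc) * l := by
    rw [mul_assoc]
    refine Lp.norm_le_of_ae_bound (by positivity) ?_
    have hm := memLp_reactionDeriv (μ := D.vol) hD.jc_pos hγ hω (Lp.aestronglyMeasurable E)
    filter_upwards [coeFn_mulOp hm (opGradT D.vol θ E),
      coeFn_mulOp (memLp_clm_fderiv_field continuous_adjoint3 θ) E] with x k1 k2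
    rw [k1, opGradT, k2]
    have k3 : ‖ContinuousLinearMap.adjoint (fderiv ℝ (θ : E3 → E3) x) (E x)‖ ≤ l * ‖E x‖ :=
      ContinuousLinearMap.le_of_opNorm_le _ (by
        rw [LinearIsometryEquiv.norm_map]
        exact g2 x) _
    have k4 := norm_reactionDeriv_mul_le (s := ω) hD.jc_pos hγ E x
    calc _ ≤ ‖reactionDeriv D.jc γ ω E x‖ * (l * ‖E x‖) :=
          (ContinuousLinearMap.le_opNorm _ _).trans
            (mul_le_mul_of_nonneg_left k3 (norm_nonneg _))
      _ = ‖reactionDeriv D.jc γ ω E x‖ * ‖E x‖ * l := by ring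
      _ ≤ 2 * D.jc * l := mul_le_mul_of_nonneg_right k4 hl
  have hZ : ‖D.opε E + D.reactionOn γ ω E - D.source‖
      ≤ ‖D.opε‖ * |M₀| + s * D.jc + ‖D.source‖ := by
    refine (norm_sub_le _ _).trans (add_le_add_left ((norm_add_le _ _).trans (add_le_add ?_ ?_)) _)
    · exact (D.opε.le_opNorm E).trans (mul_le_mul_of_nonneg_left hE' n2)
    · exact norm_reaction_le hD.jc_pos hγ hω E
  have hsens := abs_sensitivity_le (N := D.opν) (Ep := D.opε) (K := D.opκ)
    (Λ' := mulOp D.vol (reactionDeriv D.jc γ ω E)) (Z := D.opε E + D.reactionOn γ ω E - D.source)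
    (d := D.targetL2) (E := E) (w := w) (p := p) (q := q) (R₀ := opGrad D.vol θ)
    (Rs₀ := opGradT D.vol θ) (τ₀ := opDiv D.vol θ) (N₀ := opDir D.vol D.ν θ)
    (Ep₀ := opDir D.vol D.ε θ) (K₀ := D.costDeriv θ)
    (f₀ := toL2 D.vol fun x => fderiv ℝ D.f x ((θ : E3 → E3) x))
    (d₀ := toL2 D.vol fun x => fderiv ℝ D.Ed x ((θ : E3 → E3) x)) (M := M) (l := l) hl
    (by linarith) (by linarith)
    ((D.opκ.le_opNorm _).trans ((mul_le_mul_of_nonneg_left hEd n3).trans (by linarith)))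
    (hZ.trans (by linarith)) (hEd.trans (by linarith)) (hE'.trans (by linarith))
    ((hw.trans (le_abs_self M₀)).trans (by linarith))
    ((hp.trans (le_abs_self M₀)).trans (by linarith))
    ((hq.trans (le_abs_self M₀)).trans (by linarith))
    (up (c := 1) ?_ (by linarith)) (up hgradT (by linarith)) (up hdivb (by linarith))
    (up (hdir hD.nu_material.c1 hν0 hν) (by linarith))
    (up (hdir hD.eps_material.c1 hε0 hε) (by linarith)) (up hcost (by linarith))
    (up (hvec hD.f_c1 hf0 hf) (by linarith)) (up (hvec hD.Ed_c1 hd0 hd) (by linarith))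
    (up hreact (by linarith))
  · have hdiv : |∫ x in ω, tr3 (fderiv ℝ (θ : E3 → E3) x)| ≤ 3 * volume.real ω * l := by
      have h3 : ∀ x ∈ ω, ‖tr3 (fderiv ℝ (θ : E3 → E3) x)‖ ≤ 3 * l := fun x _ =>
        (abs_tr3_le _).trans (mul_le_mul_of_nonneg_left (g2 x) (by norm_num))
      rw [mul_right_comm]
      exact norm_setIntegral_le_of_norm_le_const (hD.volume_shape_ne_top hωB).lt_top h3
    rw [shapeDeriv, add_mul]
    exact (abs_add_le _ _).trans (add_le_add hsens hdiv)
  · refine norm_mulOp_le (by positivity) (memLp_clm_fderiv_field continuous_id θ)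
      (Eventually.of_forall fun x => ?_)
    rw [one_mul]
    exact g2 x

/-- Shape differentiability with a bound uniform in the penalty parameter. -/
theorem exists_hasShapeDerivative (hω : MeasurableSet ω) (hωB : ω ⊆ D.B) :
    ∃ C : ℝ, ∀ γ : ℝ, 0 < γ → ∃ dJ : lipschitzFields D.B →ₗ[ℝ] ℝ,
      HasShapeDerivative D.B (D.J γ) ω dJ ∧
        ∀ θ : lipschitzFields D.B, |dJ θ| ≤ C * lipNorm D.B θ := by
  obtain ⟨M₁, hM₁⟩ := hD.exists_norm_state_le
  obtain ⟨M₂, hM₂⟩ := hD.exists_adjoint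
  set M₃ : ℝ := ‖D.opκ‖ * (|M₁| + ‖D.targetL2‖)
  have hM₃ : 0 ≤ M₃ := by positivity
  -- The single radius bounds both pairs: the state by $|M_1|$, and the adjoint state by $|M_2|$
  -- times the bound $M_3$ for its right-hand side.
  obtain ⟨C, hC⟩ := hD.exists_abs_shapeDeriv_le hω hωB (|M₁| + |M₂| * M₃)
  refine ⟨C, fun γ hγ => ?_⟩
  obtain ⟨w₀, h1, h2⟩ := hD.isState_state hγ hω (hωB.trans hD.B_subset)
  have hst : D.IsWeakState γ ω (D.state γ ω) w₀ := ⟨h1, h2⟩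
  have hE := hD.isStateL2_toL2 hγ hω (hωB.trans hD.B_subset) h1 h2
  obtain ⟨k1, k2⟩ := hM₁ γ hγ ω hω _ _ hE
  obtain ⟨p, q, hp, hadj, k3, k4⟩ := hM₂ γ hγ ω hω (toL2 D.vol (D.state γ ω))
    (D.opκ (toL2 D.vol (D.state γ ω) - D.targetL2))
  have k5 : ‖D.opκ (toL2 D.vol (D.state γ ω) - D.targetL2)‖ ≤ M₃ := by
    refine (D.opκ.le_opNorm _).trans (mul_le_mul_of_nonneg_left ?_ (norm_nonneg _))
    exact (norm_sub_le _ _).trans (add_le_add_left (k1.trans (le_abs_self M₁)) _)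
  have k6 : M₂ * ‖D.opκ (toL2 D.vol (D.state γ ω) - D.targetL2)‖ ≤ |M₂| * M₃ :=
    mul_le_mul (le_abs_self M₂) k5 (norm_nonneg _) (abs_nonneg M₂)
  have k7 : 0 ≤ |M₂| * M₃ := by positivity
  have k8 := abs_nonneg M₁
  have k9 := le_abs_self M₁
  have hb := hC γ hγ (toL2 D.vol (D.state γ ω)) (toL2 D.vol w₀) p q (by linarith) (by linarith)
    (by linarith) (by linarith)
  exact ⟨(hD.isLinearMap_shapeDeriv hωB _ _ p q).mk' _,
    ⟨hD.hasEulerianSemiderivative hγ hω hωB hst hp hadj, C, hb⟩, hb⟩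

end Admissible

end ProblemData

end HTS

end

theorem theorem5p1 (D : HTS.ProblemData) (hD : D.Admissible) (L : NNReal)
    (ω : Set HTS.E3) (hω : ω ∈ HTS.admissibleShapes D.B L) :
    ∃ C : ℝ, ∀ γ : ℝ, 0 < γ →
      ∃ dJ : HTS.lipschitzFields D.B →ₗ[ℝ] ℝ,
        HTS.HasShapeDerivative D.B (D.J γ) ω dJ ∧
        ∀ θ : HTS.lipschitzFields D.B, |dJ θ| ≤ C * HTS.lipNorm D.B θ := by
  exact hD.exists_hasShapeDerivative hω.2.1.measurableSet hω.1
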